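/- Let $\mathbb{D}=\{|z|<1\}$, $B(0,r)=\{|z|<r\}$ and $A(0;s,t)=\{s<|w|<t\}$. An inner function is a holomorphic map $F:\mathbb{D}\to\mathbb{D}$ such that for a.e. $\zeta\in\partial\mathbb{D}$ the radial limit $\lim_{r\to1^-}F(r\zeta)$ exists and has absolute value $1$. Let $\Sigma\subset\partial\mathbb{D}$ be the (closed) set of points $\zeta\in\partial\mathbb{D}$ such that $F$ has no analytic extension to a neighbourhood of $\zeta$. At $\zeta\in\partial\mathbb{D}\setminus\Sigma$, the symbols $F(\zeta),F'(\zeta),F''(\zeta)$ refer to the analytic extension of $F$ near $\zeta$; and $F$ is regarded as a meromorphic function $\hat{\mathbb{C}}\setminus\Sigma\to\hat{\mathbb{C}}$ by setting $F(z)=1/\overline{F(1/\bar z)}$ for $|z|>1$ (including $z=\infty$). A map $f:X\to Y$ is said to be a covering map over an open set $A\subset Y$ if every point of $A$ has an open neighbourhood that is evenly covered by $f$. Theorem. Let $F:\mathbb{D}\to\mathbb{D}$ be an inner function. The following are equivalent: (a) The set $F^{-1}(B(0,r))$ is connected for some $0<r<1$. (b) There is $0<\rho<1$ such that $F:\mathbb{D}\to\mathbb{D}$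 is a covering map over the annulus $A(0;\rho,1)$. (c) There is $0<\rho<1$ such that $F:\hat{\mathbb{C}}\setminus\Sigma\to\hat{\mathbb{C}}$ is a covering map over the annulus $A(0;\rho,1/\rho)$. (d) The set $\Sigma$ has Lebesgue measure $0$ on $\partial\mathbb{D}$; $|F'(\zeta)|\to\infty$ as $\zeta\in\partial\mathbb{D}\setminus\Sigma$ approaches $\Sigma$; and there is a constant $C>0$ with $$\left|\frac{F''(\zeta)}{F'(\zeta)^2}\right|\le C,\qquad \zeta\in\partial\mathbb{D}\setminus\Sigma.$$ If any of these conditions holds, then $\Sigma$ is equal to the set of points $\zeta\in\partial\mathbb{D}$ at which the radial limit of $F$ does not exist or is not unimodular. -/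

import Mathlib

open Set Filter Topology MeasureTheory

noncomputable section

/-- `F` has a unimodular radial limit at the point `ζ` of the unit circle: `lim_{r → 1⁻} F (r ζ)`
exists and has absolute value `1`. -/
def HasUnimodularRadialLimit (F : ℂ → ℂ) (ζ : ℂ) : Prop :=
  ∃ w : ℂ, ‖w‖ = 1 ∧ Tendsto (fun r : ℝ => F ((r : ℂ) * ζ)) (𝓝[<] (1 : ℝ)) (𝓝 w)

/-- `F` is an inner function: a holomorphic map of the open unit disk into itself with unimodular
radial limits at almost every point `e ^ (iθ)` of the unit circle. Only the values of `F` on the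
open unit disk are relevant. -/
structure IsInnerFunction (F : ℂ → ℂ) : Prop where
  holomorphic : DifferentiableOn ℂ F (Metric.ball 0 1)
  mapsTo : MapsTo F (Metric.ball 0 1) (Metric.ball 0 1)
  radial : ∀ᵐ θ : ℝ ∂(volume.restrict (Ico 0 (2 * Real.pi))),
    HasUnimodularRadialLimit F (Complex.exp (θ * Complex.I))

/-- `G` is an analytic extension of `F` (a function on the open unit disk) to a neighbourhood of
the point `ζ`. -/
def IsAnalyticExtensionAt (F G : ℂ → ℂ) (ζ : ℂ) : Prop :=
  AnalyticAt ℂ G ζ ∧ G =ᶠ[𝓝[Metric.ball 0 1] ζ] F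

/-- The singular set `Σ` of `F`: the points of the unit circle at which `F` does not admit an
analytic extension. -/
def singularSet (F : ℂ → ℂ) : Set ℂ :=
  {ζ | ζ ∈ Metric.sphere (0 : ℂ) 1 ∧ ¬ ∃ G : ℂ → ℂ, IsAnalyticExtensionAt F G ζ}

/-- Analytic extensions at a point of the unit circle are unique as germs. -/
theorem IsAnalyticExtensionAt.unique {F G H : ℂ → ℂ} {ζ : ℂ} (hζ : ζ ∈ Metric.sphere (0 : ℂ) 1)
    (hG : IsAnalyticExtensionAt F G ζ) (hH : IsAnalyticExtensionAt F H ζ) : G =ᶠ[𝓝 ζ] H := by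
  have hz : ‖ζ‖ = 1 := by simpa using hζ
  have hcl : ζ ∈ closure (Metric.ball (0 : ℂ) 1) := by
    rw [closure_ball _ one_ne_zero]
    simp [hz]
  have hne : (𝓝[Metric.ball (0 : ℂ) 1] ζ).NeBot := mem_closure_iff_nhdsWithin_neBot.mp hcl
  have hsub : Metric.ball (0 : ℂ) 1 ⊆ {ζ}ᶜ := by
    rintro w hw rfl
    rw [mem_ball_zero_iff, hz] at hw
    exact lt_irrefl _ hw
  have hfreq : ∃ᶠ z in 𝓝[≠] ζ, G z = H z :=
    ((hG.2.trans hH.2.symm).frequently).filter_mono (nhdsWithin_mono _ hsub)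
  exact (hG.1.frequently_eq_iff_eventually_eq hH.1).mp hfreq

/-- The (germ at `ζ` of the) analytic extension of `F` to a neighbourhood of `ζ`, for `ζ` on the
unit circle off the singular set; a junk function if `F` has no analytic extension at `ζ`.
So `F (ζ)`, `F' (ζ)`, `F'' (ζ)` for `ζ ∈ ∂𝔻 ∖ Σ` are `boundaryExtension F ζ ζ`,
`deriv (boundaryExtension F ζ) ζ`, `iteratedDeriv 2 (boundaryExtension F ζ) ζ`. -/
def boundaryExtension (F : ℂ → ℂ) (ζ : ℂ) : ℂ → ℂ :=
  Classical.epsilon fun G : ℂ → ℂ => IsAnalyticExtensionAt F G ζ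

/-- Reflection of a point of `ℂ` in the unit circle, `w ↦ 1 / conj w`, with values in the Riemann
sphere (`0 ↦ ∞`). -/
def circleReflection (w : ℂ) : OnePoint ℂ :=
  if w = 0 then OnePoint.infty else (((starRingEnd ℂ) w)⁻¹ : ℂ)

/-- `F` as a function on the Riemann sphere minus its singular set: `F` in the open unit disk, the
values of the analytic extensions on the unit circle, and `z ↦ 1 / conj (F (1 / conj z))` outside
the closed unit disk (including `∞`). On the singular set the value is junk. -/
def sphereExtension (F : ℂ → ℂ) : OnePoint ℂ → OnePoint ℂ
  | OnePoint.infty => circleReflection (F 0)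
  | OnePoint.some z =>
      if ‖z‖ < 1 then ((F z : ℂ) : OnePoint ℂ)
      else if ‖z‖ = 1 then ((boundaryExtension F z z : ℂ) : OnePoint ℂ)
      else circleReflection (F ((starRingEnd ℂ) z)⁻¹)

/-- `F⁻¹ (B (0, r))` is connected for some `0 < r < 1`. -/
def HasConnectedSublevel (F : ℂ → ℂ) : Prop :=
  ∃ r : ℝ, 0 < r ∧ r < 1 ∧ IsConnected {z : ℂ | z ∈ Metric.ball (0 : ℂ) 1 ∧ ‖F z‖ < r}

/-- The map `F`, defined on the open unit disk, is a covering map over an annulus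
`{ρ < |w| < 1}` with `0 < ρ < 1`. -/
def IsCoveringOverAnnulus (F : ℂ → ℂ) : Prop :=
  ∃ ρ : ℝ, 0 < ρ ∧ ρ < 1 ∧
    IsCoveringMapOn (fun z : Metric.ball (0 : ℂ) 1 => F z) {w : ℂ | ρ < ‖w‖ ∧ ‖w‖ < 1}

/-- The map `F`, defined on the Riemann sphere minus the singular set and with values in the
Riemann sphere, is a covering map over an annulus `{ρ < |w| < 1 / ρ}` with `0 < ρ < 1`. -/
def IsCoveringOverSymmetricAnnulus (F : ℂ → ℂ) : Prop :=
  ∃ ρ : ℝ, 0 < ρ ∧ ρ < 1 ∧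
    IsCoveringMapOn
      (fun p : {p : OnePoint ℂ // p ∉ ((↑) : ℂ → OnePoint ℂ) '' singularSet F} =>
        sphereExtension F p)
      (((↑) : ℂ → OnePoint ℂ) '' {w : ℂ | ρ < ‖w‖ ∧ ‖w‖ < 1 / ρ})

/-- The singular set has Lebesgue measure zero, `|F' (ζ)| → ∞` as `ζ ∈ ∂𝔻 ∖ Σ` approaches the set
`Σ`, and `|F'' / F' ^ 2|` is bounded on `∂𝔻 ∖ Σ`. -/
def HasBoundaryDerivativeBounds (F : ℂ → ℂ) : Prop :=
  volume {θ : ℝ | θ ∈ Ico 0 (2 * Real.pi) ∧ Complex.exp (θ * Complex.I) ∈ singularSet F} = 0 ∧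
  Tendsto (fun ζ : ℂ => ‖deriv (boundaryExtension F ζ) ζ‖)
    (𝓝ˢ (singularSet F) ⊓ 𝓟 (Metric.sphere (0 : ℂ) 1 \ singularSet F)) atTop ∧
  ∃ C : ℝ, 0 < C ∧ ∀ ζ ∈ Metric.sphere (0 : ℂ) 1 \ singularSet F,
    ‖iteratedDeriv 2 (boundaryExtension F ζ) ζ / deriv (boundaryExtension F ζ) ζ ^ 2‖ ≤ C

end

/-! The implications proved are (b) ⇒ (a) ⇒ (d) ⇒ (c) ⇒ (b); the description of `Σ` comes out of (a)
along the way.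

(b) ⇒ (a): the radial contraction of the annulus onto its part inside `‖w‖ ≤ s` lifts through the
covering. The lift retracts the whole disk onto `{‖F‖ ≤ s}`, which is therefore connected.

(a) ⇒ (d): let `Ω = {‖F‖ < r}`. Away from `Ω` the function is bounded below, so `F` and its Schwarz
reflection are bounded on both sides of the circle and have equal boundary values almost everywhere;
they glue analytically (`notMem_singularSet_of_le`). Thus `Σ` lies in the closure of `Ω`.
Conversely, when the connected set `Ω` comes close to a point `ζ` of the circle, a harmonic measure
estimate (`norm_le_of_isPreconnected_of_dist`) keeps `F` away from modulus `1` on the radius at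
every scale between the distance to `Ω` and a fixed one. So there is no unimodular radial limit at a
point of the closure, which identifies `Σ`, and Julia's inequality gives `dist(ζ, Ω) * ‖F'(ζ)‖ ≥ c`
at regular points. Since `F` extends boundedly to the disk of radius `dist(ζ, Ω)`, Cauchy's estimate
bounds `F'' / F' ^ 2`.

(d) ⇒ (c): the bound on `F'' / F' ^ 2` says that `1 / F'` has bounded derivative along the circle,
and the blow-up of `F'` makes it continuous when set to `0` on `Σ`. Hence `boundaryGauge`, equal to
`1 / ‖F'‖`, is Lipschitz. Disks of radius a small multiple of the gauge are then disks on which the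
extension is injective and nearly affine (`IsLinearizationScale`). A maximum principle which ignores
the null set `Σ` shows that `F` is close to the circle only inside these disks, so they supply the
sheets over a neighbourhood of each point of the circle.

(c) ⇒ (b): the sphere map takes values in the open disk exactly on the open disk. -/

noncomputable section

/-! ### Maximum principle with an exceptional null set on the circle. -/

/-- Maximum modulus principle with boundary upper limits. -/
theorem norm_le_of_eventually_frontier {U : Set ℂ} (hU : IsOpen U) (hb : Bornology.IsBounded U)
    {f : ℂ → ℂ} (hf : DifferentiableOn ℂ f U) {M : ℝ}
    (h : ∀ ξ ∈ frontier U, ∀ M' > M, ∀ᶠ z in 𝓝[U] ξ, ‖f z‖ ≤ M') {z : ℂ} (hz : z ∈ U) :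
    ‖f z‖ ≤ M := by
  refine le_of_forall_gt_imp_ge_of_dense fun M' hM' => ?_
  by_contra hcon
  push Not at hcon
  -- The boundary hypothesis keeps the closure of this superlevel set inside `U`, so the classical
  -- maximum principle applies to it, with `‖f‖ ≤ M'` on its frontier.
  set V : Set ℂ := U ∩ {w | M' < ‖f w‖} with hV
  have hVo : IsOpen V := hf.continuousOn.norm.isOpen_inter_preimage hU isOpen_Ioi
  have hVU : closure V ⊆ U := by
    intro ξ hξ
    by_contra hξU
    have hfr : ξ ∈ frontier U := by
      rw [hU.frontier_eq]
      exact ⟨closure_mono inter_subset_left hξ, hξU⟩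
    have h1 := h ξ hfr M' hM'
    have h2 : ∀ᶠ w in 𝓝[V] ξ, ‖f w‖ ≤ M' := h1.filter_mono (nhdsWithin_mono _ inter_subset_left)
    have := mem_closure_iff_nhdsWithin_neBot.mp hξ
    obtain ⟨w, hw1, hw2⟩ := (h2.and self_mem_nhdsWithin).exists
    exact absurd hw1 (not_le.mpr hw2.2)
  have hd : DiffContOnCl ℂ f V := (hf.mono hVU).diffContOnCl
  have := Complex.norm_le_of_forall_mem_frontier_norm_le (hb.subset inter_subset_left) hd
    (C := M') (fun ξ hξ => by
      rw [hVo.frontier_eq] at hξ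
      by_contra hlt
      exact hξ.2 ⟨hVU hξ.1, not_le.mp hlt⟩) (subset_closure (⟨hz, hcon⟩ : z ∈ V))
  exact absurd this (not_le.mpr hcon)

/-- A compact null set of reals has finite covers by intervals of small total length. -/
theorem exists_finset_cover_sum_lt {K : Set ℝ} (hK : IsCompact K) (h0 : volume K = 0) {ε : ℝ}
    (hε : 0 < ε) :
    ∃ (t : Finset ℝ) (r : ℝ → ℝ), (∀ x ∈ t, 0 < r x) ∧ (∀ y ∈ K, ∃ x ∈ t, |y - x| < r x) ∧
      ∑ x ∈ t, r x ≤ ε := by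
  obtain ⟨t, r, htc, htK, hr, hcov, hsum⟩ := Besicovitch.exists_closedBall_covering_tsum_measure_le
    (volume : Measure ℝ) (ε := ENNReal.ofReal ε) (by simpa using hε) (fun _ => Ioi 0) K
    (fun x _ δ hδ => ⟨δ / 2, by simp [hδ], by simp [hδ]⟩)
  rw [h0, zero_add] at hsum
  obtain ⟨s, hst, hs⟩ := hK.elim_finite_subcover_image (b := t)
    (c := fun x => Metric.ball x (2 * r x)) (fun _ _ => Metric.isOpen_ball) (by
      refine hcov.trans (iUnion₂_mono fun x hx => Metric.closedBall_subset_ball ?_)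
      have := hr x hx
      simp only [mem_Ioi] at this
      linarith)
  obtain ⟨hsf, hs⟩ := hs
  refine ⟨hsf.toFinset, fun x => 2 * r x, ?_, ?_, ?_⟩
  · intro x hx
    have := hr x (hst (hsf.mem_toFinset.mp hx))
    simp only [mem_Ioi] at this
    linarith
  · intro y hy
    obtain ⟨x, hx, hxy⟩ := mem_iUnion₂.mp (hs hy)
    exact ⟨x, hsf.mem_toFinset.mpr hx, by simpa [Real.dist_eq] using hxy⟩
  · have h1 : ∑ x ∈ hsf.toFinset, volume (Metric.closedBall x (r x)) ≤ ENNReal.ofReal ε := by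
      refine le_trans ?_ hsum
      rw [← Finset.tsum_subtype hsf.toFinset (fun x => volume (Metric.closedBall x (r x)))]
      exact ENNReal.tsum_mono_subtype (fun x => volume (Metric.closedBall x (r x)))
        (fun x hx => hst (hsf.mem_toFinset.mp hx))
    simp only [Real.volume_closedBall] at h1
    rw [← ENNReal.ofReal_sum_of_nonneg] at h1
    · exact (ENNReal.ofReal_le_ofReal_iff hε.le).mp h1
    · intro x hx
      have := hr x (hst (hsf.mem_toFinset.mp hx))
      simp only [mem_Ioi] at this
      linarith

theorem re_le_of_norm_eq_one {z ξ : ℂ} (hξ : ‖ξ‖ = 1) :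
    (z * (starRingEnd ℂ) ξ).re ≤ ‖z‖ := by
  refine (Complex.re_le_norm _).trans ?_
  simp [hξ]

/-- A closed null subset `S` of the circle admits holomorphic functions on the disk with
nonnegative real part which is at least `1` near `S` and arbitrarily small on compact sets. -/
theorem exists_barrier {S : Set ℂ} (hS : IsClosed S) (hS1 : S ⊆ Metric.sphere 0 1)
    (h0 : volume {θ : ℝ | θ ∈ Ico 0 (2 * Real.pi) ∧ Complex.exp (θ * Complex.I) ∈ S} = 0)
    {ε : ℝ} (hε : 0 < ε) :
    ∃ H : ℂ → ℂ, DifferentiableOn ℂ H (Metric.ball 0 1) ∧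
      (∀ z ∈ Metric.ball (0 : ℂ) 1, 0 ≤ (H z).re) ∧
      (∀ z ∈ Metric.ball (0 : ℂ) 1, (H z).re ≤ ε / (1 - ‖z‖)) ∧
      ∀ σ ∈ S, ∀ᶠ z in 𝓝[Metric.ball 0 1] σ, 1 ≤ (H z).re := by
  -- The closed interval makes `K` compact; the added endpoint is a null set.
  set K : Set ℝ := {θ : ℝ | θ ∈ Icc 0 (2 * Real.pi) ∧ Complex.exp (θ * Complex.I) ∈ S} with hKdef
  have hKc : IsCompact K := by
    refine isCompact_Icc.inter_right (hS.preimage ?_)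
    fun_prop
  have hK0 : volume K = 0 := by
    refine measure_mono_null (t := _ ∪ {2 * Real.pi}) ?_ (measure_union_null h0 (by simp))
    rintro θ ⟨hθ, hθS⟩
    rcases eq_or_lt_of_le hθ.2 with h | h
    · right; exact h
    · left; exact ⟨⟨hθ.1, h⟩, hθS⟩
  obtain ⟨t, r, hr, hcov, hsum⟩ := exists_finset_cover_sum_lt hKc hK0 (ε := ε / 4) (by positivity)
  set e : ℝ → ℂ := fun x => Complex.exp (x * Complex.I) with he
  have hen : ∀ x, ‖e x‖ = 1 := fun x => Complex.norm_exp_ofReal_mul_I x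
  set q : ℝ → ℂ → ℂ := fun x z => 1 + r x - z * (starRingEnd ℂ) (e x) with hq
  have hqre : ∀ x ∈ t, ∀ z ∈ Metric.ball (0 : ℂ) 1, r x + (1 - ‖z‖) ≤ (q x z).re := by
    intro x hx z hz
    rw [mem_ball_zero_iff] at hz
    have := re_le_of_norm_eq_one (z := z) (hen x)
    simp only [hq, Complex.sub_re, Complex.add_re, Complex.one_re, Complex.ofReal_re]
    linarith
  have hqpos : ∀ x ∈ t, ∀ z ∈ Metric.ball (0 : ℂ) 1, 0 < (q x z).re := by
    intro x hx z hz
    have := hqre x hx z hz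
    have h2 := hr x hx
    rw [mem_ball_zero_iff] at hz
    linarith
  have hterm : ∀ x z, ((4 * r x : ℂ) / q x z).re = 4 * r x * ((q x z).re / ‖q x z‖ ^ 2) := by
    intro x z
    rw [div_eq_mul_inv, show (4 * r x : ℂ) = ((4 * r x : ℝ) : ℂ) by push_cast; ring,
      Complex.re_ofReal_mul, Complex.inv_re, Complex.normSq_eq_norm_sq]
  -- Each term has its pole at `(1 + r x) * e x`, just outside the disk. Within distance `r x` of `e
  -- x` one has `Re q ≥ r x` and `‖q‖ ≤ 2 * r x`, so the term has real part at least `1`. In general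
  -- `Re (1 / q) ≤ 1 / (1 - ‖z‖)`, and the radii sum to at most `ε / 4`.
  refine ⟨fun z => ∑ x ∈ t, (4 * r x : ℂ) / q x z, ?_, ?_, ?_, ?_⟩
  · refine DifferentiableOn.fun_sum fun x hx => ?_
    refine DifferentiableOn.div (by fun_prop) (by fun_prop) fun z hz h => ?_
    have := hqpos x hx z hz
    rw [h] at this
    simp at this
  · intro z hz
    rw [Complex.re_sum]
    refine Finset.sum_nonneg fun x hx => ?_
    rw [hterm]
    have := hr x hx
    have := hqpos x hx z hz
    positivity
  · intro z hz
    rw [Complex.re_sum]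
    have hz1 : 0 < 1 - ‖z‖ := by rw [mem_ball_zero_iff] at hz; linarith
    calc _ ≤ ∑ x ∈ t, 4 * r x * (1 / (1 - ‖z‖)) := by
          refine Finset.sum_le_sum fun x hx => ?_
          rw [hterm]
          have h1 := hr x hx
          have h2 := hqre x hx z hz
          have h3 := Complex.re_le_norm (q x z)
          have h4 := hqpos x hx z hz
          have h5 : 0 < ‖q x z‖ := h4.trans_le h3
          refine mul_le_mul_of_nonneg_left ?_ (by positivity)
          rw [div_le_div_iff₀ (by positivity) hz1]
          nlinarith
      _ = 4 * (∑ x ∈ t, r x) / (1 - ‖z‖) := by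
          rw [Finset.mul_sum, Finset.sum_div]
          refine Finset.sum_congr rfl fun x _ => by ring
      _ ≤ _ := by
          gcongr
          linarith
  · intro σ hσ
    have hσ1 : ‖σ‖ = 1 := by simpa using hS1 hσ
    obtain ⟨θ, hθ, hθσ⟩ : ∃ θ ∈ K, e θ = σ := by
      refine ⟨toIcoMod Real.two_pi_pos 0 (Complex.arg σ), ?_, ?_⟩
      · have hmem := toIcoMod_mem_Ico Real.two_pi_pos 0 (Complex.arg σ)
        rw [zero_add] at hmem
        refine ⟨Ico_subset_Icc_self hmem, ?_⟩
        convert hσ using 1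
        rw [toIcoMod]
        push_cast [zsmul_eq_mul]
        rw [show ((σ.arg : ℂ) - (toIcoDiv Real.two_pi_pos 0 σ.arg : ℂ) * (2 * Real.pi)) * Complex.I
          = σ.arg * Complex.I - (toIcoDiv Real.two_pi_pos 0 σ.arg : ℤ) * (2 * Real.pi * Complex.I)
          by ring, Complex.exp_periodic.sub_int_mul_eq]
        have := Complex.norm_mul_exp_arg_mul_I σ
        rwa [hσ1, Complex.ofReal_one, one_mul] at this
      · simp only [he]
        rw [toIcoMod]
        push_cast [zsmul_eq_mul]
        rw [show ((σ.arg : ℂ) - (toIcoDiv Real.two_pi_pos 0 σ.arg : ℂ) * (2 * Real.pi)) * Complex.I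
          = σ.arg * Complex.I - (toIcoDiv Real.two_pi_pos 0 σ.arg : ℤ) * (2 * Real.pi * Complex.I)
          by ring, Complex.exp_periodic.sub_int_mul_eq]
        have := Complex.norm_mul_exp_arg_mul_I σ
        rwa [hσ1, Complex.ofReal_one, one_mul] at this
    obtain ⟨x, hx, hxr⟩ := hcov θ hθ
    have hdist : dist σ (e x) < r x := by
      refine lt_of_le_of_lt ?_ hxr
      rw [← hθσ, dist_eq_norm]
      have h1 : e θ - e x = e x * (Complex.exp (Complex.I * (θ - x : ℝ)) - 1) := by
        simp only [he]
        rw [mul_sub, mul_one, ← Complex.exp_add]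
        congr 2
        push_cast
        ring
      rw [h1, norm_mul, hen, one_mul]
      exact (Real.norm_exp_I_mul_ofReal_sub_one_le).trans_eq (Real.norm_eq_abs _)
    have hev : ∀ᶠ z in 𝓝 σ, dist z (e x) < r x :=
      (continuous_id.dist continuous_const).continuousAt.eventually_lt continuousAt_const hdist
    filter_upwards [nhdsWithin_le_nhds hev, self_mem_nhdsWithin] with z hz hzb
    rw [Complex.re_sum]
    have hone : 1 ≤ ((4 * r x : ℂ) / q x z).re := by
      rw [hterm]
      have h1 := hr x hx
      have h2 := hqre x hx z hzb
      have hz1 : 0 < 1 - ‖z‖ := by rw [mem_ball_zero_iff] at hzb; linarith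
      have h3 : ‖q x z‖ ≤ 2 * r x := by
        have : q x z = r x + (e x - z) * (starRingEnd ℂ) (e x) := by
          simp only [hq]
          rw [sub_mul, Complex.mul_conj, Complex.normSq_eq_norm_sq, hen]
          push_cast
          ring
        rw [this]
        refine (norm_add_le _ _).trans ?_
        rw [norm_mul, RCLike.norm_conj, hen, mul_one, Complex.norm_real, Real.norm_eq_abs,
          abs_of_pos h1, norm_sub_rev, ← dist_eq_norm]
        linarith
      have h4 : 0 < ‖q x z‖ := lt_of_lt_of_le (hqpos x hx z hzb) (Complex.re_le_norm _)
      rw [← mul_div_assoc, le_div_iff₀ (by positivity)]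
      nlinarith
    refine hone.trans (Finset.single_le_sum (f := fun x => ((4 * r x : ℂ) / q x z).re)
      (fun y hy => ?_) hx)
    rw [hterm]
    have := hr y hy
    have := hqpos y hy z hzb
    positivity

/-- Maximum modulus principle for subdomains of the disk, with an exceptional closed null set on
the unit circle. -/
theorem norm_le_of_eventually_frontier_off_null {S : Set ℂ} (hS : IsClosed S)
    (hS1 : S ⊆ Metric.sphere 0 1)
    (h0 : volume {θ : ℝ | θ ∈ Ico 0 (2 * Real.pi) ∧ Complex.exp (θ * Complex.I) ∈ S} = 0)
    {U : Set ℂ} (hU : IsOpen U) (hU1 : U ⊆ Metric.ball 0 1) {f : ℂ → ℂ}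
    (hf : DifferentiableOn ℂ f U) {M : ℝ} (hM : 0 < M) (hf1 : ∀ z ∈ U, ‖f z‖ ≤ 1)
    (h : ∀ ξ ∈ frontier U, ξ ∉ S → ∀ M' > M, ∀ᶠ z in 𝓝[U] ξ, ‖f z‖ ≤ M') {z : ℂ} (hz : z ∈ U) :
    ‖f z‖ ≤ M := by
  rcases le_or_gt 1 M with hM1 | hM1
  · exact (hf1 z hz).trans hM1
  set k := Real.log (1 / M) with hk
  have hk0 : 0 < k := Real.log_pos (by rw [lt_div_iff₀ hM]; linarith)
  have hMk : Real.exp (-k) = M := by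
    rw [hk, one_div, Real.log_inv, neg_neg, Real.exp_log hM]
  have hz1 : 0 < 1 - ‖z‖ := by have := hU1 hz; rw [mem_ball_zero_iff] at this; linarith
  have key : ∀ ε > 0, ‖f z‖ ≤ M * Real.exp (k * (ε / (1 - ‖z‖))) := by
    intro ε hε
    obtain ⟨H, hHd, hH0, hHε, hHS⟩ := exists_barrier hS hS1 h0 hε
    -- The factor `exp (-k H)` has modulus at most `1`, and at most `exp (-k) = M` near `S`, where
    -- only `‖f‖ ≤ 1` is known. At a fixed point its effect disappears as `ε → 0`.
    have hn : ∀ w, ‖f w * Complex.exp (-(k * H w))‖ = ‖f w‖ * Real.exp (-(k * (H w).re)) := by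
      intro w
      rw [norm_mul, Complex.norm_exp]
      simp
    have := norm_le_of_eventually_frontier hU (Metric.isBounded_ball.subset hU1)
      (f := fun w => f w * Complex.exp (-(k * H w))) (M := M)
      (hf.mul ((((hHd.mono hU1).const_mul _).neg).cexp)) (fun ξ hξ M' hM' => by
        by_cases hξS : ξ ∈ S
        · filter_upwards [(hHS ξ hξS).filter_mono (nhdsWithin_mono _ hU1), self_mem_nhdsWithin]
            with w hw hwU
          rw [hn]
          have h1 : Real.exp (-(k * (H w).re)) ≤ M := by
            rw [← hMk, Real.exp_le_exp]
            nlinarith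
          have := hf1 w hwU
          have := Real.exp_pos (-(k * (H w).re))
          nlinarith [norm_nonneg (f w)]
        · filter_upwards [h ξ hξ hξS M' hM', self_mem_nhdsWithin] with w hw hwU
          rw [hn]
          refine le_trans (mul_le_of_le_one_right (norm_nonneg _) ?_) hw
          rw [Real.exp_le_one_iff]
          have := hH0 w (hU1 hwU)
          nlinarith) hz
    rw [hn] at this
    calc ‖f z‖ = ‖f z‖ * Real.exp (-(k * (H z).re)) * Real.exp (k * (H z).re) := by
          rw [mul_assoc, ← Real.exp_add]; simp
      _ ≤ M * Real.exp (k * (H z).re) := by gcongr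
      _ ≤ _ := by
          gcongr
          exact hHε z (hU1 hz)
  have hlim : Tendsto (fun ε : ℝ => M * Real.exp (k * (ε / (1 - ‖z‖)))) (𝓝[>] 0) (𝓝 M) := by
    have : ContinuousAt (fun ε : ℝ => M * Real.exp (k * (ε / (1 - ‖z‖)))) 0 := by fun_prop
    have h2 := this.tendsto
    simp only [zero_div, mul_zero, Real.exp_zero, mul_one] at h2
    exact h2.mono_left nhdsWithin_le_nhds
  exact ge_of_tendsto hlim (by filter_upwards [self_mem_nhdsWithin] with ε hε using key ε hε)

end

/-! ### From a covering over the annulus to a connected sublevel set: (b) ⇒ (a). -/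

noncomputable section

/-- Radial contraction: moves `w` towards the closed disk of radius `s` in time `t ∈ [0, 1]`. -/
def radialContraction (s t : ℝ) (w : ℂ) : ℂ := ((1 - t + t * (s / max s ‖w‖) : ℝ) : ℂ) * w

theorem continuous_radialContraction {s : ℝ} (hs : 0 < s) :
    Continuous fun p : ℝ × ℂ => radialContraction s p.1 p.2 := by
  unfold radialContraction
  have : Continuous fun p : ℝ × ℂ => s / max s ‖p.2‖ :=
    Continuous.div (by fun_prop) (by fun_prop) fun p => (lt_max_of_lt_left hs).ne'
  fun_prop

theorem radialContraction_zero (s : ℝ) (w : ℂ) : radialContraction s 0 w = w := by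
  simp [radialContraction]

theorem radialContraction_of_le {s : ℝ} (hs : 0 < s) (t : ℝ) {w : ℂ} (hw : ‖w‖ ≤ s) :
    radialContraction s t w = w := by
  simp [radialContraction, max_eq_left hw, div_self hs.ne']

theorem norm_radialContraction {s t : ℝ} (hs : 0 < s) (ht : t ∈ Icc (0 : ℝ) 1) (w : ℂ) :
    ‖radialContraction s t w‖ = (1 - t + t * (s / max s ‖w‖)) * ‖w‖ := by
  rw [radialContraction, norm_mul, Complex.norm_real, Real.norm_of_nonneg]
  have : 0 ≤ s / max s ‖w‖ := by positivity
  have := ht.1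
  have := ht.2
  nlinarith [mul_nonneg ht.1 ‹0 ≤ s / max s ‖w‖›]

theorem norm_radialContraction_one_le {s : ℝ} (hs : 0 < s) (w : ℂ) :
    ‖radialContraction s 1 w‖ ≤ s := by
  rw [norm_radialContraction hs (by simp)]
  have h : 0 < max s ‖w‖ := lt_max_of_lt_left hs
  rw [sub_self, zero_add, one_mul, div_mul_eq_mul_div, div_le_iff₀ h]
  exact mul_le_mul_of_nonneg_left (le_max_right _ _) hs.le

theorem radialContraction_mem_annulus {ρ s t : ℝ} (hρ : 0 < ρ) (hs : ρ < s)
    (ht : t ∈ Icc (0 : ℝ) 1) {w : ℂ} (hw : ρ < ‖w‖ ∧ ‖w‖ < 1) :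
    ρ < ‖radialContraction s t w‖ ∧ ‖radialContraction s t w‖ < 1 := by
  have hs0 : 0 < s := hρ.trans hs
  rcases le_or_gt ‖w‖ s with h | h
  · rwa [radialContraction_of_le hs0 t h]
  · rw [norm_radialContraction hs0 ht, max_eq_right h.le]
    have h0 : 0 < ‖w‖ := hρ.trans hw.1
    have : (1 - t + t * (s / ‖w‖)) * ‖w‖ = (1 - t) * ‖w‖ + t * s := by field_simp
    rw [this]
    have h1 := ht.1
    have h2 := ht.2
    constructor <;> nlinarith

/-- The homotopy `radialContraction s` of the annulus lifts to the part of the disk lying over it.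
The end of the lift, continued by the identity, is a retraction of the disk onto the closed sublevel
set. -/
theorem isPreconnected_sublevel_of_isCoveringMapOn {F : ℂ → ℂ}
    (hF : ContinuousOn F (Metric.ball 0 1)) (hm : MapsTo F (Metric.ball 0 1) (Metric.ball 0 1))
    {ρ s : ℝ} (hρ : 0 < ρ) (hs : ρ < s)
    (hcov : IsCoveringMapOn (fun z : Metric.ball (0 : ℂ) 1 => F z) {w : ℂ | ρ < ‖w‖ ∧ ‖w‖ < 1}) :
    IsPreconnected {z : ℂ | z ∈ Metric.ball (0 : ℂ) 1 ∧ ‖F z‖ ≤ s} := by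
  have hs0 : 0 < s := hρ.trans hs
  set A : Set ℂ := {w : ℂ | ρ < ‖w‖ ∧ ‖w‖ < 1} with hA
  set f : Metric.ball (0 : ℂ) 1 → ℂ := fun z => F z with hf
  have hfc : Continuous f := hF.domRestrict
  have hc := hcov.isCoveringMap_restrictPreimage
  set X := f ⁻¹' A with hX
  have hXn : ∀ x : Metric.ball (0 : ℂ) 1, ρ < ‖f x‖ ↔ x ∈ X := fun x =>
    ⟨fun h => ⟨h, by simpa using hm x.2⟩, fun h => h.1⟩
  let H : C(unitInterval × X, A) :=
    ⟨fun p => ⟨radialContraction s p.1 (f p.2), radialContraction_mem_annulus hρ hs p.1.2 p.2.2⟩, by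
      refine Continuous.subtype_mk ?_ _
      exact (continuous_radialContraction hs0).comp (by fun_prop :
        Continuous fun p : unitInterval × X => ((p.1 : ℝ), f p.2))⟩
  have H0 : ∀ a, H (0, a) = A.restrictPreimage f (ContinuousMap.id X a) := fun a =>
    Subtype.ext (radialContraction_zero s _)
  set L := hc.liftHomotopy H (ContinuousMap.id X) H0 with hL
  have hL1 : ∀ p, f (L p) = radialContraction s p.1 (f p.2) := fun p =>
    congrArg Subtype.val (congrFun (hc.liftHomotopy_lifts H (ContinuousMap.id X) H0) p)
  -- Over such a point the path to be lifted is constant, and so is its lift.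
  have hfix : ∀ a : X, ‖f a‖ ≤ s → L (1, a) = a := by
    intro a ha
    have h1 : H.comp ((ContinuousMap.id unitInterval).prodMk (.const unitInterval a)) =
        .const unitInterval (A.restrictPreimage f a) := by
      ext t
      exact radialContraction_of_le hs0 _ ha
    have h2 := hc.liftPath_const (e := a) (x := A.restrictPreimage f a) rfl
    rw [hL, IsCoveringMap.liftHomotopy_apply]
    simp only [h1, ContinuousMap.id_apply]
    rw [h2]
    rfl
  classical
  let R : Metric.ball (0 : ℂ) 1 → Metric.ball (0 : ℂ) 1 :=
    fun x => if h : x ∈ X then L (1, ⟨x, h⟩) else x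
  have hXo : IsOpen X := by
    have : X = {x | ρ < ‖f x‖} := by ext x; exact (hXn x).symm
    rw [this]
    exact isOpen_lt continuous_const hfc.norm
  have hR1 : ContinuousOn R X := by
    rw [continuousOn_iff_continuous_domRestrict]
    have : X.domRestrict R = fun a => ((L (1, a) : X) : Metric.ball (0 : ℂ) 1) := by
      ext a
      simp [R]
    rw [this]
    fun_prop
  -- Since `ρ < s`, this open set together with `X` covers the disk, which gives the continuity of
  -- the glued map.
  have hR2 : EqOn R id {x | ‖f x‖ < s} := by
    intro x hx
    simp only [R]
    split_ifs with h
    · rw [hfix ⟨x, h⟩ (le_of_lt hx)]; rfl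
    · rfl
  have hR : Continuous R := by
    rw [continuous_iff_continuousAt]
    intro x
    by_cases h : x ∈ X
    · exact hR1.continuousAt (hXo.mem_nhds h)
    · have hx : ‖f x‖ < s := lt_of_le_of_lt (not_lt.mp (fun h' => h ((hXn x).mp h'))) hs
      have ho : IsOpen {x | ‖f x‖ < s} := isOpen_lt hfc.norm continuous_const
      exact (continuousAt_id).congr (hR2.eventuallyEq_of_mem (ho.mem_nhds hx)).symm
  have hconn : PreconnectedSpace (Metric.ball (0 : ℂ) 1) :=
    Subtype.preconnectedSpace (convex_ball (0 : ℂ) 1).isPreconnected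
  have hrange : {z : ℂ | z ∈ Metric.ball (0 : ℂ) 1 ∧ ‖F z‖ ≤ s} =
      range (fun x => (R x : ℂ)) := by
    ext z
    constructor
    · rintro ⟨hz, hzs⟩
      refine ⟨⟨z, hz⟩, ?_⟩
      simp only [R]
      split_ifs with h
      · rw [hfix ⟨_, h⟩ hzs]
      · rfl
    · rintro ⟨x, rfl⟩
      refine ⟨(R x).2, ?_⟩
      change ‖f (R x)‖ ≤ s
      simp only [R]
      split_ifs with h
      · rw [hL1]
        exact norm_radialContraction_one_le hs0 _
      · exact (not_lt.mp (fun h' => h ((hXn x).mp h'))).trans hs.le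
  rw [hrange]
  exact isPreconnected_range (continuous_subtype_val.comp hR)

/-- The open sublevel set is the union of the closed ones with `ρ < s < r`: any two of its points
lie in a common one. Taking `r > ‖F 0‖` makes it nonempty. -/
theorem IsCoveringOverAnnulus.hasConnectedSublevel {F : ℂ → ℂ} (hF : IsInnerFunction F)
    (h : IsCoveringOverAnnulus F) : HasConnectedSublevel F := by
  obtain ⟨ρ, hρ, hρ1, hcov⟩ := h
  have h0 : ‖F 0‖ < 1 := by simpa using hF.mapsTo (Metric.mem_ball_self one_pos)
  obtain ⟨r, hr, hr1⟩ := exists_between (max_lt hρ1 h0)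
  rw [max_lt_iff] at hr
  refine ⟨r, hρ.trans hr.1, hr1, ⟨0, by simp, hr.2⟩, ?_⟩
  refine isPreconnected_of_forall_pair fun x hx y hy => ?_
  obtain ⟨s, hs, hs1⟩ := exists_between (max_lt (max_lt hx.2 hy.2) hr.1)
  simp only [max_lt_iff] at hs
  refine ⟨{z | z ∈ Metric.ball (0 : ℂ) 1 ∧ ‖F z‖ ≤ s}, ?_, ⟨hx.1, hs.1.1.le⟩, ⟨hy.1, hs.1.2.le⟩,
    isPreconnected_sublevel_of_isCoveringMapOn hF.holomorphic.continuousOn hF.mapsTo hρ hs.2 hcov⟩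
  rintro z ⟨hz, hzs⟩
  exact ⟨hz, hzs.trans_lt hs1⟩

end

/-! ### Analytic extension across the circle and Schwarz reflection. -/

noncomputable section

open scoped ComplexConjugate

/-- Reflection of a planar function in the unit circle, on both sides. -/
def schwarzReflection (G : ℂ → ℂ) (z : ℂ) : ℂ := (conj (G (conj z)⁻¹))⁻¹

/-- The extension of `F` by its analytic extensions on the circle and by reflection outside. -/
def reflectedExtension (F : ℂ → ℂ) (z : ℂ) : ℂ :=
  if ‖z‖ < 1 then F z else if ‖z‖ = 1 then boundaryExtension F z z else schwarzReflection F z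

theorem norm_inv_conj (z : ℂ) : ‖(conj z)⁻¹‖ = ‖z‖⁻¹ := by
  rw [norm_inv, RCLike.norm_conj]

theorem inv_conj_of_norm_one {z : ℂ} (hz : ‖z‖ = 1) : (conj z)⁻¹ = z := by
  rw [Complex.inv_def, Complex.conj_conj, Complex.normSq_conj, Complex.normSq_eq_norm_sq, hz]
  simp

theorem dist_inv_conj {z ζ : ℂ} (hζ : ‖ζ‖ = 1) (hz : z ≠ 0) :
    dist (conj z)⁻¹ ζ = dist z ζ / ‖z‖ := by
  have h1 : conj z ≠ 0 := by simpa using hz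
  have h2 : ζ * conj ζ = 1 := by
    rw [Complex.mul_conj, Complex.normSq_eq_norm_sq, hζ]; simp
  have : (conj z)⁻¹ - ζ = -(ζ * conj (z - ζ) / conj z) := by
    field_simp
    rw [map_sub]
    linear_combination -h2
  rw [dist_eq_norm, dist_eq_norm, this, norm_neg, norm_div, norm_mul, RCLike.norm_conj,
    RCLike.norm_conj, hζ, one_mul]

theorem DifferentiableAt.schwarzReflection {G : ℂ → ℂ} {z : ℂ} (hz : z ≠ 0)
    (hG : DifferentiableAt ℂ G (conj z)⁻¹) (h0 : G (conj z)⁻¹ ≠ 0) :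
    DifferentiableAt ℂ (schwarzReflection G) z := by
  have h1 : DifferentiableAt ℂ (fun w => G w⁻¹) (conj z) := by
    refine DifferentiableAt.comp (conj z) (by simpa using hG) ?_
    exact differentiableAt_inv (by simpa using hz)
  have h2 : DifferentiableAt ℂ (conj ∘ (fun w => G w⁻¹) ∘ conj) z := by
    have := h1.conj_conj
    rwa [Complex.conj_conj] at this
  exact h2.inv (by simpa using h0)

section Basics

variable {F : ℂ → ℂ}

theorem boundaryExtension_spec {ζ : ℂ} (hζ : ζ ∈ Metric.sphere (0 : ℂ) 1 \ singularSet F) :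
    IsAnalyticExtensionAt F (boundaryExtension F ζ) ζ := by
  have : ∃ G : ℂ → ℂ, IsAnalyticExtensionAt F G ζ := by
    by_contra h
    exact hζ.2 ⟨hζ.1, h⟩
  exact Classical.epsilon_spec this

theorem IsAnalyticExtensionAt.eventually {G : ℂ → ℂ} {ζ : ℂ} (h : IsAnalyticExtensionAt F G ζ) :
    ∀ᶠ z in 𝓝 ζ, IsAnalyticExtensionAt F G z := by
  have h1 : ∀ᶠ z in 𝓝 ζ, z ∈ Metric.ball (0 : ℂ) 1 → G z = F z :=
    eventually_nhdsWithin_iff.mp h.2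
  filter_upwards [h.1.eventually_analyticAt, eventually_eventually_nhds.mpr h1] with z hz hz1
  exact ⟨hz, eventually_nhdsWithin_iff.mpr hz1⟩

theorem notMem_singularSet_of_isAnalyticExtensionAt {G : ℂ → ℂ} {ζ : ℂ}
    (h : IsAnalyticExtensionAt F G ζ) : ζ ∉ singularSet F := fun h' => h'.2 ⟨G, h⟩

theorem singularSet_subset_sphere (F : ℂ → ℂ) : singularSet F ⊆ Metric.sphere 0 1 :=
  fun _ h => h.1

theorem isClosed_singularSet (F : ℂ → ℂ) : IsClosed (singularSet F) := by
  rw [← isOpen_compl_iff, isOpen_iff_mem_nhds]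
  intro ζ hζ
  by_cases h1 : ζ ∈ Metric.sphere (0 : ℂ) 1
  · filter_upwards [(boundaryExtension_spec ⟨h1, hζ⟩).eventually] with z hz
    exact notMem_singularSet_of_isAnalyticExtensionAt hz
  · filter_upwards [Metric.isClosed_sphere.isOpen_compl.mem_nhds h1] with z hz h
    exact hz h.1

theorem tendsto_radial {ζ : ℂ} (hζ : ζ ∈ Metric.sphere (0 : ℂ) 1) :
    Tendsto (fun r : ℝ => (r : ℂ) * ζ) (𝓝[<] (1 : ℝ)) (𝓝[Metric.ball 0 1] ζ) := by
  have hz : ‖ζ‖ = 1 := by simpa using hζ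
  refine tendsto_nhdsWithin_iff.mpr ⟨?_, ?_⟩
  · have : ContinuousAt (fun r : ℝ => (r : ℂ) * ζ) 1 := by fun_prop
    have h2 := this.tendsto
    simp only [Complex.ofReal_one, one_mul] at h2
    exact h2.mono_left nhdsWithin_le_nhds
  · filter_upwards [Ioo_mem_nhdsLT (zero_lt_one' ℝ)] with r hr
    rw [mem_ball_zero_iff, norm_mul, hz, mul_one, Complex.norm_real, Real.norm_of_nonneg hr.1.le]
    exact hr.2

theorem IsAnalyticExtensionAt.tendsto_radial {G : ℂ → ℂ} {ζ : ℂ}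
    (hζ : ζ ∈ Metric.sphere (0 : ℂ) 1) (h : IsAnalyticExtensionAt F G ζ) :
    Tendsto (fun r : ℝ => F ((r : ℂ) * ζ)) (𝓝[<] (1 : ℝ)) (𝓝 (G ζ)) := by
  have h1 : Tendsto F (𝓝[Metric.ball 0 1] ζ) (𝓝 (G ζ)) :=
    (h.1.continuousAt.tendsto.mono_left nhdsWithin_le_nhds).congr' h.2
  exact h1.comp (_root_.tendsto_radial hζ)

theorem exp_surj_sphere {ζ : ℂ} (hζ : ‖ζ‖ = 1) : ∃ θ : ℝ, Complex.exp (θ * Complex.I) = ζ := by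
  refine ⟨Complex.arg ζ, ?_⟩
  have := Complex.norm_mul_exp_arg_mul_I ζ
  rwa [hζ, Complex.ofReal_one, one_mul] at this

/-- Periodicity moves the almost everywhere statement from one period to the whole line, so that
angles can be translated and considered in open intervals without wrapping around. -/
theorem IsInnerFunction.ae_radial (hF : IsInnerFunction F) :
    ∀ᵐ θ : ℝ, HasUnimodularRadialLimit F (Complex.exp (θ * Complex.I)) := by
  have h0 := (ae_restrict_iff' measurableSet_Ico).mp hF.radial
  have h1 : ∀ n : ℤ, ∀ᵐ θ : ℝ, θ + n * (2 * Real.pi) ∈ Ico 0 (2 * Real.pi) →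
      HasUnimodularRadialLimit F (Complex.exp (θ * Complex.I)) := by
    intro n
    have := (measurePreserving_add_right (volume : Measure ℝ) (n * (2 * Real.pi))).quasiMeasurePreserving.ae h0
    filter_upwards [this] with θ hθ hm
    have := hθ hm
    have he : Complex.exp (((θ + n * (2 * Real.pi) : ℝ) : ℂ) * Complex.I) =
        Complex.exp (θ * Complex.I) := by
      push_cast
      rw [show ((θ : ℂ) + n * (2 * Real.pi)) * Complex.I
          = θ * Complex.I + n * (2 * Real.pi * Complex.I) by ring,
        Complex.exp_periodic.int_mul n]
    rwa [he] at this
  filter_upwards [ae_all_iff.mpr h1] with θ hθ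
  have hmem := toIcoMod_mem_Ico Real.two_pi_pos 0 θ
  rw [zero_add] at hmem
  refine hθ (-toIcoDiv Real.two_pi_pos 0 θ) ?_
  convert hmem using 1
  rw [toIcoMod]
  push_cast [zsmul_eq_mul]
  ring

theorem tendsto_exp_nhds (θ : ℝ) :
    Tendsto (fun x : ℝ => Complex.exp (x * Complex.I)) (𝓝 θ) (𝓝 (Complex.exp (θ * Complex.I))) := by
  have : Continuous fun x : ℝ => Complex.exp (x * Complex.I) := by fun_prop
  exact this.tendsto θ

theorem exp_mem_sphere (θ : ℝ) : Complex.exp (θ * Complex.I) ∈ Metric.sphere (0 : ℂ) 1 := by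
  simp [Complex.norm_exp_ofReal_mul_I]

/-- Near `ζ` the radial limits are the values of `G`. If `‖G ζ‖ ≠ 1`, then by continuity a whole
arc, of positive measure, would consist of points without unimodular radial limit. -/
theorem IsAnalyticExtensionAt.norm_eq_one (hF : IsInnerFunction F) {G : ℂ → ℂ} {ζ : ℂ}
    (hζ : ζ ∈ Metric.sphere (0 : ℂ) 1) (h : IsAnalyticExtensionAt F G ζ) : ‖G ζ‖ = 1 := by
  obtain ⟨θ, rfl⟩ := exp_surj_sphere (by simpa using hζ)
  by_contra hne
  have h1 : ∀ᶠ z in 𝓝 (Complex.exp (θ * Complex.I)), ‖G z‖ ≠ 1 :=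
    h.1.continuousAt.norm.eventually_ne hne
  have h2 : ∀ᶠ x : ℝ in 𝓝 θ, ¬ HasUnimodularRadialLimit F (Complex.exp (x * Complex.I)) := by
    filter_upwards [(tendsto_exp_nhds θ).eventually h1, (tendsto_exp_nhds θ).eventually h.eventually]
      with x hx hx2
    rintro ⟨w, hw, hlim⟩
    have := tendsto_nhds_unique hlim (hx2.tendsto_radial (exp_mem_sphere x))
    exact hx (this ▸ hw)
  obtain ⟨U, hU, hUo, hθU⟩ := eventually_nhds_iff.mp h2
  have h3 := hF.ae_radial
  rw [ae_iff] at h3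
  have h4 : volume U = 0 := measure_mono_null (fun x hx => hU x hx) h3
  exact (hUo.measure_pos volume ⟨θ, hθU⟩).ne' h4

theorem reflectedExtension_of_lt {z : ℂ} (hz : ‖z‖ < 1) : reflectedExtension F z = F z := by
  simp [reflectedExtension, hz]

theorem reflectedExtension_of_eq {z : ℂ} (hz : ‖z‖ = 1) :
    reflectedExtension F z = boundaryExtension F z z := by
  simp [reflectedExtension, hz]

theorem reflectedExtension_of_gt {z : ℂ} (hz : 1 < ‖z‖) :
    reflectedExtension F z = schwarzReflection F z := by
  simp [reflectedExtension, hz.not_gt, hz.ne']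

theorem norm_schwarzReflection (z : ℂ) : ‖schwarzReflection F z‖ = ‖F (conj z)⁻¹‖⁻¹ := by
  rw [schwarzReflection, norm_inv, RCLike.norm_conj]

/-- The circle accumulates at each of its points, which is what the identity theorem needs. -/
theorem frequently_sphere {ζ : ℂ} (hζ : ζ ∈ Metric.sphere (0 : ℂ) 1) :
    ∃ᶠ z in 𝓝[≠] ζ, z ∈ Metric.sphere (0 : ℂ) 1 := by
  obtain ⟨θ, rfl⟩ := exp_surj_sphere (by simpa using hζ)
  have hd : HasDerivAt (fun x : ℝ => Complex.exp (x * Complex.I))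
      (Complex.exp (θ * Complex.I) * (1 * Complex.I)) θ :=
    ((Complex.ofRealCLM.hasDerivAt (x := θ)).mul_const Complex.I).cexp
  have h1 : Tendsto (fun x : ℝ => Complex.exp (x * Complex.I)) (𝓝[≠] θ)
      (𝓝[≠] (Complex.exp (θ * Complex.I))) :=
    hd.tendsto_nhdsNE (by simp [Complex.exp_ne_zero])
  exact h1.frequently (Eventually.of_forall fun x => exp_mem_sphere x).frequently

/-- The reflection of `G` is analytic near `ζ` and agrees with `G` on the circle, where `‖G‖ = 1`;
by the identity theorem it is `G`. Hence the three pieces of `reflectedExtension` fit into one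
analytic germ, and derivatives of the pointwise chosen `boundaryExtension` become derivatives of a
single function. -/
theorem IsAnalyticExtensionAt.reflectedExtension_eventuallyEq (hF : IsInnerFunction F)
    {G : ℂ → ℂ} {ζ : ℂ} (hζ : ζ ∈ Metric.sphere (0 : ℂ) 1) (h : IsAnalyticExtensionAt F G ζ) :
    reflectedExtension F =ᶠ[𝓝 ζ] G := by
  have hz : ‖ζ‖ = 1 := by simpa using hζ
  have hζ0 : ζ ≠ 0 := by rintro rfl; simp at hz
  have hfix := inv_conj_of_norm_one hz
  have hcont : ContinuousAt (fun z : ℂ => (conj z)⁻¹) ζ :=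
    (Complex.continuous_conj.continuousAt).inv₀ (by simpa using hζ0)
  have htend : Tendsto (fun z : ℂ => (conj z)⁻¹) (𝓝 ζ) (𝓝 ζ) := by
    have := hcont.tendsto
    rwa [hfix] at this
  have hG1 : ‖G ζ‖ = 1 := h.norm_eq_one hF hζ
  have hG0 : ∀ᶠ z in 𝓝 ζ, G z ≠ 0 :=
    h.1.continuousAt.eventually_ne (by rintro h0; simp [h0] at hG1)
  have hR : AnalyticAt ℂ (schwarzReflection G) ζ := by
    rw [Complex.analyticAt_iff_eventually_differentiableAt]
    filter_upwards [htend.eventually hG0, htend.eventually h.1.eventually_analyticAt,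
      eventually_ne_nhds hζ0] with z h1 h2 h3
    exact DifferentiableAt.schwarzReflection h3 h2.differentiableAt h1
  have hev : ∀ᶠ z in 𝓝 ζ, z ∈ Metric.sphere (0 : ℂ) 1 → ‖G z‖ = 1 := by
    filter_upwards [h.eventually] with z hz hzs
    exact hz.norm_eq_one hF hzs
  have hfreq : ∃ᶠ z in 𝓝[≠] ζ, schwarzReflection G z = G z := by
    refine ((frequently_sphere hζ).and_eventually (nhdsWithin_le_nhds hev)).mono ?_
    rintro z ⟨hz1, hz2⟩
    have hz3 : ‖z‖ = 1 := by simpa using hz1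
    rw [schwarzReflection, inv_conj_of_norm_one hz3, inv_conj_of_norm_one (hz2 hz1)]
  have hRG : schwarzReflection G =ᶠ[𝓝 ζ] G := (hR.frequently_eq_iff_eventually_eq h.1).mp hfreq
  have hFG : ∀ᶠ z in 𝓝 ζ, z ∈ Metric.ball (0 : ℂ) 1 → G z = F z :=
    eventually_nhdsWithin_iff.mp h.2
  filter_upwards [hRG, hFG, htend.eventually hFG, h.eventually] with z h1 h2 h3 h4
  rcases lt_trichotomy ‖z‖ 1 with hlt | heq | hgt
  · rw [reflectedExtension_of_lt hlt, h2 (by simpa using hlt)]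
  · rw [reflectedExtension_of_eq heq]
    have hzs : z ∈ Metric.sphere (0 : ℂ) 1 := by simpa using heq
    exact (boundaryExtension_spec
      ⟨hzs, notMem_singularSet_of_isAnalyticExtensionAt h4⟩).unique hzs h4 |>.self_of_nhds
  · rw [reflectedExtension_of_gt hgt, ← h1, schwarzReflection, schwarzReflection, h3]
    rw [mem_ball_zero_iff, norm_inv_conj]
    exact inv_lt_one_of_one_lt₀ hgt

theorem reflectedExtension_eventuallyEq (hF : IsInnerFunction F) {ζ : ℂ}
    (hζ : ζ ∈ Metric.sphere (0 : ℂ) 1 \ singularSet F) :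
    reflectedExtension F =ᶠ[𝓝 ζ] boundaryExtension F ζ :=
  (boundaryExtension_spec hζ).reflectedExtension_eventuallyEq hF hζ.1

theorem analyticAt_reflectedExtension (hF : IsInnerFunction F) {ζ : ℂ}
    (hζ : ζ ∈ Metric.sphere (0 : ℂ) 1 \ singularSet F) : AnalyticAt ℂ (reflectedExtension F) ζ :=
  (boundaryExtension_spec hζ).1.congr (reflectedExtension_eventuallyEq hF hζ).symm

theorem norm_reflectedExtension_eq_one (hF : IsInnerFunction F) {ζ : ℂ}
    (hζ : ζ ∈ Metric.sphere (0 : ℂ) 1 \ singularSet F) : ‖reflectedExtension F ζ‖ = 1 := by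
  rw [(reflectedExtension_eventuallyEq hF hζ).self_of_nhds]
  exact (boundaryExtension_spec hζ).norm_eq_one hF hζ.1

theorem deriv_boundaryExtension (hF : IsInnerFunction F) {ζ : ℂ}
    (hζ : ζ ∈ Metric.sphere (0 : ℂ) 1 \ singularSet F) :
    deriv (boundaryExtension F ζ) ζ = deriv (reflectedExtension F) ζ :=
  (reflectedExtension_eventuallyEq hF hζ).deriv_eq.symm

theorem iteratedDeriv_boundaryExtension (hF : IsInnerFunction F) {ζ : ℂ}
    (hζ : ζ ∈ Metric.sphere (0 : ℂ) 1 \ singularSet F) (n : ℕ) :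
    iteratedDeriv n (boundaryExtension F ζ) ζ = iteratedDeriv n (reflectedExtension F) ζ :=
  ((reflectedExtension_eventuallyEq hF hζ).iteratedDeriv_eq n).symm

theorem differentiableAt_reflectedExtension_of_lt (hF : IsInnerFunction F) {z : ℂ} (hz : ‖z‖ < 1) :
    DifferentiableAt ℂ (reflectedExtension F) z := by
  have hzb : Metric.ball (0 : ℂ) 1 ∈ 𝓝 z := Metric.isOpen_ball.mem_nhds (by simpa using hz)
  refine (hF.holomorphic.differentiableAt hzb).congr_of_eventuallyEq ?_
  filter_upwards [hzb] with w hw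
  exact reflectedExtension_of_lt (by simpa using hw)

theorem differentiableAt_reflectedExtension_of_gt (hF : IsInnerFunction F) {z : ℂ} (hz : 1 < ‖z‖)
    (h0 : F (conj z)⁻¹ ≠ 0) : DifferentiableAt ℂ (reflectedExtension F) z := by
  have hz0 : z ≠ 0 := by rintro rfl; norm_num at hz
  have hzb : Metric.ball (0 : ℂ) 1 ∈ 𝓝 (conj z)⁻¹ := Metric.isOpen_ball.mem_nhds (by
    rw [mem_ball_zero_iff, norm_inv_conj]
    exact inv_lt_one_of_one_lt₀ hz)
  refine (DifferentiableAt.schwarzReflection hz0 (hF.holomorphic.differentiableAt hzb)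
    h0).congr_of_eventuallyEq ?_
  filter_upwards [continuous_norm.continuousAt.eventually (eventually_gt_nhds hz)] with w hw
  exact reflectedExtension_of_gt hw

theorem norm_lt_one (hF : IsInnerFunction F) {z : ℂ} (hz : ‖z‖ < 1) : ‖F z‖ < 1 := by
  simpa using hF.mapsTo (show z ∈ Metric.ball (0 : ℂ) 1 by simpa using hz)

/-- If `F` is bounded below in the part of a disk around `ζ` inside the unit disk, then the
extension is holomorphic and bounded in this disk off the unit circle. -/
theorem reflectedExtension_off_circle (hF : IsInnerFunction F) {ζ : ℂ} (hζ : ‖ζ‖ = 1) {d r : ℝ}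
    (hr : 0 < r) (hr1 : r ≤ 1) (hlow : ∀ z ∈ Metric.ball ζ d, ‖z‖ < 1 → r ≤ ‖F z‖) {z : ℂ}
    (hz : z ∈ Metric.ball ζ d) (hz1 : ‖z‖ ≠ 1) :
    DifferentiableAt ℂ (reflectedExtension F) z ∧ ‖reflectedExtension F z‖ ≤ 1 / r := by
  rcases hz1.lt_or_gt with hlt | hgt
  · refine ⟨differentiableAt_reflectedExtension_of_lt hF hlt, ?_⟩
    rw [reflectedExtension_of_lt hlt, le_div_iff₀ hr]
    have := norm_lt_one hF hlt
    nlinarith [norm_nonneg (F z)]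
  · have hz0 : z ≠ 0 := by rintro rfl; norm_num at hgt
    -- Reflecting an exterior point into the disk divides its distance to `ζ` by `‖z‖ > 1`, so the
    -- lower bound on `F` is available there and excludes poles.
    have h1 : (conj z)⁻¹ ∈ Metric.ball ζ d := by
      rw [Metric.mem_ball, dist_inv_conj hζ hz0]
      exact (div_le_self dist_nonneg hgt.le).trans_lt hz
    have h2 : ‖(conj z)⁻¹‖ < 1 := by rw [norm_inv_conj]; exact inv_lt_one_of_one_lt₀ hgt
    have h3 := hlow _ h1 h2
    refine ⟨differentiableAt_reflectedExtension_of_gt hF hgt fun h0 => ?_, ?_⟩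
    · rw [h0, norm_zero] at h3
      linarith
    · rw [reflectedExtension_of_gt hgt, norm_schwarzReflection, ← one_div]
      exact one_div_le_one_div_of_le hr h3

/-- If `F` is bounded below in the part of a disk around `ζ` inside the unit disk, and the disk
contains no singular points, then the extension is holomorphic and bounded there. -/
theorem reflectedExtension_on_ball (hF : IsInnerFunction F) {ζ : ℂ} (hζ : ‖ζ‖ = 1) {d r : ℝ}
    (hr : 0 < r) (hr1 : r ≤ 1) (hS : ∀ z ∈ Metric.ball ζ d, z ∉ singularSet F)
    (hlow : ∀ z ∈ Metric.ball ζ d, ‖z‖ < 1 → r ≤ ‖F z‖) {z : ℂ} (hz : z ∈ Metric.ball ζ d) :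
    DifferentiableAt ℂ (reflectedExtension F) z ∧ ‖reflectedExtension F z‖ ≤ 1 / r := by
  by_cases h : ‖z‖ = 1
  · have hz' : z ∈ Metric.sphere (0 : ℂ) 1 \ singularSet F := ⟨by simpa using h, hS z hz⟩
    refine ⟨(analyticAt_reflectedExtension hF hz').differentiableAt, ?_⟩
    rw [norm_reflectedExtension_eq_one hF hz', le_div_iff₀ hr]
    linarith
  · exact reflectedExtension_off_circle hF hζ hr hr1 hlow hz h

end Basics

end

/-! ### Schwarz–Pick, Julia's inequality and the boundary derivative. -/

noncomputable section

open scoped ComplexConjugate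

theorem one_sub_conj_mul_ne_zero {a z : ℂ} (ha : ‖a‖ < 1) (hz : ‖z‖ < 1) : 1 - conj a * z ≠ 0 := by
  intro h
  have h1 : ‖conj a * z‖ = 1 := by rw [← sub_eq_zero.mp h]; simp
  rw [norm_mul, RCLike.norm_conj] at h1
  nlinarith [norm_nonneg a, norm_nonneg z]

theorem normSq_one_sub_conj_mul (a z : ℂ) :
    ‖1 - conj a * z‖ ^ 2 - ‖z - a‖ ^ 2 = (1 - ‖a‖ ^ 2) * (1 - ‖z‖ ^ 2) := by
  simp only [← Complex.normSq_eq_norm_sq, Complex.normSq_apply]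
  simp
  ring

theorem norm_moebius_lt_one {a z : ℂ} (ha : ‖a‖ < 1) (hz : ‖z‖ < 1) :
    ‖(z - a) / (1 - conj a * z)‖ < 1 := by
  have h0 : 0 < ‖1 - conj a * z‖ := norm_pos_iff.mpr (one_sub_conj_mul_ne_zero ha hz)
  rw [norm_div, div_lt_one h0]
  refine lt_of_pow_lt_pow_left₀ 2 h0.le ?_
  have h1 := normSq_one_sub_conj_mul a z
  have h2 : 0 < (1 - ‖a‖ ^ 2) * (1 - ‖z‖ ^ 2) :=
    mul_pos (by nlinarith [norm_nonneg a]) (by nlinarith [norm_nonneg z])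
  linarith

/-- The Schwarz–Pick inequality. -/
theorem schwarz_pick {F : ℂ → ℂ} (hd : DifferentiableOn ℂ F (Metric.ball 0 1))
    (hm : MapsTo F (Metric.ball 0 1) (Metric.ball 0 1)) {a z : ℂ} (ha : ‖a‖ < 1) (hz : ‖z‖ < 1) :
    (1 - ‖a‖ ^ 2) * (1 - ‖z‖ ^ 2) * ‖1 - conj (F a) * F z‖ ^ 2 ≤
      (1 - ‖F a‖ ^ 2) * (1 - ‖F z‖ ^ 2) * ‖1 - conj a * z‖ ^ 2 := by
  have hFa : ‖F a‖ < 1 := by simpa using hm (by simpa using ha : a ∈ Metric.ball (0 : ℂ) 1)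
  have hFz : ‖F z‖ < 1 := by simpa using hm (by simpa using hz : z ∈ Metric.ball (0 : ℂ) 1)
  have hφ : MapsTo (fun w : ℂ => (w - -a) / (1 - conj (-a) * w)) (Metric.ball 0 1)
      (Metric.ball 0 1) := by
    intro w hw
    rw [mem_ball_zero_iff] at hw ⊢
    exact norm_moebius_lt_one (by simpa using ha) hw
  -- Conjugating `F` by disk automorphisms gives a self-map fixing `0`, to which the Schwarz lemma
  -- applies. The result is rewritten by `normSq_one_sub_conj_mul` in a form without quotients that
  -- passes to the boundary.
  set g : ℂ → ℂ := fun w => (F ((w - -a) / (1 - conj (-a) * w)) - F a) /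
    (1 - conj (F a) * F ((w - -a) / (1 - conj (-a) * w))) with hg
  have hgd : DifferentiableOn ℂ g (Metric.ball 0 1) := by
    have h1 : DifferentiableOn ℂ (fun w : ℂ => (w - -a) / (1 - conj (-a) * w))
        (Metric.ball 0 1) := by
      refine DifferentiableOn.div (by fun_prop) (by fun_prop) fun w hw => ?_
      exact one_sub_conj_mul_ne_zero (by simpa using ha) (by simpa using hw)
    have h2 := hd.comp h1 hφ
    refine DifferentiableOn.div (h2.sub_const _) ((h2.const_mul _).const_sub _) fun w hw => ?_
    exact one_sub_conj_mul_ne_zero hFa (by simpa using hm (hφ hw))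
  have hgm : MapsTo g (Metric.ball 0 1) (Metric.closedBall 0 1) := by
    intro w hw
    rw [mem_closedBall_zero_iff]
    exact (norm_moebius_lt_one hFa (by simpa using hm (hφ hw))).le
  have hg0 : g 0 = 0 := by simp [hg]
  have hw := norm_moebius_lt_one ha hz
  have hne := one_sub_conj_mul_ne_zero ha hz
  have hgw := Complex.norm_le_norm_of_mapsTo_ball hgd hgm hg0 hw
  have hback : ((z - a) / (1 - conj a * z) - -a) / (1 - conj (-a) * ((z - a) / (1 - conj a * z))) = z := by
    have h3 : (1 - conj a * z) + conj a * (z - a) ≠ 0 := by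
      have := one_sub_conj_mul_ne_zero ha ha
      intro h
      apply this
      linear_combination h
    rw [map_neg]
    rw [show (1 - -conj a * ((z - a) / (1 - conj a * z))) =
      ((1 - conj a * z) + conj a * (z - a)) / (1 - conj a * z) by field_simp; ring]
    rw [show (z - a) / (1 - conj a * z) - -a = (z - a + a * (1 - conj a * z)) / (1 - conj a * z) by
      rw [eq_div_iff hne, sub_neg_eq_add, add_mul, div_mul_cancel₀ _ hne]]
    rw [div_div_div_cancel_right₀ hne, div_eq_iff h3]
    ring
  simp only [hg] at hgw
  rw [hback, norm_div, norm_div, div_le_div_iff₀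
    (norm_pos_iff.mpr (one_sub_conj_mul_ne_zero hFa hFz)) (norm_pos_iff.mpr hne)] at hgw
  have h4 := normSq_one_sub_conj_mul a z
  have h5 := normSq_one_sub_conj_mul (F a) (F z)
  have h6 : (‖F z - F a‖ * ‖1 - conj a * z‖) ^ 2 ≤ (‖z - a‖ * ‖1 - conj (F a) * F z‖) ^ 2 :=
    pow_le_pow_left₀ (by positivity) hgw 2
  rw [← h4, ← h5]
  nlinarith

section Boundary

variable {F : ℂ → ℂ}

/-- Julia's inequality at a regular boundary point. -/
theorem julia (hF : IsInnerFunction F) {ζ : ℂ} (hζ : ζ ∈ Metric.sphere (0 : ℂ) 1 \ singularSet F)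
    {a : ℂ} (ha : ‖a‖ < 1) :
    (1 - ‖a‖ ^ 2) * (1 - ‖F a‖) ≤ 2 * ‖deriv (reflectedExtension F) ζ‖ * ‖ζ - a‖ ^ 2 := by
  set E := reflectedExtension F with hE
  have hz : ‖ζ‖ = 1 := by simpa using hζ.1
  have hFa := norm_lt_one hF ha
  have hd : HasDerivAt E (deriv E ζ) ζ :=
    (analyticAt_reflectedExtension hF hζ).differentiableAt.hasDerivAt
  have hd1 : HasDerivAt (fun t : ℝ => E (t * ζ)) (deriv E ζ * ζ) 1 := by
    have h1 : HasDerivAt (fun t : ℝ => (t : ℂ) * ζ) (1 * ζ) 1 :=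
      (Complex.ofRealCLM.hasDerivAt (x := (1 : ℝ))).mul_const ζ
    rw [one_mul] at h1
    refine HasDerivAt.comp (1 : ℝ) (h₂ := E) ?_ h1
    simpa using hd
  have hslope : Tendsto (fun t : ℝ => ‖slope (fun t : ℝ => E (t * ζ)) 1 t‖) (𝓝[<] 1)
      (𝓝 ‖deriv E ζ‖) := by
    have h1 := (hasDerivAt_iff_tendsto_slope.mp hd1).norm
    rw [norm_mul, hz, mul_one] at h1
    exact h1.mono_left (nhdsWithin_mono _ fun t ht => ne_of_lt ht)
  have hl : Tendsto (fun t : ℝ => (1 - ‖a‖ ^ 2) * (1 + t) * (1 - ‖F a‖)) (𝓝[<] 1)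
      (𝓝 ((1 - ‖a‖ ^ 2) * (1 + 1) * (1 - ‖F a‖))) := by
    have : ContinuousAt (fun t : ℝ => (1 - ‖a‖ ^ 2) * (1 + t) * (1 - ‖F a‖)) 1 := by fun_prop
    exact this.tendsto.mono_left nhdsWithin_le_nhds
  have hr : Tendsto (fun t : ℝ => 4 * ‖slope (fun t : ℝ => E (t * ζ)) 1 t‖ *
      ‖1 - conj a * (t * ζ)‖ ^ 2) (𝓝[<] 1)
      (𝓝 (4 * ‖deriv E ζ‖ * ‖1 - conj a * ((1 : ℝ) * ζ)‖ ^ 2)) := by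
    have : ContinuousAt (fun t : ℝ => ‖1 - conj a * (t * ζ)‖ ^ 2) 1 := by fun_prop
    exact (hslope.const_mul 4).mul (this.tendsto.mono_left nhdsWithin_le_nhds)
  -- Apply Schwarz–Pick at `a` and `t ζ`, divide by `(1 - t) * (1 - ‖F a‖)` and let `t → 1`: the
  -- quotient `(1 - ‖F (t ζ)‖) / (1 - t)` is controlled by the difference quotient of the extension
  -- at `ζ`.
  have key := le_of_tendsto_of_tendsto hl hr (by
    filter_upwards [Ioo_mem_nhdsLT (zero_lt_one' ℝ)] with t ht
    have htz : ‖(t : ℂ) * ζ‖ = t := by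
      rw [norm_mul, hz, mul_one, Complex.norm_real, Real.norm_of_nonneg ht.1.le]
    have htz1 : ‖(t : ℂ) * ζ‖ < 1 := by rw [htz]; exact ht.2
    have hsp := schwarz_pick hF.holomorphic hF.mapsTo ha htz1
    rw [htz] at hsp
    have hFt := norm_lt_one hF htz1
    have h1 : (1 - ‖F a‖) ^ 2 ≤ ‖1 - conj (F a) * F (t * ζ)‖ ^ 2 := by
      refine pow_le_pow_left₀ (by linarith) ?_ 2
      have h2 := norm_sub_norm_le (1 : ℂ) (conj (F a) * F (t * ζ))
      rw [norm_one, norm_mul, RCLike.norm_conj] at h2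
      nlinarith [norm_nonneg (F a)]
    have h3 : 1 - ‖F (t * ζ)‖ ≤ (1 - t) * ‖slope (fun t : ℝ => E (t * ζ)) 1 t‖ := by
      rw [slope_def_module, norm_smul, norm_inv, Real.norm_eq_abs, abs_sub_comm,
        abs_of_pos (by linarith [ht.2] : 0 < 1 - t), ← mul_assoc, mul_inv_cancel₀
        (by linarith [ht.2]), one_mul]
      simp only [Complex.ofReal_one, one_mul]
      rw [← norm_reflectedExtension_eq_one hF hζ, norm_sub_rev]
      have := norm_sub_norm_le (E ζ) (E (t * ζ))
      rwa [show E (t * ζ) = F (t * ζ) from reflectedExtension_of_lt htz1] at *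
    set N := ‖slope (fun t : ℝ => E (t * ζ)) 1 t‖
    set Q := ‖1 - conj a * (t * ζ)‖ ^ 2
    have hQ : 0 ≤ Q := by positivity
    have hN : 0 ≤ N := norm_nonneg _
    have h4 : 1 - ‖F (t * ζ)‖ ^ 2 ≤ 2 * ((1 - t) * N) := by nlinarith [norm_nonneg (F (t * ζ))]
    have ha2 : 0 < 1 - ‖a‖ ^ 2 := by nlinarith [norm_nonneg a]
    have ht1 : 0 < 1 - t := by linarith [ht.2]
    have ht2 : 0 < 1 - t ^ 2 := by nlinarith [ht.1]
    have hfa : 0 < 1 - ‖F a‖ := by linarith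
    have h5 : (1 - ‖a‖ ^ 2) * (1 - t ^ 2) * (1 - ‖F a‖) ^ 2 ≤
        (2 * (1 - ‖F a‖)) * (2 * ((1 - t) * N)) * Q := by
      calc _ ≤ (1 - ‖a‖ ^ 2) * (1 - t ^ 2) * ‖1 - conj (F a) * F (t * ζ)‖ ^ 2 := by gcongr
        _ ≤ _ := hsp
        _ ≤ _ := by
            gcongr
            · nlinarith [norm_nonneg (F (t * ζ))]
            · nlinarith [norm_nonneg (F a)]
    have h6 : (1 - t) * (1 - ‖F a‖) * ((1 - ‖a‖ ^ 2) * (1 + t) * (1 - ‖F a‖)) ≤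
        (1 - t) * (1 - ‖F a‖) * (4 * N * Q) := by nlinarith
    exact le_of_mul_le_mul_left h6 (by positivity))
  have hn : ‖1 - conj a * ((1 : ℝ) * ζ)‖ = ‖ζ - a‖ := by
    have : 1 - conj a * ((1 : ℝ) * ζ) = ζ * conj (ζ - a) := by
      have h2 : ζ * conj ζ = 1 := by
        rw [Complex.mul_conj, Complex.normSq_eq_norm_sq, hz]; simp
      rw [map_sub, Complex.ofReal_one]
      linear_combination -h2
    rw [this, norm_mul, hz, one_mul, RCLike.norm_conj]
  rw [hn] at key
  linarith

/-- With `E` the extension, `conj (E ζ) * ζ * E' ζ` has nonnegative real part because `‖E‖` reaches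
its maximum over the radius at `ζ`, and zero imaginary part because `‖E‖ = 1` along the circle. So
it equals its own modulus. It says that `E` maps the inward normal to the inward normal. -/
theorem mul_deriv_reflectedExtension (hF : IsInnerFunction F) {ζ : ℂ}
    (hζ : ζ ∈ Metric.sphere (0 : ℂ) 1 \ singularSet F) :
    ζ * deriv (reflectedExtension F) ζ =
      ‖deriv (reflectedExtension F) ζ‖ * reflectedExtension F ζ := by
  set E := reflectedExtension F with hE
  have hz : ‖ζ‖ = 1 := by simpa using hζ.1
  have hd : HasDerivAt E (deriv E ζ) ζ :=
    (analyticAt_reflectedExtension hF hζ).differentiableAt.hasDerivAt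
  have hE1 := norm_reflectedExtension_eq_one hF hζ
  set c := conj (E ζ) * (ζ * deriv E ζ) with hc
  have hre : 0 ≤ c.re := by
    have h1 : HasDerivAt (fun t : ℝ => (t : ℂ) * ζ) (1 * ζ) 1 :=
      (Complex.ofRealCLM.hasDerivAt (x := (1 : ℝ))).mul_const ζ
    rw [one_mul] at h1
    have hd1 : HasDerivAt (fun t : ℝ => E (t * ζ)) (deriv E ζ * ζ) 1 := by
      refine HasDerivAt.comp (1 : ℝ) (h₂ := E) ?_ h1
      simpa using hd
    have h2 := hd1.norm_sq
    have h3 := (hasDerivAt_iff_tendsto_slope.mp h2).mono_left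
      (nhdsWithin_mono (1 : ℝ) (fun t (ht : t ∈ Iio 1) => ne_of_lt ht))
    have h4 := ge_of_tendsto h3 (b := 0) (by
      filter_upwards [Ioo_mem_nhdsLT (zero_lt_one' ℝ)] with t ht
      rw [slope_def_field]
      have htz1 : ‖(t : ℂ) * ζ‖ < 1 := by
        rw [norm_mul, hz, mul_one, Complex.norm_real, Real.norm_of_nonneg ht.1.le]; exact ht.2
      have h5 : ‖E (t * ζ)‖ < 1 := by
        rw [hE, reflectedExtension_of_lt htz1]; exact norm_lt_one hF htz1
      refine div_nonneg_of_nonpos ?_ (by linarith [ht.2])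
      simp only [Complex.ofReal_one, one_mul]
      rw [hE1]
      nlinarith [norm_nonneg (E (t * ζ))])
    rw [Complex.inner] at h4
    simp only [Complex.ofReal_one, one_mul] at h4
    rw [hc, mul_comm ζ]
    rw [mul_comm (conj _)]
    linarith
  have him : c.im = 0 := by
    have h0 : HasDerivAt (fun x : ℝ => ζ * Complex.exp (x * Complex.I)) (ζ * Complex.I) 0 := by
      have := (((Complex.ofRealCLM.hasDerivAt (x := (0 : ℝ))).mul_const Complex.I).cexp).const_mul ζ
      simpa using this
    have hd1 : HasDerivAt (fun x : ℝ => E (ζ * Complex.exp (x * Complex.I)))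
        (deriv E ζ * (ζ * Complex.I)) 0 := by
      refine HasDerivAt.comp (0 : ℝ) (h₂ := E) ?_ h0
      simpa using hd
    have h2 := hd1.norm_sq
    have hev : (fun x : ℝ => ‖E (ζ * Complex.exp (x * Complex.I))‖ ^ 2) =ᶠ[𝓝 0] fun _ => 1 := by
      have h3 : Tendsto (fun x : ℝ => ζ * Complex.exp (x * Complex.I)) (𝓝 0) (𝓝 ζ) := by
        simpa using h0.continuousAt.tendsto
      filter_upwards [h3.eventually ((isClosed_singularSet F).isOpen_compl.mem_nhds hζ.2)] with x hx
      rw [norm_reflectedExtension_eq_one hF ⟨?_, hx⟩, one_pow]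
      simp [hz, Complex.norm_exp_ofReal_mul_I]
    have h4 := h2.unique ((hasDerivAt_const (0 : ℝ) (1 : ℝ)).congr_of_eventuallyEq hev)
    rw [Complex.inner] at h4
    simp only [Complex.ofReal_zero, zero_mul, Complex.exp_zero, mul_one] at h4
    have h5 : deriv E ζ * (ζ * Complex.I) * conj (E ζ) = c * Complex.I := by rw [hc]; ring
    rw [h5] at h4
    simpa using h4
  have hcn : ‖c‖ = ‖deriv E ζ‖ := by
    rw [hc, norm_mul, RCLike.norm_conj, hE1, one_mul, norm_mul, hz, one_mul]
  have hcc : c = (‖deriv E ζ‖ : ℂ) := by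
    rw [← hcn]
    have : c = (c.re : ℂ) := Complex.ext rfl (by simp [him])
    rw [this, Complex.norm_real, Real.norm_of_nonneg hre]
  have h6 : E ζ * conj (E ζ) = 1 := by
    rw [Complex.mul_conj, Complex.normSq_eq_norm_sq, hE1]; simp
  rw [← hcc, hc]
  linear_combination (-(ζ * deriv E ζ)) * h6

end Boundary

end

/-! ### A harmonic measure estimate for connected sets in the half plane. -/

noncomputable section

/-- A continuous function whose exponential is constant on a preconnected set is constant. -/
theorem eq_of_exp_const {T : Set ℂ} (hT : IsPreconnected T) {g : ℂ → ℂ} (hg : ContinuousOn g T)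
    {κ : ℂ} (hκ : ∀ z ∈ T, Complex.exp (g z) = κ) {x y : ℂ} (hx : x ∈ T) (hy : y ∈ T) :
    g x = g y := by
  refine hT.induction₂ (fun x y => g x = g y) (fun x hx => ?_) (fun _ _ _ _ _ _ h1 h2 => h1.trans h2)
    (fun _ _ _ _ h => h.symm) hx hy
  have h1 : ∀ᶠ y in 𝓝[T] x, dist (g y) (g x) < 2 * Real.pi :=
    (hg x hx).eventually (Metric.ball_mem_nhds _ Real.two_pi_pos)
  filter_upwards [h1, self_mem_nhdsWithin] with y hy hyT
  obtain ⟨n, hn⟩ := Complex.exp_eq_exp_iff_exists_int.mp ((hκ y hyT).trans (hκ x hx).symm)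
  rw [hn, dist_eq_norm, add_sub_cancel_left, norm_mul] at hy
  have h2 : ‖(2 * Real.pi * Complex.I : ℂ)‖ = 2 * Real.pi := by
    simp [abs_of_pos Real.pi_pos]
  rw [h2, Complex.norm_intCast] at hy
  have h3 : |(n : ℝ)| < 1 := by
    by_contra h
    nlinarith [Real.two_pi_pos]
  have h4 : n = 0 := by
    have : |n| < 1 := by exact_mod_cast h3
    exact Int.abs_lt_one_iff.mp this
  rw [hn, h4]
  simp

/-- In an open connected set `Ω`, two points `x`, `y` can be joined by a compact set off which
`(z - x) / (z - y)` has a holomorphic logarithm. -/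
theorem exists_log_div {Ω : Set ℂ} (ho : IsOpen Ω) (hc : IsPreconnected Ω) {x y : ℂ} (hx : x ∈ Ω)
    (hy : y ∈ Ω) :
    ∃ K ⊆ Ω, IsCompact K ∧ x ∈ K ∧ y ∈ K ∧ ∃ L : ℂ → ℂ, DifferentiableOn ℂ L Kᶜ ∧
      ∀ z ∉ K, Complex.exp (L z) = (z - x) / (z - y) := by
  refine hc.induction₂ (fun x y => ∃ K ⊆ Ω, IsCompact K ∧ x ∈ K ∧ y ∈ K ∧ ∃ L : ℂ → ℂ,
    DifferentiableOn ℂ L Kᶜ ∧ ∀ z ∉ K, Complex.exp (L z) = (z - x) / (z - y)) ?_ ?_ ?_ hx hy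
  · intro x hx
    obtain ⟨ε, hε, hball⟩ := Metric.isOpen_iff.mp ho x hx
    filter_upwards [nhdsWithin_le_nhds (Metric.ball_mem_nhds x hε)] with y hy
    have hsub : segment ℝ x y ⊆ Ω :=
      ((convex_ball x ε).segment_subset (Metric.mem_ball_self hε) hy).trans hball
    -- The quotient equals `-t` with `t ≥ 0` only at `z = (x + t y) / (1 + t)`, a point of the
    -- segment.
    have hslit : ∀ z ∉ segment ℝ x y, (z - x) / (z - y) ∈ Complex.slitPlane := by
      intro z hz
      have hzy : z - y ≠ 0 := fun h => hz (by
        rw [sub_eq_zero.mp h]; exact right_mem_segment ℝ x y)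
      by_contra hcon
      rw [Complex.mem_slitPlane_iff_not_le_zero, not_not, Complex.nonpos_iff] at hcon
      obtain ⟨t, ht⟩ : ∃ t : ℝ, t = -((z - x) / (z - y)).re := ⟨_, rfl⟩
      have ht0 : 0 ≤ t := by rw [ht]; linarith [hcon.1]
      have h1 : (z - x) / (z - y) = ((-t : ℝ) : ℂ) := Complex.ext (by simp [ht]) (by simp [hcon.2])
      rw [div_eq_iff hzy] at h1
      have h2 : (1 + t : ℂ) ≠ 0 := by
        have : (1 + t : ℝ) ≠ 0 := by positivity
        exact_mod_cast this
      apply hz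
      refine ⟨1 / (1 + t), t / (1 + t), by positivity, by positivity, by field_simp, ?_⟩
      simp only [Complex.real_smul]
      push_cast at h1 ⊢
      field_simp
      linear_combination (-1 : ℂ) * h1
    refine ⟨segment ℝ x y, hsub, ?_, left_mem_segment ℝ x y, right_mem_segment ℝ x y,
      fun z => Complex.log ((z - x) / (z - y)), ?_, ?_⟩
    · rw [segment_eq_image]
      exact isCompact_Icc.image (by fun_prop)
    · intro z hz
      have hzy : z - y ≠ 0 := fun h => hz (by
        rw [sub_eq_zero.mp h]; exact right_mem_segment ℝ x y)
      refine DifferentiableAt.differentiableWithinAt ?_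
      exact DifferentiableAt.clog (by fun_prop (disch := assumption)) (hslit z hz)
    · intro z hz
      exact Complex.exp_log (Complex.slitPlane_ne_zero (hslit z hz))
  · rintro x y w - - - ⟨K, hK, hKc, hxK, hyK, L, hL, hLe⟩ ⟨K', hK', hKc', hyK', hwK', L', hL', hLe'⟩
    refine ⟨K ∪ K', union_subset hK hK', hKc.union hKc', .inl hxK, .inr hwK', fun z => L z + L' z,
      ?_, ?_⟩
    · exact (hL.mono (compl_subset_compl.mpr subset_union_left)).add
        (hL'.mono (compl_subset_compl.mpr subset_union_right))
    · intro z hz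
      rw [mem_union, not_or] at hz
      have : z - y ≠ 0 := fun h => hz.1 (by rwa [sub_eq_zero.mp h])
      rw [Complex.exp_add, hLe z hz.1, hLe' z hz.2, div_mul_div_cancel₀ this]
  · rintro x y - - ⟨K, hK, hKc, hxK, hyK, L, hL, hLe⟩
    refine ⟨K, hK, hKc, hyK, hxK, fun z => -L z, hL.neg, fun z hz => ?_⟩
    rw [Complex.exp_neg, hLe z hz, inv_div]

theorem mem_closure_halfAnnulus {R : ℝ} {W : Set ℂ}
    (hW : W ⊆ {z : ℂ | 0 < z.re ∧ 1 / R < ‖z‖ ∧ ‖z‖ < R}) {ξ : ℂ} (hξ : ξ ∈ closure W) :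
    0 ≤ ξ.re ∧ 1 / R ≤ ‖ξ‖ ∧ ‖ξ‖ ≤ R := by
  have hc : IsClosed {z : ℂ | 0 ≤ z.re ∧ 1 / R ≤ ‖z‖ ∧ ‖z‖ ≤ R} :=
    (isClosed_le continuous_const Complex.continuous_re).inter
      ((isClosed_le continuous_const continuous_norm).inter
        (isClosed_le continuous_norm continuous_const))
  have hsub : W ⊆ {z : ℂ | 0 ≤ z.re ∧ 1 / R ≤ ‖z‖ ∧ ‖z‖ ≤ R} := fun z hz =>
    ⟨(hW hz).1.le, (hW hz).2.1.le, (hW hz).2.2.le⟩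
  exact closure_minimal hsub hc hξ

/-- Two-constants estimate for a subdomain of a half annulus in the right half plane whose boundary
meets only one of the two boundary segments on the imaginary axis. -/
theorem norm_one_le_of_frontier {f : ℂ → ℂ} (hf : DifferentiableOn ℂ f {z | 0 < z.re})
    (hf1 : ∀ z : ℂ, 0 < z.re → ‖f z‖ ≤ 1) {l : ℝ} (hl : 0 < l) {s : ℝ} (hs : s = 1 ∨ s = -1)
    {W : Set ℂ} (hW : IsOpen W) (hWsub : W ⊆ {z : ℂ | 0 < z.re ∧ 1 / 256 < ‖z‖ ∧ ‖z‖ < 256})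
    (hfr : ∀ ξ ∈ frontier W, (0 < ξ.re ∧ ‖f ξ‖ ≤ Real.exp (-l)) ∨ ‖ξ‖ = 1 / 256 ∨ ‖ξ‖ = 256 ∨
      (ξ.re = 0 ∧ 0 < s * ξ.im)) (h1 : (1 : ℂ) ∈ W) : ‖f 1‖ ≤ Real.exp (-(l / 4)) := by
  set q : ℂ → ℂ := fun w => Complex.exp (1 / 2 * Complex.log w) with hq
  set p : ℂ → ℂ := fun w => Complex.exp (-(1 / 2 * Complex.log w)) with hp
  -- An explicit comparison function. The first two terms have real part between `0` and `l`,
  -- vanishing on the half of the imaginary axis selected by `s`. The terms `w ^ (1/2)` and `w ^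
  -- (-1/2)` have positive real part. On the circles of radius `256` and `1 / 256`, where the larger
  -- root has modulus `16` and the cosine is at least `1 / 2`, they contribute at least `l`. Hence
  -- `‖f exp G‖ ≤ 1` at the boundary, while `Re G 1 = l / 2 - l / 4`.
  set G : ℂ → ℂ := fun w => l / 2 + s * Complex.I * (l / Real.pi) * Complex.log w -
    l / 8 * (q w + p w) with hG
  have hGd : ∀ w ∈ Complex.slitPlane, DifferentiableAt ℂ G w := by
    intro w hw
    have := Complex.differentiableAt_log hw
    simp only [hG, hq, hp]
    fun_prop
  have hGre : ∀ w : ℂ, w ≠ 0 → (G w).re = l / 2 - s * (l / Real.pi) * w.arg -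
      l / 8 * ((Real.exp (Real.log ‖w‖ / 2) + Real.exp (-(Real.log ‖w‖ / 2))) *
        Real.cos (w.arg / 2)) := by
    intro w hw
    have e1 : (s * Complex.I * (l / Real.pi) * Complex.log w : ℂ) =
        ((s * (l / Real.pi) : ℝ) : ℂ) * (Complex.I * Complex.log w) := by push_cast; ring
    have e2 : (l / 8 * (q w + p w) : ℂ) = ((l / 8 : ℝ) : ℂ) * (q w + p w) := by push_cast; ring
    have e3 : (l / 2 : ℂ) = ((l / 2 : ℝ) : ℂ) := by push_cast; ring
    have e4 : (1 / 2 * Complex.log w).re = Real.log ‖w‖ / 2 := by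
      rw [show (1 / 2 : ℂ) = ((1 / 2 : ℝ) : ℂ) by push_cast; ring, Complex.re_ofReal_mul,
        Complex.log_re]
      ring
    have e5 : (1 / 2 * Complex.log w).im = w.arg / 2 := by
      rw [show (1 / 2 : ℂ) = ((1 / 2 : ℝ) : ℂ) by push_cast; ring, Complex.im_ofReal_mul,
        Complex.log_im]
      ring
    simp only [hG]
    rw [Complex.sub_re, Complex.add_re, e1, e2, e3, Complex.re_ofReal_mul, Complex.re_ofReal_mul,
      Complex.ofReal_re, Complex.add_re, hq, hp]
    simp only
    rw [Complex.exp_re, Complex.exp_re, Complex.neg_re, Complex.neg_im, e4, e5, Real.cos_neg,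
      Complex.I_mul_re, Complex.log_im]
    ring
  have hcos : ∀ w : ℂ, 0 ≤ w.re → 1 / 2 ≤ Real.cos (w.arg / 2) := by
    intro w hw
    have h2 := Complex.abs_arg_le_pi_div_two_iff.mpr hw
    rw [← Real.cos_pi_div_three, ← Real.cos_abs (w.arg / 2)]
    refine Real.cos_le_cos_of_nonneg_of_le_pi (abs_nonneg _) (by linarith [Real.pi_pos]) ?_
    rw [abs_div, abs_of_pos (two_pos : (0 : ℝ) < 2)]
    linarith [Real.pi_pos]
  have hlog : Real.exp (Real.log 256 / 2) = 16 := by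
    rw [show (256 : ℝ) = 16 ^ 2 by norm_num, Real.log_pow]
    rw [show ((2 : ℕ) : ℝ) * Real.log 16 / 2 = Real.log 16 by push_cast; ring]
    exact Real.exp_log (by norm_num)
  have harg : ∀ w : ℂ, 0 ≤ w.re → - s * (l / Real.pi) * w.arg ≤ l / 2 := by
    intro w hw
    have h2 := Complex.abs_arg_le_pi_div_two_iff.mpr hw
    have h3 : |- s * (l / Real.pi) * w.arg| ≤ l / 2 := by
      rw [abs_mul, abs_mul, abs_neg]
      have : |s| = 1 := by rcases hs with rfl | rfl <;> simp
      rw [this, one_mul, abs_of_pos (by positivity)]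
      calc l / Real.pi * |w.arg| ≤ l / Real.pi * (Real.pi / 2) := by gcongr
        _ = l / 2 := by field_simp
    exact (le_abs_self _).trans h3
  have hball : W ⊆ Metric.ball 0 256 := fun w hw => by simpa using (hWsub hw).2.2
  have hslit : ∀ w : ℂ, 0 < w.re → w ∈ Complex.slitPlane := fun w hw => .inl hw
  have hfd : ∀ w : ℂ, 0 < w.re → DifferentiableAt ℂ f w := fun w hw =>
    hf.differentiableAt ((isOpen_lt continuous_const Complex.continuous_re).mem_nhds hw)
  have hnorm : ∀ w, ‖f w * Complex.exp (G w)‖ = ‖f w‖ * Real.exp (G w).re := fun w => by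
    rw [norm_mul, Complex.norm_exp]
  have key := norm_le_of_eventually_frontier hW (Metric.isBounded_ball.subset hball)
    (f := fun w => f w * Complex.exp (G w)) (M := 1)
    (fun w hw => ((hfd w (hWsub hw).1).mul
      (hGd w (hslit w (hWsub hw).1)).cexp).differentiableWithinAt) (fun ξ hξ M' hM' => by
      have hcl := mem_closure_halfAnnulus hWsub (frontier_subset_closure hξ)
      have hξ0 : ξ ≠ 0 := by
        rintro rfl
        have := hcl.2.1
        norm_num at this
      have hcosξ := hcos ξ hcl.1
      have hposE : 0 < Real.exp (Real.log ‖ξ‖ / 2) + Real.exp (-(Real.log ‖ξ‖ / 2)) := by positivity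
      have hcase : (0 < ξ.re ∧ ‖f ξ‖ ≤ Real.exp (-l) ∧ (G ξ).re ≤ l) ∨
          (ξ ∈ Complex.slitPlane ∧ (G ξ).re ≤ 0) := by
        have hbd : ∀ c : ℝ, 16 ≤ c → (Real.exp (Real.log ‖ξ‖ / 2) +
            Real.exp (-(Real.log ‖ξ‖ / 2))) = c →  (G ξ).re ≤ 0 := by
          intro c hc hc2
          rw [hGre ξ hξ0, hc2]
          have := harg ξ hcl.1
          have h8 : 8 ≤ c * Real.cos (ξ.arg / 2) := by nlinarith
          nlinarith
        have hslit' : ‖ξ‖ = 1 / 256 ∨ ‖ξ‖ = 256 → ξ ∈ Complex.slitPlane := by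
          intro h
          rcases hcl.1.lt_or_eq with h' | h'
          · exact .inl h'
          · refine .inr fun h2 => hξ0 (Complex.ext h'.symm h2)
        rcases hfr ξ hξ with h | h | h | h
        · left
          refine ⟨h.1, h.2, ?_⟩
          rw [hGre ξ hξ0]
          have := harg ξ hcl.1
          nlinarith [mul_pos hposE (by linarith : 0 < Real.cos (ξ.arg / 2))]
        · right
          refine ⟨hslit' (.inl h), hbd _ ?_ rfl⟩
          rw [h, one_div, Real.log_inv, neg_div, neg_neg, hlog]
          linarith [Real.exp_pos (-(Real.log 256 / 2))]
        · right
          refine ⟨hslit' (.inr h), hbd _ ?_ rfl⟩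
          rw [h, hlog]
          linarith [Real.exp_pos (-(Real.log 256 / 2))]
        · right
          have him : ξ.im ≠ 0 := fun h0 => by simp [h0] at h
          refine ⟨.inr him, ?_⟩
          rw [hGre ξ hξ0]
          have hargs : s * ξ.arg = Real.pi / 2 := by
            rcases hs with rfl | rfl
            · rw [one_mul, Complex.arg_eq_pi_div_two_iff]
              exact ⟨h.1, by simpa using h.2⟩
            · have : ξ.arg = -(Real.pi / 2) :=
                Complex.arg_eq_neg_pi_div_two_iff.mpr ⟨h.1, by simpa using h.2⟩
              rw [this]; ring
          have : s * (l / Real.pi) * ξ.arg = l / 2 := by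
            rw [mul_right_comm, hargs]
            field_simp
          rw [this]
          nlinarith [mul_pos hposE (by linarith : 0 < Real.cos (ξ.arg / 2))]
      rcases hcase with ⟨hre, hfξ, hGξ⟩ | ⟨hsl, hGξ⟩
      · have hc : ContinuousAt (fun w => ‖f w * Complex.exp (G w)‖) ξ :=
          ((hfd ξ hre).mul (hGd ξ (hslit ξ hre)).cexp).continuousAt.norm
        have hlt : ‖f ξ * Complex.exp (G ξ)‖ < M' := by
          refine lt_of_le_of_lt ?_ hM'
          rw [hnorm]
          calc _ ≤ Real.exp (-l) * Real.exp l := by gcongr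
            _ = 1 := by rw [← Real.exp_add]; simp
        exact nhdsWithin_le_nhds ((hc.eventually_lt continuousAt_const hlt).mono fun _ h => h.le)
      · have hc : ContinuousAt (fun w => Real.exp (G w).re) ξ :=
          Real.continuous_exp.continuousAt.comp
            (Complex.continuous_re.continuousAt.comp (hGd ξ hsl).continuousAt)
        have hlt : Real.exp (G ξ).re < M' := lt_of_le_of_lt (Real.exp_le_one_iff.mpr hGξ) hM'
        filter_upwards [nhdsWithin_le_nhds (hc.eventually_lt continuousAt_const hlt),
          self_mem_nhdsWithin] with w hw hwW
        rw [hnorm]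
        exact (mul_le_of_le_one_left (Real.exp_pos _).le (hf1 w (hWsub hwW).1)).trans hw.le) h1
  rw [hnorm, hGre 1 one_ne_zero] at key
  simp only [Complex.arg_one, norm_one, Real.log_one, zero_div, neg_zero, Real.exp_zero,
    Real.cos_zero, mul_zero] at key
  have h3 : l / 2 - 0 - l / 8 * ((1 + 1) * 1) = l / 4 := by ring
  rw [h3] at key
  rw [Real.exp_neg]
  rwa [← le_div_iff₀ (Real.exp_pos _), one_div] at key

/-- A bounded holomorphic function on the right half plane which is small on a connected set
reaching from near `0` to near `∞` is bounded away from `1` in modulus at `1`. -/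
theorem norm_one_le_of_isPreconnected {f : ℂ → ℂ} (hf : DifferentiableOn ℂ f {z | 0 < z.re})
    (hf1 : ∀ z : ℂ, 0 < z.re → ‖f z‖ ≤ 1) {l : ℝ} (hl : 0 < l) {Ω : Set ℂ} (ho : IsOpen Ω)
    (hc : IsPreconnected Ω) (hΩ : Ω ⊆ {z | 0 < z.re}) (hfΩ : ∀ z ∈ Ω, ‖f z‖ ≤ Real.exp (-l))
    {a b : ℂ} (ha : a ∈ Ω) (hb : b ∈ Ω) (ha' : 512 ≤ ‖a‖) (hb' : ‖b‖ ≤ 1 / 512) :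
    ‖f 1‖ ≤ Real.exp (-(l / 4)) := by
  obtain ⟨K, hKΩ, hKc, hbK, haK, L, hL, hLe⟩ := exists_log_div ho hc hb ha
  have hKre : ∀ z : ℂ, z.re ≤ 0 → z ∉ K := fun z hz hzK => not_lt.mpr hz (hΩ (hKΩ hzK))
  by_cases h1K : (1 : ℂ) ∈ K
  · refine (hfΩ 1 (hKΩ h1K)).trans (Real.exp_le_exp.mpr (by linarith))
  have ha0 : a ≠ 0 := by rintro rfl; norm_num at ha'
  have hLd : ∀ z ∉ K, DifferentiableAt ℂ L z := fun z hz =>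
    hL.differentiableAt (hKc.isClosed.isOpen_compl.mem_nhds hz)
  have hslit1 : ∀ u : ℂ, ‖u‖ < 1 → 0 < (1 - u).re := by
    intro u hu
    have := Complex.re_le_norm u
    simp only [Complex.sub_re, Complex.one_re]
    linarith
  have hdb : ∀ z : ℂ, 1 / 256 < ‖z‖ → 0 < (1 - b / z).re := fun z hz => by
    apply hslit1
    rw [norm_div, div_lt_one (by linarith [norm_nonneg z])]
    linarith
  have hda : ∀ z : ℂ, ‖z‖ < 256 → 0 < (1 - z / a).re := fun z hz => by
    apply hslit1
    rw [norm_div, div_lt_one (by linarith)]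
    linarith
  set V : Set ℂ := {z | z ∈ Complex.slitPlane ∧ (1 / 256 < ‖z‖ ∧ ‖z‖ < 256) ∧ z ∉ K} with hV
  have hVo : IsOpen V := Complex.isOpen_slitPlane.inter
    (((isOpen_lt continuous_const continuous_norm).inter
      (isOpen_lt continuous_norm continuous_const)).inter hKc.isClosed.isOpen_compl)
  -- Here `exp E` is the constant `-1 / a`, so `E` is locally constant on the slit annulus off `K`.
  -- It replaces plane topology: where `E` takes different values, `K` separates.
  set E : ℂ → ℂ := fun z => L z - Complex.log z - Complex.log (1 - b / z) + Complex.log (1 - z / a)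
    with hE
  have hEc : ContinuousOn E V := by
    intro z hz
    have hz0 : z ≠ 0 := Complex.slitPlane_ne_zero hz.1
    refine ContinuousAt.continuousWithinAt ?_
    refine (((hLd z hz.2.2).continuousAt.sub (continuousAt_clog hz.1)).sub
      (ContinuousAt.clog ?_ (.inl (hdb z hz.2.1.1)))).add
      (ContinuousAt.clog ?_ (.inl (hda z hz.2.1.2)))
    · fun_prop (disch := assumption)
    · fun_prop (disch := assumption)
  have hza : ∀ z ∉ K, z - a ≠ 0 := fun z hz h => hz (by rwa [sub_eq_zero.mp h])
  have hzb : ∀ z ∉ K, z - b ≠ 0 := fun z hz h => hz (by rwa [sub_eq_zero.mp h])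
  have hne : ∀ u : ℂ, 0 < u.re → u ≠ 0 := fun u hu h => by simp [h] at hu
  have hEe : ∀ z ∈ V, Complex.exp (E z) = -1 / a := by
    intro z hz
    have hz0 : z ≠ 0 := Complex.slitPlane_ne_zero hz.1
    simp only [hE]
    rw [Complex.exp_add, Complex.exp_sub, Complex.exp_sub, hLe z hz.2.2, Complex.exp_log hz0,
      Complex.exp_log (hne _ (hdb z hz.2.1.1)), Complex.exp_log (hne _ (hda z hz.2.1.2))]
    have h1 := hza z hz.2.2
    have h2 := hzb z hz.2.2
    have h3 : 1 - b / z = (z - b) / z := by field_simp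
    have h4 : 1 - z / a = -(z - a) / a := by field_simp; ring
    rw [h3, h4]
    field_simp
  have hpos : ∀ y ∈ Ioo (1 / 256 : ℝ) 256, ∀ s : ℝ, s = 1 ∨ s = -1 →
      (s * y : ℝ) * Complex.I ∈ V := by
    intro y hy s hs
    have hy0 : 0 < y := lt_trans (by norm_num) hy.1
    have hn : ‖((s * y : ℝ) : ℂ) * Complex.I‖ = y := by
      rcases hs with rfl | rfl <;> simp [abs_of_pos hy0]
    refine ⟨.inr ?_, by rw [hn]; exact hy, hKre _ (by simp)⟩
    rcases hs with rfl | rfl <;> simp [hy0.ne']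
  have haxis : ∀ s : ℝ, s = 1 ∨ s = -1 → ∀ y ∈ Ioo (1 / 256 : ℝ) 256,
      E ((s * y : ℝ) * Complex.I) = E (s * Complex.I) := by
    intro s hs y hy
    have hT : IsPreconnected ((fun y : ℝ => ((s * y : ℝ) : ℂ) * Complex.I) '' Ioo (1 / 256) 256) :=
      isPreconnected_Ioo.image _ (by fun_prop)
    have hTV : (fun y : ℝ => ((s * y : ℝ) : ℂ) * Complex.I) '' Ioo (1 / 256) 256 ⊆ V := by
      rintro _ ⟨y, hy, rfl⟩
      exact hpos y hy s hs
    have := eq_of_exp_const hT (hEc.mono hTV) (fun z hz => hEe z (hTV hz)) ⟨y, hy, rfl⟩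
      ⟨1, by norm_num, rfl⟩
    simpa using this
  -- In the left half plane, which `K` avoids, `E'` is continuous and so takes equal values at `I`
  -- and `-I`. The difference of `E` and `E'` contains `log z`, whose argument changes by `π`
  -- between these points; the arguments of the other logarithms cannot compensate because `b` is
  -- small. Thus the two halves of the axis are separated by `K` inside the right half annulus.
  have hdiff : E Complex.I ≠ E (-Complex.I) := by
    have hT : IsPreconnected ({z : ℂ | z.re ≤ 0} ∩ Metric.ball 0 256) :=
      ((convex_halfSpace_re_le 0).inter (convex_ball 0 256)).isPreconnected
    set E' : ℂ → ℂ := fun z => L z - Complex.log (b - z) + Complex.log (1 - z / a) with hE'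
    have hbre : ∀ z : ℂ, z.re ≤ 0 → 0 < (b - z).re := fun z hz => by
      have := hΩ hb
      simp only [mem_ofPred_eq] at this
      simp only [Complex.sub_re]
      linarith
    have h1 := eq_of_exp_const hT (g := E') (κ := 1 / a) (fun z hz => by
      refine ContinuousAt.continuousWithinAt ?_
      have hzn : ‖z‖ < 256 := by simpa using hz.2
      refine ((hLd z (hKre z hz.1)).continuousAt.sub
        (ContinuousAt.clog (by fun_prop) (.inl (hbre z hz.1)))).add
        (ContinuousAt.clog ?_ (.inl (hda z hzn)))
      fun_prop (disch := assumption)) (fun z hz => by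
      have hzn : ‖z‖ < 256 := by simpa using hz.2
      have hzK := hKre z hz.1
      simp only [hE']
      rw [Complex.exp_add, Complex.exp_sub, hLe z hzK, Complex.exp_log (hne _ (hbre z hz.1)),
        Complex.exp_log (hne _ (hda z hzn))]
      have h1 := hza z hzK
      have h2 := hzb z hzK
      have h4 : 1 - z / a = -(z - a) / a := by field_simp; ring
      have h5 : b - z = -(z - b) := by ring
      rw [h4, h5]
      field_simp) (x := Complex.I) (y := -Complex.I) (by simp) (by simp)
    intro h2
    have h3 : Complex.log (b - Complex.I) - Complex.log (b + Complex.I) -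
        (Complex.log Complex.I - Complex.log (-Complex.I)) -
        (Complex.log (1 - b / Complex.I) - Complex.log (1 - b / -Complex.I)) = 0 := by
      simp only [hE, hE', sub_neg_eq_add] at h1 h2
      linear_combination h2 - h1
    have h4 := congrArg Complex.im h3
    simp only [Complex.sub_im, Complex.log_im, Complex.zero_im, Complex.arg_I, Complex.arg_neg_I]
      at h4
    have hbim : |b.im| ≤ 1 / 512 := (Complex.abs_im_le_norm b).trans hb'
    rw [abs_le] at hbim
    have h5 : (b - Complex.I).arg < 0 := by
      rw [Complex.arg_neg_iff]
      simp only [Complex.sub_im, Complex.I_im]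
      linarith [hbim.2]
    have h6 : 0 ≤ (b + Complex.I).arg := by
      rw [Complex.arg_nonneg_iff]
      simp only [Complex.add_im, Complex.I_im]
      linarith [hbim.1]
    have h7 := Complex.abs_arg_le_pi_div_two_iff.mpr
      (hdb Complex.I (by rw [Complex.norm_I]; norm_num)).le
    have h8 := Complex.abs_arg_le_pi_div_two_iff.mpr
      (hdb (-Complex.I) (by rw [norm_neg, Complex.norm_I]; norm_num)).le
    rw [abs_le] at h7 h8
    linarith [h7.1, h8.2]
  have main : ∀ (s : ℝ) (p : ℂ → Prop), (s = 1 ∨ s = -1) → (p (E Complex.I) → s = 1) →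
      (p (E (-Complex.I)) → s = -1) → p (E 1) → ‖f 1‖ ≤ Real.exp (-(l / 4)) := by
    intro s p hs hp1 hp2 hp
    -- A union of components of the half annulus minus `K`. The predicate `p` selects values of `E`
    -- so that `1` is included and at most one half of the imaginary axis is touched.
    set W : Set ℂ := {z | 0 < z.re ∧ (1 / 256 < ‖z‖ ∧ ‖z‖ < 256) ∧ z ∉ K ∧ p (E z)} with hWdef
    have hWV : W ⊆ V := fun z hz => ⟨.inl hz.1, hz.2.1, hz.2.2.1⟩
    have hloc : ∀ ξ ∈ V, ∀ᶠ z in 𝓝 ξ, E z = E ξ := by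
      intro ξ hξ
      obtain ⟨ε, hε, hball⟩ := Metric.isOpen_iff.mp hVo ξ hξ
      filter_upwards [Metric.ball_mem_nhds ξ hε] with z hz
      exact eq_of_exp_const (convex_ball ξ ε).isPreconnected (hEc.mono hball)
        (fun w hw => hEe w (hball hw)) hz (Metric.mem_ball_self hε)
    have hWo : IsOpen W := by
      rw [isOpen_iff_mem_nhds]
      intro ξ hξ
      filter_upwards [hloc ξ (hWV hξ), hVo.mem_nhds (hWV hξ),
        (isOpen_lt continuous_const Complex.continuous_re).mem_nhds hξ.1] with z h1 h2 h3
      exact ⟨h3, h2.2.1, h2.2.2, h1 ▸ hξ.2.2.2⟩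
    refine norm_one_le_of_frontier hf hf1 hl hs hWo (fun z hz => ⟨hz.1, hz.2.1⟩) (fun ξ hξ => ?_)
      ⟨by simp, by norm_num, h1K, hp⟩
    rw [hWo.frontier_eq] at hξ
    have hcl := mem_closure_halfAnnulus (R := 256) (W := W) (fun z hz => ⟨hz.1, hz.2.1⟩) hξ.1
    rcases hcl.2.1.eq_or_lt with h | hn1
    · exact .inr (.inl h.symm)
    rcases hcl.2.2.eq_or_lt with h | hn2
    · exact .inr (.inr (.inl h))
    by_cases hξK : ξ ∈ K
    · exact .inl ⟨hΩ (hKΩ hξK), hfΩ ξ (hKΩ hξK)⟩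
    have hξ0 : ξ ≠ 0 := by
      rintro rfl
      norm_num at hn1
    have hξV : ξ ∈ V := by
      refine ⟨?_, ⟨hn1, hn2⟩, hξK⟩
      rcases hcl.1.lt_or_eq with h' | h'
      · exact .inl h'
      · refine .inr fun h2 => hξ0 (Complex.ext h'.symm h2)
    have hpξ : p (E ξ) := by
      obtain ⟨z, hz1, hz2⟩ := (mem_closure_iff_nhds.mp hξ.1) _ (hloc ξ hξV)
      have hz1' : E z = E ξ := hz1
      exact hz1' ▸ hz2.2.2.2
    rcases hcl.1.lt_or_eq with hre | hre
    · exact absurd ⟨hre, ⟨hn1, hn2⟩, hξK, hpξ⟩ hξ.2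
    · refine .inr (.inr (.inr ⟨hre.symm, ?_⟩))
      have him : ξ.im ≠ 0 := fun h2 => hξ0 (Complex.ext hre.symm h2)
      have hξI : ξ = (ξ.im : ℂ) * Complex.I := Complex.ext (by simp [← hre]) (by simp)
      have hnim : ‖ξ‖ = |ξ.im| := by
        conv_lhs => rw [hξI]
        simp
      rcases him.lt_or_gt with hneg | hpos'
      · have := haxis (-1) (.inr rfl) (-ξ.im) (by
          rw [hnim, abs_of_neg hneg] at hn1 hn2; exact ⟨hn1, hn2⟩)
        rw [show -1 * -ξ.im = ξ.im by ring, ← hξI] at this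
        rw [this] at hpξ
        have hs' := hp2 (by simpa using hpξ)
        rw [hs']
        linarith
      · have := haxis 1 (.inl rfl) ξ.im (by
          rw [hnim, abs_of_pos hpos'] at hn1 hn2; exact ⟨hn1, hn2⟩)
        rw [one_mul, ← hξI] at this
        rw [this] at hpξ
        have hs' := hp1 (by simpa using hpξ)
        rw [hs']
        linarith
  -- The point `1` is separated from `-I` in the first case and from `I` in the second.
  by_cases h : E 1 = E Complex.I
  · exact main 1 (fun w => w = E Complex.I) (.inl rfl) (fun _ => rfl)
      (fun h' => absurd h'.symm hdiff) h
  · exact main (-1) (fun w => w ≠ E Complex.I) (.inr rfl) (fun h' => absurd rfl h')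
      (fun _ => rfl) h

end

/-! ### Removable segments and a criterion for regular boundary points. -/

noncomputable section

open scoped ComplexConjugate Interval

open Complex in
/-- The integral of `f` along the boundary of a rectangle. -/
def rectIntegral (f : ℂ → ℂ) (x₁ x₂ y₁ y₂ : ℝ) : ℂ :=
  (∫ x : ℝ in x₁..x₂, f (x + y₁ * I)) - (∫ x : ℝ in x₁..x₂, f (x + y₂ * I)) +
    I * (∫ y : ℝ in y₁..y₂, f (x₂ + y * I)) - I * (∫ y : ℝ in y₁..y₂, f (x₁ + y * I))

theorem rectIntegral_swap (f : ℂ → ℂ) (x₁ x₂ y₁ y₂ : ℝ) :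
    rectIntegral f x₁ x₂ y₂ y₁ = -rectIntegral f x₁ x₂ y₁ y₂ := by
  simp only [rectIntegral]
  rw [intervalIntegral.integral_symm y₁ y₂, intervalIntegral.integral_symm y₁ y₂]
  ring

theorem rectIntegral_eq_zero {f : ℂ → ℂ} {x₁ x₂ y₁ y₂ : ℝ}
    (hc : ContinuousOn f ([[x₁, x₂]] ×ℂ [[y₁, y₂]]))
    (hd : DifferentiableOn ℂ f (Ioo (min x₁ x₂) (max x₁ x₂) ×ℂ Ioo (min y₁ y₂) (max y₁ y₂))) :
    rectIntegral f x₁ x₂ y₁ y₂ = 0 :=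
  Complex.integral_boundary_rect_eq_zero_of_continuousOn_of_differentiableOn f ⟨x₁, y₁⟩ ⟨x₂, y₂⟩
    hc hd

section Jump

variable {f : ℂ → ℂ} {η B : ℝ}

/-- The open square with centre `0` and side length `2 η`. -/
def centeredSquare (η : ℝ) : Set ℂ := Ioo (-η) η ×ℂ Ioo (-η) η

theorem isOpen_centeredSquare (η : ℝ) : IsOpen (centeredSquare η) :=
  isOpen_Ioo.reProdIm isOpen_Ioo

theorem mk_mem_centeredSquare {x y : ℝ} (hx : x ∈ Ioo (-η) η) (hy : y ∈ Ioo (-η) η) :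
    (x + y * Complex.I : ℂ) ∈ centeredSquare η := by
  simp only [centeredSquare, Complex.mem_reProdIm]
  constructor <;> simpa

theorem intervalIntegrable_vertical
    (hd : ∀ z ∈ centeredSquare η, z.im ≠ 0 → DifferentiableAt ℂ f z)
    (hB : ∀ z ∈ centeredSquare η, ‖f z‖ ≤ B) {x y₁ y₂ : ℝ} (hx : x ∈ Ioo (-η) η)
    (h₁ : y₁ ∈ Ioo (-η) η) (h₂ : y₂ ∈ Ioo (-η) η) :
    IntervalIntegrable (fun y : ℝ => f (x + y * Complex.I)) volume y₁ y₂ := by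
  have hsub : Ι y₁ y₂ ⊆ Ioo (-η) η := uIoc_subset_uIcc.trans ((ordConnected_Ioo).uIcc_subset h₁ h₂)
  rw [intervalIntegrable_iff]
  have hae : (Ι y₁ y₂ \ {0} : Set ℝ) =ᵐ[volume] Ι y₁ y₂ := sdiff_null_ae_eq_self (by simp)
  refine IntegrableOn.congr_set_ae ?_ hae.symm
  have hcont : ContinuousOn (fun y : ℝ => f (x + y * Complex.I)) (Ι y₁ y₂ \ {0}) := by
    intro y hy
    refine ContinuousAt.continuousWithinAt ?_
    have := (hd _ (mk_mem_centeredSquare hx (hsub hy.1)) (by simpa using hy.2)).continuousAt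
    exact ContinuousAt.comp (g := f) (f := fun y : ℝ => (x + y * Complex.I : ℂ)) this (by fun_prop)
  have hm : MeasurableSet (Ι y₁ y₂ \ {0} : Set ℝ) := measurableSet_uIoc.diff (measurableSet_singleton _)
  refine IntegrableOn.of_bound ?_ (hcont.aestronglyMeasurable hm) B ?_
  · refine (measure_mono sdiff_subset).trans_lt ?_
    simp [uIoc]
  · filter_upwards [ae_restrict_mem hm] with y hy
    exact hB _ (mk_mem_centeredSquare hx (hsub hy.1))

theorem intervalIntegrable_horizontal
    (hd : ∀ z ∈ centeredSquare η, z.im ≠ 0 → DifferentiableAt ℂ f z)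
    {x₁ x₂ y : ℝ} (h₁ : x₁ ∈ Ioo (-η) η) (h₂ : x₂ ∈ Ioo (-η) η) (hy : y ∈ Ioo (-η) η)
    (hy0 : y ≠ 0) :
    IntervalIntegrable (fun x : ℝ => f (x + y * Complex.I)) volume x₁ x₂ := by
  refine ContinuousOn.intervalIntegrable fun x hx => ContinuousAt.continuousWithinAt ?_
  have hx' := (ordConnected_Ioo).uIcc_subset h₁ h₂ hx
  have := (hd _ (mk_mem_centeredSquare hx' hy) (by simpa using hy0)).continuousAt
  exact ContinuousAt.comp (g := f) (f := fun x : ℝ => (x + y * Complex.I : ℂ)) this (by fun_prop)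

theorem rectIntegral_eq_zero_of_same_side
    (hd : ∀ z ∈ centeredSquare η, z.im ≠ 0 → DifferentiableAt ℂ f z)
    {x₁ x₂ y₁ y₂ : ℝ} (h₁ : x₁ ∈ Ioo (-η) η) (h₂ : x₂ ∈ Ioo (-η) η) (h₃ : y₁ ∈ Ioo (-η) η)
    (h₄ : y₂ ∈ Ioo (-η) η) (h0 : (0 : ℝ) ∉ [[y₁, y₂]]) : rectIntegral f x₁ x₂ y₁ y₂ = 0 := by
  have hd' : DifferentiableOn ℂ f ([[x₁, x₂]] ×ℂ [[y₁, y₂]]) := by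
    intro z hz
    rw [Complex.mem_reProdIm] at hz
    refine (hd z ?_ fun h => h0 (h ▸ hz.2)).differentiableWithinAt
    exact ⟨(ordConnected_Ioo).uIcc_subset h₁ h₂ hz.1, (ordConnected_Ioo).uIcc_subset h₃ h₄ hz.2⟩
  refine rectIntegral_eq_zero hd'.continuousOn (hd'.mono ?_)
  intro z hz
  exact ⟨Ioo_subset_Icc_self hz.1, Ioo_subset_Icc_self hz.2⟩

/-- Cut out the strip `|Im z| < ε`. The two remaining rectangles contribute nothing; the horizontal
sides of the strip cancel in the limit by dominated convergence, and its vertical sides are `O(ε)`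
because `f` is bounded. -/
theorem rectIntegral_eq_zero_of_jump
    (hd : ∀ z ∈ centeredSquare η, z.im ≠ 0 → DifferentiableAt ℂ f z)
    (hB : ∀ z ∈ centeredSquare η, ‖f z‖ ≤ B)
    (hj : ∀ᵐ x : ℝ, x ∈ Ioo (-η) η →
      Tendsto (fun y : ℝ => f (x + y * Complex.I) - f (x + (-y : ℝ) * Complex.I)) (𝓝[>] 0) (𝓝 0))
    {x₁ x₂ y₁ y₂ : ℝ} (h₁ : x₁ ∈ Ioo (-η) η) (h₂ : x₂ ∈ Ioo (-η) η) (h₃ : y₁ ∈ Ioo (-η) η)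
    (h₄ : y₂ ∈ Ioo (-η) η) (hy₁ : y₁ ≠ 0) (hy₂ : y₂ ≠ 0) : rectIntegral f x₁ x₂ y₁ y₂ = 0 := by
  by_cases h0 : (0 : ℝ) ∈ [[y₁, y₂]]
  swap
  · exact rectIntegral_eq_zero_of_same_side hd h₁ h₂ h₃ h₄ h0
  wlog hlt : y₁ < y₂ generalizing y₁ y₂
  · rcases (not_lt.mp hlt).eq_or_lt with rfl | h
    · simp at h0; exact absurd h0.symm hy₁
    · have := this h₄ h₃ hy₂ hy₁ (by rwa [uIcc_comm]) h
      rw [rectIntegral_swap, this, neg_zero]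
  rw [uIcc_of_le hlt.le] at h0
  have hy1 : y₁ < 0 := lt_of_le_of_ne h0.1 hy₁
  have hy2 : 0 < y₂ := lt_of_le_of_ne h0.2 hy₂.symm
  have hη : 0 < η := hy2.trans h₄.2
  have hI : uIoc x₁ x₂ ⊆ Ioo (-η) η := uIoc_subset_uIcc.trans ((ordConnected_Ioo).uIcc_subset h₁ h₂)
  have hsmall : ∀ᶠ ε : ℝ in 𝓝[>] 0, 0 < ε ∧ ε < y₂ ∧ ε < -y₁ := by
    filter_upwards [Ioo_mem_nhdsGT (show (0 : ℝ) < min y₂ (-y₁) by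
      rw [lt_min_iff]; exact ⟨hy2, by linarith⟩)] with ε hε
    exact ⟨hε.1, lt_min_iff.mp hε.2⟩
  have hlim1 : Tendsto (fun ε : ℝ => ∫ x : ℝ in x₁..x₂,
      (f (x + ε * Complex.I) - f (x + (-ε : ℝ) * Complex.I))) (𝓝[>] 0) (𝓝 0) := by
    have := intervalIntegral.tendsto_integral_filter_of_dominated_convergence
      (l := 𝓝[>] (0 : ℝ)) (μ := volume) (a := x₁) (b := x₂)
      (F := fun (ε : ℝ) (x : ℝ) => f (x + ε * Complex.I) - f (x + (-ε : ℝ) * Complex.I))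
      (f := fun _ => 0) (fun _ => B + B) (by
        filter_upwards [hsmall] with ε hε
        have e1 : ε ∈ Ioo (-η) η := ⟨by linarith, by linarith [h₄.2]⟩
        have e2 : -ε ∈ Ioo (-η) η := ⟨by linarith [e1.2], by linarith [e1.1]⟩
        exact ((intervalIntegrable_horizontal hd h₁ h₂ e1 hε.1.ne').sub
          (intervalIntegrable_horizontal hd h₁ h₂ e2 (by linarith [hε.1]))).def'.1) (by
        filter_upwards [hsmall] with ε hε
        have e1 : ε ∈ Ioo (-η) η := ⟨by linarith, by linarith [h₄.2]⟩
        have e2 : -ε ∈ Ioo (-η) η := ⟨by linarith [e1.2], by linarith [e1.1]⟩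
        refine Eventually.of_forall fun x hx => (norm_sub_le _ _).trans (add_le_add ?_ ?_)
        · exact hB _ (mk_mem_centeredSquare (hI hx) e1)
        · exact hB _ (mk_mem_centeredSquare (hI hx) e2))
      intervalIntegrable_const (by
        filter_upwards [hj] with x hx hxI using hx (hI hxI))
    simpa using this
  have hvert : ∀ x ∈ Ioo (-η) η, Tendsto (fun ε : ℝ => ∫ y : ℝ in (-ε)..ε,
      f (x + y * Complex.I)) (𝓝[>] 0) (𝓝 0) := by
    intro x hx
    have hb : Tendsto (fun ε : ℝ => B * (2 * ε)) (𝓝[>] 0) (𝓝 0) := by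
      have : ContinuousAt (fun ε : ℝ => B * (2 * ε)) 0 := by fun_prop
      have h2 := this.tendsto
      simp only [mul_zero] at h2
      exact h2.mono_left nhdsWithin_le_nhds
    refine squeeze_zero_norm' ?_ hb
    filter_upwards [hsmall] with ε hε
    have e1 : ε ∈ Ioo (-η) η := ⟨by linarith, by linarith [h₄.2]⟩
    have e2 : -ε ∈ Ioo (-η) η := ⟨by linarith [e1.2], by linarith [e1.1]⟩
    have := intervalIntegral.norm_integral_le_of_norm_le_const (a := -ε) (b := ε)
      (f := fun y : ℝ => f (x + y * Complex.I)) (C := B) (fun y hy =>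
        hB _ (mk_mem_centeredSquare hx ((ordConnected_Ioo).uIcc_subset e2 e1 (uIoc_subset_uIcc hy))))
    rwa [show ε - -ε = 2 * ε by ring, abs_of_pos (by linarith)] at this
  have heq : ∀ᶠ ε : ℝ in 𝓝[>] 0, rectIntegral f x₁ x₂ y₁ y₂ =
      -(∫ x : ℝ in x₁..x₂, (f (x + ε * Complex.I) - f (x + (-ε : ℝ) * Complex.I))) +
      Complex.I * (∫ y : ℝ in (-ε)..ε, f (x₂ + y * Complex.I)) -
      Complex.I * (∫ y : ℝ in (-ε)..ε, f (x₁ + y * Complex.I)) := by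
    filter_upwards [hsmall] with ε hε
    have e1 : ε ∈ Ioo (-η) η := ⟨by linarith, by linarith [h₄.2]⟩
    have e2 : -ε ∈ Ioo (-η) η := ⟨by linarith [e1.2], by linarith [e1.1]⟩
    have r1 := rectIntegral_eq_zero_of_same_side hd h₁ h₂ h₃ e2 (by
      rw [uIcc_of_le (by linarith)]; intro h; linarith [h.2])
    have r2 := rectIntegral_eq_zero_of_same_side hd h₁ h₂ e1 h₄ (by
      rw [uIcc_of_le (by linarith)]; intro h; linarith [h.1])
    have split : ∀ x ∈ Ioo (-η) η, (∫ y : ℝ in y₁..y₂, f (x + y * Complex.I)) =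
        (∫ y : ℝ in y₁..(-ε), f (x + y * Complex.I)) + (∫ y : ℝ in (-ε)..ε, f (x + y * Complex.I)) +
        (∫ y : ℝ in ε..y₂, f (x + y * Complex.I)) := by
      intro x hx
      rw [intervalIntegral.integral_add_adjacent_intervals
        (intervalIntegrable_vertical hd hB hx h₃ e2) (intervalIntegrable_vertical hd hB hx e2 e1),
        intervalIntegral.integral_add_adjacent_intervals
        (intervalIntegrable_vertical hd hB hx h₃ e1) (intervalIntegrable_vertical hd hB hx e1 h₄)]
    rw [intervalIntegral.integral_sub (intervalIntegrable_horizontal hd h₁ h₂ e1 hε.1.ne')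
          (intervalIntegrable_horizontal hd h₁ h₂ e2 (by linarith [hε.1]))]
    simp only [rectIntegral] at r1 r2 ⊢
    rw [split x₁ h₁, split x₂ h₂]
    linear_combination r1 + r2
  have hlim := ((hlim1.neg.add ((hvert x₂ h₂).const_mul Complex.I)).sub
    ((hvert x₁ h₁).const_mul Complex.I))
  simp only [neg_zero, mul_zero, add_zero, sub_zero] at hlim
  exact tendsto_nhds_unique (tendsto_const_nhds.congr' heq) hlim

/-- A primitive of `f` obtained by integrating along a horizontal and a vertical segment. -/
def wedgePrimitive (f : ℂ → ℂ) (h : ℝ) (z : ℂ) : ℂ :=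
  (∫ t : ℝ in (0 : ℝ)..z.re, f (t + h * Complex.I)) +
    Complex.I * ∫ s : ℝ in h..z.im, f (z.re + s * Complex.I)

/-- Removability of a segment for bounded holomorphic functions without jump. -/
theorem exists_differentiableOn_of_jump (hη : 0 < η)
    (hd : ∀ z ∈ centeredSquare η, z.im ≠ 0 → DifferentiableAt ℂ f z)
    (hB : ∀ z ∈ centeredSquare η, ‖f z‖ ≤ B)
    (hj : ∀ᵐ x : ℝ, x ∈ Ioo (-η) η →
      Tendsto (fun y : ℝ => f (x + y * Complex.I) - f (x + (-y : ℝ) * Complex.I)) (𝓝[>] 0) (𝓝 0)) :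
    ∃ g : ℂ → ℂ, DifferentiableOn ℂ g (centeredSquare η) ∧
      ∀ z ∈ centeredSquare η, z.im ≠ 0 → g z = f z := by
  have hη2 : η / 2 ∈ Ioo (-η) η := ⟨by linarith, by linarith⟩
  have h0η : (0 : ℝ) ∈ Ioo (-η) η := ⟨by linarith, hη⟩
  have hB0 : 0 ≤ B := (norm_nonneg _).trans (hB 0 ⟨by simpa using hη, by simpa using hη⟩)
  -- The values of `f` on the real axis carry no information, so one works with a primitive, which
  -- is Lipschitz across the axis. Morera's theorem makes it holomorphic, and its derivative is the
  -- required function.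
  set H := wedgePrimitive f (η / 2) with hH
  have hdiff : ∀ z ∈ centeredSquare η, ∀ w ∈ centeredSquare η, w.im ≠ 0 → H w - H z =
      Complex.I * (∫ s : ℝ in z.im..w.im, f (z.re + s * Complex.I)) +
      ∫ t : ℝ in z.re..w.re, f (t + w.im * Complex.I) := by
    intro z hz w hw hwi
    have r := rectIntegral_eq_zero_of_jump hd hB hj hz.1 hw.1 hη2 hw.2 (by positivity) hwi
    simp only [rectIntegral] at r
    have a1 := intervalIntegral.integral_add_adjacent_intervals
      (intervalIntegrable_horizontal hd h0η hz.1 hη2 (by positivity))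
      (intervalIntegrable_horizontal hd hz.1 hw.1 hη2 (by positivity))
    have a2 := intervalIntegral.integral_add_adjacent_intervals
      (intervalIntegrable_vertical hd hB hz.1 hη2 hz.2)
      (intervalIntegrable_vertical hd hB hz.1 hz.2 hw.2)
    simp only [hH, wedgePrimitive]
    linear_combination r - a1 - Complex.I * a2
  have hlip1 : ∀ z ∈ centeredSquare η, ∀ w ∈ centeredSquare η, w.im ≠ 0 →
      ‖H w - H z‖ ≤ B * (|w.im - z.im| + |w.re - z.re|) := by
    intro z hz w hw hwi
    rw [hdiff z hz w hw hwi, mul_add]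
    refine (norm_add_le _ _).trans (add_le_add ?_ ?_)
    · rw [norm_mul, Complex.norm_I, one_mul]
      exact intervalIntegral.norm_integral_le_of_norm_le_const fun s hs => hB _
        (mk_mem_centeredSquare hz.1 ((ordConnected_Ioo).uIcc_subset hz.2 hw.2 (uIoc_subset_uIcc hs)))
    · exact intervalIntegral.norm_integral_le_of_norm_le_const fun s hs => hB _
        (mk_mem_centeredSquare ((ordConnected_Ioo).uIcc_subset hz.1 hw.1 (uIoc_subset_uIcc hs)) hw.2)
  have hlip : ∀ z ∈ centeredSquare η, ∀ w ∈ centeredSquare η,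
      ‖H w - H z‖ ≤ B * (|w.im - z.im| + |w.re - z.re|) := by
    intro z hz w hw
    by_cases hwi : w.im = 0
    swap
    · exact hlip1 z hz w hw hwi
    by_cases hzi : z.im = 0
    swap
    · rw [norm_sub_rev, abs_sub_comm, abs_sub_comm w.re]
      exact hlip1 w hw z hz hzi
    -- Two points of the real axis are compared through a point at height `ε`, because the path
    -- formula needs an endpoint off the axis.
    have hlim : Tendsto (fun ε : ℝ => B * ε + B * (ε + |w.re - z.re|)) (𝓝[>] 0)
        (𝓝 (B * 0 + B * (0 + |w.re - z.re|))) := by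
      have : ContinuousAt (fun ε : ℝ => B * ε + B * (ε + |w.re - z.re|)) 0 := by fun_prop
      exact this.tendsto.mono_left nhdsWithin_le_nhds
    rw [hwi, hzi, sub_self, abs_zero]
    rw [mul_zero, zero_add] at hlim
    refine ge_of_tendsto hlim ?_
    filter_upwards [Ioo_mem_nhdsGT hη] with ε hε
    have hεI : ε ∈ Ioo (-η) η := ⟨by linarith [hε.1], hε.2⟩
    have hw' := mk_mem_centeredSquare hw.1 hεI
    have b1 := hlip1 w hw _ hw' (by simpa using hε.1.ne')
    have b2 := hlip1 z hz _ hw' (by simpa using hε.1.ne')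
    simp only [Complex.add_im, Complex.ofReal_im, Complex.mul_im, Complex.ofReal_re, Complex.I_im,
      Complex.I_re, Complex.add_re, Complex.mul_re, mul_one, mul_zero, zero_add, add_zero, sub_zero,
      sub_self, abs_zero, hwi, hzi, abs_of_pos hε.1] at b1 b2
    calc ‖H w - H z‖ = ‖(H (w.re + ε * Complex.I) - H z) - (H (w.re + ε * Complex.I) - H w)‖ := by
          congr 1; ring
      _ ≤ _ := norm_sub_le _ _
      _ ≤ _ := by linarith
  have hHc : ContinuousOn H (centeredSquare η) := by
    intro z hz
    rw [ContinuousWithinAt, tendsto_iff_norm_sub_tendsto_zero]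
    have hb : Tendsto (fun w : ℂ => B * (|w.im - z.im| + |w.re - z.re|)) (𝓝[centeredSquare η] z)
        (𝓝 0) := by
      have : Continuous (fun w : ℂ => B * (|w.im - z.im| + |w.re - z.re|)) := by fun_prop
      have h2 := this.tendsto z
      simp only [sub_self, abs_zero, add_zero, mul_zero] at h2
      exact h2.mono_left nhdsWithin_le_nhds
    refine squeeze_zero' (Eventually.of_forall fun _ => norm_nonneg _) ?_ hb
    filter_upwards [self_mem_nhdsWithin] with w hw using hlip z hz w hw
  have hHd : ∀ z ∈ centeredSquare η, z.im ≠ 0 → HasDerivAt H (f z) z := by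
    intro z hz hzi
    have hU : IsOpen (centeredSquare η ∩ {w : ℂ | w.im ≠ 0}) :=
      (isOpen_centeredSquare η).inter (isOpen_ne_fun Complex.continuous_im continuous_const)
    obtain ⟨δ, hδ, hball⟩ := Metric.isOpen_iff.mp hU z ⟨hz, hzi⟩
    have hfd : DifferentiableOn ℂ f (Metric.ball z δ) := fun w hw =>
      (hd w (hball hw).1 (hball hw).2).differentiableWithinAt
    have h1 := (hfd.isConservativeOn.hasDerivAt_wedgeIntegral hfd.continuousOn
      (Metric.mem_ball_self hδ)).const_add (H z)
    refine h1.congr_of_eventuallyEq ?_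
    filter_upwards [Metric.ball_mem_nhds z hδ] with w hw
    have := hdiff w (hball hw).1 z hz hzi
    simp only [Complex.wedgeIntegral, smul_eq_mul]
    rw [intervalIntegral.integral_symm z.im w.im, intervalIntegral.integral_symm z.re w.re] at this
    linear_combination -this
  -- A rectangle crossing the axis is cut along it. On each half `H` is continuous up to the
  -- boundary and holomorphic inside, which is enough for Cauchy's theorem.
  have hcons : Complex.IsConservativeOn H (centeredSquare η) := by
    intro z w hzw
    have hc : ContinuousOn H ([[z.re, w.re]] ×ℂ [[z.im, w.im]]) := hHc.mono hzw
    have hmem : ∀ x ∈ [[z.re, w.re]], ∀ y ∈ [[z.im, w.im]], x ∈ Ioo (-η) η ∧ y ∈ Ioo (-η) η := by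
      intro x hx y hy
      exact hzw (show (⟨x, y⟩ : ℂ) ∈ Complex.Rectangle z w from ⟨hx, hy⟩)
    have hz1 := hmem z.re left_mem_uIcc z.im left_mem_uIcc
    have hw1 := hmem w.re right_mem_uIcc w.im right_mem_uIcc
    have hside : ∀ y₁ ∈ Ioo (-η) η, ∀ y₂ ∈ Ioo (-η) η, (0 : ℝ) ∉ Ioo (min y₁ y₂) (max y₁ y₂) →
        rectIntegral H z.re w.re y₁ y₂ = 0 := by
      intro y₁ h₁ y₂ h₂ h0
      refine rectIntegral_eq_zero (hHc.mono fun u hu => ?_) fun u hu => ?_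
      · exact ⟨(ordConnected_Ioo).uIcc_subset hz1.1 hw1.1 hu.1,
          (ordConnected_Ioo).uIcc_subset h₁ h₂ hu.2⟩
      · refine (hHd u ⟨(ordConnected_Ioo).uIcc_subset hz1.1 hw1.1 (Ioo_subset_Icc_self hu.1),
          (ordConnected_Ioo).uIcc_subset h₁ h₂ (Ioo_subset_Icc_self hu.2)⟩
          fun h => h0 (h ▸ hu.2)).differentiableAt.differentiableWithinAt
    have hzero : rectIntegral H z.re w.re z.im w.im = 0 := by
      by_cases h0 : (0 : ℝ) ∈ Ioo (min z.im w.im) (max z.im w.im)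
      swap
      · exact hside _ hz1.2 _ hw1.2 h0
      have r1 := hside z.im hz1.2 0 h0η (by
        rcases le_total z.im 0 with h | h
        · rw [max_eq_right h]; exact fun h' => lt_irrefl _ h'.2
        · rw [min_eq_right h]; exact fun h' => lt_irrefl _ h'.1)
      have r2 := hside 0 h0η w.im hw1.2 (by
        rcases le_total 0 w.im with h | h
        · rw [min_eq_left h]; exact fun h' => lt_irrefl _ h'.1
        · rw [max_eq_left h]; exact fun h' => lt_irrefl _ h'.2)
      have hint : ∀ x ∈ Ioo (-η) η, ∀ y₁ ∈ Ioo (-η) η, ∀ y₂ ∈ Ioo (-η) η,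
          IntervalIntegrable (fun y : ℝ => H (x + y * Complex.I)) volume y₁ y₂ := by
        intro x hx y₁ h₁ y₂ h₂
        refine ContinuousOn.intervalIntegrable ?_
        refine hHc.comp (by fun_prop) fun y hy => ?_
        exact mk_mem_centeredSquare hx ((ordConnected_Ioo).uIcc_subset h₁ h₂ hy)
      have a1 := intervalIntegral.integral_add_adjacent_intervals
        (hint _ hz1.1 _ hz1.2 _ h0η) (hint _ hz1.1 _ h0η _ hw1.2)
      have a2 := intervalIntegral.integral_add_adjacent_intervals
        (hint _ hw1.1 _ hz1.2 _ h0η) (hint _ hw1.1 _ h0η _ hw1.2)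
      simp only [rectIntegral] at r1 r2 ⊢
      linear_combination r1 + r2 - Complex.I * a2 + Complex.I * a1
    rw [← add_eq_zero_iff_eq_neg, Complex.wedgeIntegral_add_wedgeIntegral_eq]
    simpa only [smul_eq_mul, rectIntegral] using hzero
  have hHdiff : DifferentiableOn ℂ H (centeredSquare η) :=
    (Complex.isConservativeOn_and_continuousOn_iff_isDifferentiableOn
      (isOpen_centeredSquare η)).mp ⟨hcons, hHc⟩
  exact ⟨deriv H, hHdiff.deriv (isOpen_centeredSquare η), fun z hz hzi => (hHd z hz hzi).deriv⟩

end Jump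

/-- An inner function which is bounded below near a boundary point extends analytically across
this point. -/
theorem notMem_singularSet_of_le {F : ℂ → ℂ} (hF : IsInnerFunction F) {ζ : ℂ}
    (hζ : ζ ∈ Metric.sphere (0 : ℂ) 1) {δ r : ℝ} (hδ : 0 < δ) (hr : 0 < r) (hr1 : r ≤ 1)
    (hlow : ∀ z ∈ Metric.ball ζ δ, ‖z‖ < 1 → r ≤ ‖F z‖) : ζ ∉ singularSet F := by
  have hz : ‖ζ‖ = 1 := by simpa using hζ
  have hζ0 : ζ ≠ 0 := by rintro rfl; simp at hz
  obtain ⟨θ, hθ⟩ := exp_surj_sphere hz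
  -- `P` straightens the circle: the real axis goes to the circle and the upper half plane to its
  -- inside.
  set P : ℂ → ℂ := fun w => ζ * Complex.exp (Complex.I * w) with hP
  have hPd : Differentiable ℂ P := by fun_prop
  have hPn : ∀ w, ‖P w‖ = Real.exp (-w.im) := by
    intro w
    rw [hP]
    simp [hz, Complex.norm_exp]
  obtain ⟨η, hη, hQ⟩ : ∃ η > 0, ∀ w ∈ centeredSquare η, P w ∈ Metric.ball ζ δ := by
    have h1 : ∀ᶠ w in 𝓝 (0 : ℂ), P w ∈ Metric.ball ζ δ := by
      refine hPd.continuous.continuousAt.eventually ?_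
      simp only [hP, mul_zero, Complex.exp_zero, mul_one]
      exact Metric.ball_mem_nhds ζ hδ
    obtain ⟨ε, hε, hball⟩ := Metric.eventually_nhds_iff_ball.mp h1
    refine ⟨ε / 2, by positivity, fun w hw => hball w ?_⟩
    rw [mem_ball_zero_iff]
    have h2 := Complex.norm_le_abs_re_add_abs_im w
    have h3 := abs_lt.mpr hw.1
    have h4 := abs_lt.mpr hw.2
    linarith
  -- The value `0` on the axis keeps the bound valid there without assuming regularity.
  set f : ℂ → ℂ := fun w => if w.im = 0 then 0 else reflectedExtension F (P w) with hf
  have hP1 : ∀ w : ℂ, w.im ≠ 0 → ‖P w‖ ≠ 1 := by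
    intro w hw
    rw [hPn, Ne, Real.exp_eq_one_iff, neg_eq_zero]
    exact hw
  obtain ⟨g, hg, hgf⟩ := exists_differentiableOn_of_jump (f := f) (B := 1 / r) hη (by
    intro w hw hwi
    have h1 := (reflectedExtension_off_circle hF hz hr hr1 hlow (hQ w hw) (hP1 w hwi)).1
    refine (h1.comp w (hPd w)).congr_of_eventuallyEq ?_
    filter_upwards [(isOpen_ne_fun Complex.continuous_im continuous_const).mem_nhds hwi] with u hu
    simp only [hf]
    rw [if_neg hu]
    rfl) (by
    intro w hw
    simp only [hf]
    split_ifs with h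
    · simp [hr.le]
    · exact (reflectedExtension_off_circle hF hz hr hr1 hlow (hQ w hw) (hP1 w h)).2) (by
    have hae : ∀ᵐ x : ℝ, HasUnimodularRadialLimit F (Complex.exp ((x + θ : ℝ) * Complex.I)) :=
      (measurePreserving_add_right (volume : Measure ℝ) θ).quasiMeasurePreserving.ae hF.ae_radial
    filter_upwards [hae] with x hx _
    obtain ⟨u, hu, hlim⟩ := hx
    set ξ := Complex.exp ((x + θ : ℝ) * Complex.I) with hξ
    have hPe : ∀ y : ℝ, P (x + y * Complex.I) = (Real.exp (-y) : ℝ) * ξ := by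
      intro y
      simp only [hP, hξ]
      rw [← hθ, Complex.ofReal_exp, ← Complex.exp_add, ← Complex.exp_add]
      congr 1
      push_cast
      linear_combination y * Complex.I_mul_I
    have hexp : Tendsto (fun y : ℝ => Real.exp (-y)) (𝓝[>] 0) (𝓝[<] 1) := by
      refine tendsto_nhdsWithin_iff.mpr ⟨?_, ?_⟩
      · have : Continuous fun y : ℝ => Real.exp (-y) := by fun_prop
        have h2 := this.tendsto 0
        simp only [neg_zero, Real.exp_zero] at h2
        exact h2.mono_left nhdsWithin_le_nhds
      · filter_upwards [self_mem_nhdsWithin] with y hy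
        simpa using hy
    have hL := hlim.comp hexp
    have hu0 : conj u ≠ 0 := by
      intro h
      have : u = 0 := by simpa using h
      simp [this] at hu
    -- The reflected side tends to `1 / conj u`, which is `u` because `‖u‖ = 1`; this is where the
    -- inner property removes the jump.
    have hL2 := ((Complex.continuous_conj.tendsto u).comp hL).inv₀ hu0
    rw [inv_conj_of_norm_one hu] at hL2
    have hsub := hL.sub hL2
    rw [sub_self] at hsub
    refine hsub.congr' ?_
    filter_upwards [self_mem_nhdsWithin] with y hy
    have hy : 0 < y := hy
    have i1 : (x + y * Complex.I : ℂ).im = y := by simp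
    have i2 : (x + (-y : ℝ) * Complex.I : ℂ).im = -y := by simp
    simp only [hf, Function.comp_apply]
    rw [if_neg (by rw [i1]; exact hy.ne'), if_neg (by rw [i2]; linarith),
      reflectedExtension_of_lt (by rw [hPn, i1]; simpa using hy),
      reflectedExtension_of_gt (by rw [hPn, i2]; simpa using hy), hPe, hPe, schwarzReflection]
    congr 4
    have hξn : ‖ξ‖ = 1 := Complex.norm_exp_ofReal_mul_I _
    rw [map_mul, Complex.conj_ofReal, mul_inv, inv_conj_of_norm_one hξn, neg_neg, Real.exp_neg]
    push_cast
    rfl)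
  refine notMem_singularSet_of_isAnalyticExtensionAt (G := fun z => g (-Complex.I * Complex.log (z / ζ)))
    ⟨?_, ?_⟩
  · have h0 : (-Complex.I * Complex.log (ζ / ζ)) = 0 := by simp [div_self hζ0]
    have hga : AnalyticAt ℂ g (-Complex.I * Complex.log (ζ / ζ)) := by
      rw [h0]
      exact hg.analyticAt ((isOpen_centeredSquare η).mem_nhds ⟨by simpa using hη, by simpa using hη⟩)
    refine AnalyticAt.comp (g := g) (f := fun z => -Complex.I * Complex.log (z / ζ)) hga ?_
    refine analyticAt_const.mul (AnalyticAt.clog (by fun_prop (disch := assumption)) ?_)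
    rw [div_self hζ0]
    exact Complex.one_mem_slitPlane
  · have hc : ContinuousAt (fun z => -Complex.I * Complex.log (z / ζ)) ζ := by
      refine continuousAt_const.mul (ContinuousAt.clog (by fun_prop (disch := assumption)) ?_)
      rw [div_self hζ0]
      exact Complex.one_mem_slitPlane
    have hev : ∀ᶠ z in 𝓝 ζ, -Complex.I * Complex.log (z / ζ) ∈ centeredSquare η := by
      refine hc.eventually ((isOpen_centeredSquare η).mem_nhds ?_)
      simp only [div_self hζ0]
      exact ⟨by simpa using hη, by simpa using hη⟩
    filter_upwards [nhdsWithin_le_nhds hev, nhdsWithin_le_nhds (eventually_ne_nhds hζ0),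
      self_mem_nhdsWithin] with z h1 h2 h3
    have hz1 : ‖z‖ < 1 := by simpa using h3
    have him : (-Complex.I * Complex.log (z / ζ)).im ≠ 0 := by
      have : (-Complex.I * Complex.log (z / ζ)).im = -Real.log ‖z‖ := by
        simp [Complex.log_re, hz]
      rw [this]
      exact neg_ne_zero.mpr (Real.log_neg (norm_pos_iff.mpr h2) hz1).ne
    rw [hgf _ h1 him]
    simp only [hf]
    rw [if_neg him]
    have hPz : P (-Complex.I * Complex.log (z / ζ)) = z := by
      simp only [hP]
      rw [show Complex.I * (-Complex.I * Complex.log (z / ζ)) = Complex.log (z / ζ) by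
        rw [← mul_assoc, mul_neg, Complex.I_mul_I, neg_neg, one_mul],
        Complex.exp_log (div_ne_zero h2 hζ0)]
      field_simp
    rw [hPz, reflectedExtension_of_lt hz1]

end

/-! ### From a connected sublevel set to the boundary derivative bounds: (a) ⇒ (d). -/

noncomputable section

open scoped ComplexConjugate

theorem norm_one_sub_lt_norm_one_add {w : ℂ} (hw : 0 < w.re) : ‖1 - w‖ < ‖1 + w‖ := by
  refine lt_of_pow_lt_pow_left₀ 2 (norm_nonneg _) ?_
  simp only [← Complex.normSq_eq_norm_sq, Complex.normSq_apply]
  simp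
  nlinarith

theorem one_add_ne_zero_of_re_pos {w : ℂ} (hw : 0 < w.re) : 1 + w ≠ 0 := by
  intro h
  have := congrArg Complex.re h
  simp at this
  linarith

theorem add_ne_zero_of_norm_lt {ζ z : ℂ} (hζ : ‖ζ‖ = 1) (hz : ‖z‖ < 1) : ζ + z ≠ 0 := by
  intro h
  have : ζ = -z := eq_neg_of_add_eq_zero_left h
  rw [this, norm_neg] at hζ
  linarith

theorem re_div_pos {ζ z : ℂ} (hζ : ‖ζ‖ = 1) (hz : ‖z‖ < 1) : 0 < ((ζ - z) / (ζ + z)).re := by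
  have h0 := add_ne_zero_of_norm_lt hζ hz
  have h1 : (ζ - z) / (ζ + z) = (ζ - z) * conj (ζ + z) * ((‖ζ + z‖ ^ 2 : ℝ)⁻¹ : ℝ) := by
    rw [div_eq_mul_inv, Complex.inv_def, Complex.normSq_eq_norm_sq, mul_assoc]
  rw [h1, Complex.re_mul_ofReal]
  have h2 : ((ζ - z) * conj (ζ + z)).re = ‖ζ‖ ^ 2 - ‖z‖ ^ 2 := by
    simp only [← Complex.normSq_eq_norm_sq, Complex.normSq_apply]
    simp
    ring
  rw [h2, hζ]
  have h3 : 0 < ‖ζ + z‖ := norm_pos_iff.mpr h0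
  have h4 : 0 < 1 ^ 2 - ‖z‖ ^ 2 := by nlinarith [norm_nonneg z]
  positivity

section ConnectedSublevel

variable {F : ℂ → ℂ}

/-- If `F` is small on a connected set in the disk which contains a point close to `ζ` and a point
far from `ζ`, then it is bounded away from `1` in between on the radius through `ζ`. -/
theorem norm_le_of_isPreconnected_of_dist (hd : DifferentiableOn ℂ F (Metric.ball 0 1))
    (hm : MapsTo F (Metric.ball 0 1) (Metric.ball 0 1)) {l : ℝ} (hl : 0 < l) {Ω : Set ℂ}
    (ho : IsOpen Ω) (hc : IsPreconnected Ω) (hΩ : Ω ⊆ Metric.ball 0 1)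
    (hFΩ : ∀ z ∈ Ω, ‖F z‖ ≤ Real.exp (-l)) {ζ a b : ℂ} (hζ : ‖ζ‖ = 1) (ha : a ∈ Ω) (hb : b ∈ Ω)
    {s : ℝ} (hs : 0 < s) (has : s ≤ (1 - ‖a‖) / 1024) (hbs : 512 * ‖ζ - b‖ ≤ s) :
    ‖F ((1 - s) / (1 + s) * ζ)‖ ≤ Real.exp (-(l / 4)) := by
  have hζ0 : ζ ≠ 0 := by rintro rfl; simp at hζ
  have ha1 : ‖a‖ < 1 := by simpa using hΩ ha
  have hb1 : ‖b‖ < 1 := by simpa using hΩ hb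
  have hs0 : (s : ℂ) ≠ 0 := by exact_mod_cast hs.ne'
  -- A Cayley map of the right half plane onto the disk with `0 ↦ ζ`, scaled so that `1` goes to the
  -- point of the radius under study. The constant `1024` is `2 * 512`, as `‖ζ + a‖ ≤ 2`.
  set c : ℂ → ℂ := fun w => ζ * ((1 - s * w) / (1 + s * w)) with hcdef
  set m : ℂ → ℂ := fun z => (ζ - z) / (ζ + z) / s with hmdef
  have hsre : ∀ w : ℂ, 0 < w.re → 0 < ((s : ℂ) * w).re := fun w hw => by
    rw [Complex.re_ofReal_mul]; positivity
  have hcm : ∀ w : ℂ, 0 < w.re → c w ∈ Metric.ball (0 : ℂ) 1 := by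
    intro w hw
    have h1 := norm_one_sub_lt_norm_one_add (hsre w hw)
    rw [mem_ball_zero_iff, hcdef]
    simp only
    rw [norm_mul, hζ, one_mul, norm_div, div_lt_one ((norm_nonneg _).trans_lt h1)]
    exact h1
  have hmre : ∀ z : ℂ, ‖z‖ < 1 → 0 < (m z).re := by
    intro z hz
    simp only [hmdef]
    rw [Complex.div_ofReal_re]
    exact div_pos (re_div_pos hζ hz) hs
  have hcmz : ∀ z : ℂ, ‖z‖ < 1 → c (m z) = z := by
    intro z hz
    have h0 := add_ne_zero_of_norm_lt hζ hz
    simp only [hcdef, hmdef]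
    rw [mul_div_cancel₀ _ hs0]
    have h1 : 1 - (ζ - z) / (ζ + z) = 2 * z / (ζ + z) := by field_simp; ring
    have h2 : 1 + (ζ - z) / (ζ + z) = 2 * ζ / (ζ + z) := by field_simp; ring
    rw [h1, h2]
    field_simp
  have hmcw : ∀ w : ℂ, 0 < w.re → m (c w) = w := by
    intro w hw
    have h0 := one_add_ne_zero_of_re_pos (hsre w hw)
    simp only [hcdef, hmdef]
    have h1 : ζ - ζ * ((1 - s * w) / (1 + s * w)) = ζ * (2 * (s * w)) / (1 + s * w) := by
      field_simp; ring
    have h2 : ζ + ζ * ((1 - s * w) / (1 + s * w)) = 2 * ζ / (1 + s * w) := by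
      field_simp; ring
    rw [h1, h2]
    field_simp
  have hcd : DifferentiableOn ℂ c {w | 0 < w.re} := by
    intro w hw
    have h0 := one_add_ne_zero_of_re_pos (hsre w hw)
    refine DifferentiableAt.differentiableWithinAt ?_
    simp only [hcdef]
    fun_prop (disch := assumption)
  have hRH : IsOpen {w : ℂ | 0 < w.re} := isOpen_lt continuous_const Complex.continuous_re
  have himg : m '' Ω = {w : ℂ | 0 < w.re} ∩ c ⁻¹' Ω := by
    ext w
    constructor
    · rintro ⟨z, hz, rfl⟩
      have hz1 : ‖z‖ < 1 := by simpa using hΩ hz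
      exact ⟨hmre z hz1, by rw [mem_preimage, hcmz z hz1]; exact hz⟩
    · rintro ⟨hw, hwΩ⟩
      exact ⟨c w, hwΩ, hmcw w hw⟩
  have key := norm_one_le_of_isPreconnected (f := fun w => F (c w)) (hd.comp hcd hcm)
    (fun w hw => by
      have := hm (hcm w hw)
      rw [mem_ball_zero_iff] at this
      exact this.le) hl (Ω := m '' Ω) (by
      rw [himg]
      exact hcd.continuousOn.isOpen_inter_preimage hRH ho) (by
      refine hc.image _ fun z hz => ContinuousAt.continuousWithinAt ?_
      have h0 := add_ne_zero_of_norm_lt hζ (by simpa using hΩ hz : ‖z‖ < 1)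
      simp only [hmdef]
      fun_prop (disch := assumption)) (by rw [himg]; exact inter_subset_left) (by
      rintro _ ⟨z, hz, rfl⟩
      rw [hcmz z (by simpa using hΩ hz)]
      exact hFΩ z hz) (mem_image_of_mem m ha) (mem_image_of_mem m hb) (by
      simp only [hmdef]
      rw [norm_div, norm_div, Complex.norm_real, Real.norm_of_nonneg hs.le, le_div_iff₀ hs]
      have h1 : ‖ζ + a‖ ≤ 2 := (norm_add_le _ _).trans (by rw [hζ]; linarith)
      have h2 : 1 - ‖a‖ ≤ ‖ζ - a‖ := by
        have := norm_sub_norm_le ζ a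
        rwa [hζ] at this
      have h0 : 0 < ‖ζ + a‖ := norm_pos_iff.mpr (add_ne_zero_of_norm_lt hζ ha1)
      rw [le_div_iff₀ h0]
      nlinarith) (by
      simp only [hmdef]
      rw [norm_div, norm_div, Complex.norm_real, Real.norm_of_nonneg hs.le, div_le_iff₀ hs]
      have h0 : 0 < ‖ζ + b‖ := norm_pos_iff.mpr (add_ne_zero_of_norm_lt hζ hb1)
      rw [div_le_iff₀ h0]
      have h1 : 1 ≤ ‖ζ + b‖ := by
        have h2 := norm_sub_norm_le (2 * ζ) (ζ - b)
        rw [show 2 * ζ - (ζ - b) = ζ + b by ring, norm_mul, hζ] at h2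
        simp at h2
        linarith [norm_nonneg a]
      nlinarith)
  simp only [hcdef, mul_one] at key
  rwa [mul_comm ζ] at key

theorem norm_cayley {ζ : ℂ} (hζ : ‖ζ‖ = 1) {s : ℝ} (hs : 0 < s) (hs1 : s ≤ 1) :
    ‖((1 - s) / (1 + s) * ζ : ℂ)‖ = (1 - s) / (1 + s) := by
  rw [norm_mul, hζ, mul_one, show ((1 - s) / (1 + s) : ℂ) = (((1 - s) / (1 + s) : ℝ) : ℂ) by
    push_cast; ring, Complex.norm_real, Real.norm_of_nonneg]
  exact div_nonneg (by linarith) (by linarith)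

/-- The closure of the sublevel set `Ω` meets the circle exactly in `Σ`, which is also the set
without unimodular radial limit. At regular points `d = dist(ζ, Ω)` is, up to a constant, bounded
below by `1 / ‖F'(ζ)‖`, and the extension is bounded on the disk of radius `d`; both derivative
conditions follow. -/
theorem HasConnectedSublevel.boundary_properties (hF : IsInnerFunction F)
    (h : HasConnectedSublevel F) :
    HasBoundaryDerivativeBounds F ∧
      singularSet F = {ζ : ℂ | ζ ∈ Metric.sphere (0 : ℂ) 1 ∧ ¬ HasUnimodularRadialLimit F ζ} := by
  obtain ⟨r, hr, hr1, hconn⟩ := h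
  set Ω : Set ℂ := {z : ℂ | z ∈ Metric.ball (0 : ℂ) 1 ∧ ‖F z‖ < r} with hΩdef
  have hΩ : Ω ⊆ Metric.ball 0 1 := fun z hz => hz.1
  have ho : IsOpen Ω := hF.holomorphic.continuousOn.norm.isOpen_inter_preimage
    Metric.isOpen_ball isOpen_Iio
  obtain ⟨a, ha⟩ := hconn.nonempty
  have ha1 : ‖a‖ < 1 := by simpa using ha.1
  set l := Real.log (1 / r) with hldef
  have hl : 0 < l := Real.log_pos (by rw [lt_div_iff₀ hr]; linarith)
  have hexp : Real.exp (-l) = r := by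
    rw [hldef, one_div, Real.log_inv, neg_neg, Real.exp_log hr]
  set ρ := Real.exp (-(l / 4)) with hρ
  have hρ1 : ρ < 1 := by
    rw [hρ, ← Real.exp_zero]
    exact Real.exp_lt_exp.mpr (by linarith)
  set A := (1 - ‖a‖) / 1024 with hA
  have hA0 : 0 < A := by rw [hA]; linarith
  have hA1 : A ≤ 1 / 1024 := by rw [hA]; linarith [norm_nonneg a]
  have hest : ∀ ζ : ℂ, ‖ζ‖ = 1 → ∀ b ∈ Ω, ∀ s : ℝ, 0 < s → s ≤ A → 512 * ‖ζ - b‖ ≤ s →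
      ‖F ((1 - s) / (1 + s) * ζ)‖ ≤ ρ := fun ζ hζ b hb s hs hsA hsb =>
    norm_le_of_isPreconnected_of_dist hF.holomorphic hF.mapsTo hl ho hconn.isPreconnected hΩ
      (fun z hz => by rw [hexp]; exact hz.2.le) hζ ha hb hs hsA hsb
  have hlow : ∀ z : ℂ, ‖z‖ < 1 → z ∉ Ω → r ≤ ‖F z‖ := fun z hz hzΩ =>
    not_lt.mp fun h => hzΩ ⟨by simpa using hz, h⟩
  have hsing : ∀ ζ ∈ singularSet F, ζ ∈ closure Ω := by
    intro ζ hζ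
    by_contra hcl
    rw [Metric.mem_closure_iff] at hcl
    push Not at hcl
    obtain ⟨δ, hδ, hδ2⟩ := hcl
    refine notMem_singularSet_of_le hF hζ.1 hδ hr hr1.le (fun z hz hz1 => hlow z hz1 fun hzΩ => ?_) hζ
    have := hδ2 z hzΩ
    rw [Metric.mem_ball, dist_comm] at hz
    linarith
  -- Here `b ∈ Ω` can be taken arbitrarily close to `ζ`, so the estimate holds at all small scales
  -- `s` and forces `‖F‖ ≤ ρ < 1` up to the end of the radius.
  have hnolim : ∀ ζ : ℂ, ‖ζ‖ = 1 → ζ ∈ closure Ω → ¬ HasUnimodularRadialLimit F ζ := by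
    rintro ζ hζ hcl ⟨u, hu, hlim⟩
    have ht : Tendsto (fun s : ℝ => (1 - s) / (1 + s)) (𝓝[>] 0) (𝓝[<] 1) := by
      refine tendsto_nhdsWithin_iff.mpr ⟨?_, ?_⟩
      · have : ContinuousAt (fun s : ℝ => (1 - s) / (1 + s)) 0 := by
          refine ContinuousAt.div (by fun_prop) (by fun_prop) (by norm_num)
        have h2 := this.tendsto
        simp only [sub_zero, add_zero, div_one] at h2
        exact h2.mono_left nhdsWithin_le_nhds
      · filter_upwards [self_mem_nhdsWithin] with s hs
        have hs : 0 < s := hs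
        rw [mem_Iio, div_lt_one (by linarith)]
        linarith
    have h1 := (hlim.comp ht).norm
    rw [hu] at h1
    have h2 : (1 : ℝ) ≤ ρ := le_of_tendsto h1 (by
      filter_upwards [Ioo_mem_nhdsGT hA0] with s hs
      obtain ⟨b, hb, hbd⟩ := Metric.mem_closure_iff.mp hcl (s / 512) (by linarith [hs.1])
      have := hest ζ hζ b hb s hs.1 hs.2.le (by rw [← dist_eq_norm]; linarith)
      simpa using this)
    linarith
  have hreg : ∀ ζ ∈ Metric.sphere (0 : ℂ) 1 \ singularSet F, HasUnimodularRadialLimit F ζ :=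
    fun ζ hζ => ⟨_, (boundaryExtension_spec hζ).norm_eq_one hF hζ.1,
      (boundaryExtension_spec hζ).tendsto_radial hζ.1⟩
  have hfinal : singularSet F =
      {ζ : ℂ | ζ ∈ Metric.sphere (0 : ℂ) 1 ∧ ¬ HasUnimodularRadialLimit F ζ} := by
    ext ζ
    constructor
    · exact fun hζ => ⟨hζ.1, hnolim ζ (by simpa using hζ.1) (hsing ζ hζ)⟩
    · rintro ⟨hζ, hn⟩
      by_contra hS
      exact hn (hreg ζ ⟨hζ, hS⟩)
  refine ⟨⟨?_, ?_⟩, hfinal⟩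
  · have h1 := (ae_restrict_iff' measurableSet_Ico).mp hF.radial
    rw [ae_iff] at h1
    refine measure_mono_null ?_ h1
    rintro θ ⟨hθ, hS⟩
    rw [hfinal] at hS
    exact fun hcon => hS.2 (hcon hθ)
  set d : ℂ → ℝ := fun ζ => Metric.infDist ζ Ω with hd
  have hne : Ω.Nonempty := hconn.nonempty
  have hdpos : ∀ ζ ∈ Metric.sphere (0 : ℂ) 1 \ singularSet F, 0 < d ζ := by
    intro ζ hζ
    refine (Metric.infDist_nonneg).lt_of_ne fun h0 => ?_
    have := (Metric.mem_closure_iff_infDist_zero hne).mpr h0.symm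
    exact hnolim ζ (by simpa using hζ.1) this (hreg ζ hζ)
  -- Near `Ω`, Julia's inequality is used at the radial point of scale `s = 1024 d`, where `‖F‖ ≤
  -- ρ`; a point of `Ω` at distance less than `2 d` meets `512 * ‖ζ - b‖ ≤ s`. When `d` exceeds `A /
  -- 1024`, Julia's inequality at `0` suffices.
  obtain ⟨c, hc, hcd⟩ : ∃ c > 0, ∀ ζ ∈ Metric.sphere (0 : ℂ) 1 \ singularSet F,
      c ≤ ‖deriv (reflectedExtension F) ζ‖ * d ζ := by
    have hF0 := norm_lt_one hF (z := 0) (by simp)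
    refine ⟨min ((1 - ρ) / 2048) ((1 - ‖F 0‖) * A / 2048), ?_, fun ζ hζ => ?_⟩
    · refine lt_min (by linarith) ?_
      have : 0 < 1 - ‖F 0‖ := by linarith
      positivity
    have hζ1 : ‖ζ‖ = 1 := by simpa using hζ.1
    set L := ‖deriv (reflectedExtension F) ζ‖ with hL
    have hd0 := hdpos ζ hζ
    rcases le_or_gt (1024 * d ζ) A with hcase | hcase
    · refine (min_le_left _ _).trans ?_
      obtain ⟨b, hb, hbd⟩ := (Metric.infDist_lt_iff hne).mp (show d ζ < 2 * d ζ by linarith)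
      set s := 1024 * d ζ with hs
      have hs0 : 0 < s := by positivity
      have h1 := hest ζ hζ1 b hb s hs0 hcase (by rw [← dist_eq_norm]; linarith)
      have hnz := norm_cayley hζ1 hs0 (by linarith)
      have h2 := julia hF hζ (a := (1 - s) / (1 + s) * ζ) (by
        rw [hnz, div_lt_one (by linarith)]; linarith)
      have h3 : ‖ζ - (1 - s) / (1 + s) * ζ‖ = 2 * s / (1 + s) := by
        have : (1 + s : ℂ) ≠ 0 := by
          have : (1 + s : ℝ) ≠ 0 := by positivity
          exact_mod_cast this
        rw [show ζ - (1 - s) / (1 + s) * ζ = ((2 * s / (1 + s) : ℝ) : ℂ) * ζ by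
          push_cast; field_simp; ring, norm_mul, hζ1, mul_one, Complex.norm_real,
          Real.norm_of_nonneg (by positivity)]
      rw [hnz, h3] at h2
      have h4 : 1 - ((1 - s) / (1 + s)) ^ 2 = 4 * s / (1 + s) ^ 2 := by field_simp; ring
      rw [h4] at h2
      have h5 : 4 * s / (1 + s) ^ 2 * (1 - ρ) ≤ 2 * L * (2 * s / (1 + s)) ^ 2 := by
        refine le_trans ?_ h2
        gcongr
      have h6 : 4 * s / (1 + s) ^ 2 * (1 - ρ) ≤ 4 * s / (1 + s) ^ 2 * (2 * L * s) := by
        refine h5.trans_eq ?_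
        field_simp
        ring
      have h7 := le_of_mul_le_mul_left h6 (by positivity)
      rw [hs] at h7
      linarith
    · refine (min_le_right _ _).trans ?_
      have h1 := julia hF hζ (a := 0) (by simp)
      simp only [norm_zero, sub_zero, hζ1] at h1
      have h2 : (1 - ‖F 0‖) ≤ 2 * L := by simpa using h1
      have h3 : 0 < 1 - ‖F 0‖ := by linarith
      nlinarith
  constructor
  · rw [tendsto_atTop]
    intro M
    have hopen : IsOpen {ζ : ℂ | d ζ < c / (|M| + 1)} :=
      isOpen_lt (Metric.continuous_infDist_pt Ω) continuous_const
    have hsub : singularSet F ⊆ {ζ : ℂ | d ζ < c / (|M| + 1)} := by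
      intro ζ hζ
      have : d ζ = 0 := (Metric.mem_closure_iff_infDist_zero hne).mp (hsing ζ hζ)
      simp only [mem_ofPred_eq, this]
      positivity
    filter_upwards [mem_inf_of_left (hopen.mem_nhdsSet.mpr hsub),
      mem_inf_of_right (mem_principal_self _)] with ζ h1 h2
    rw [deriv_boundaryExtension hF h2]
    have h3 := hcd ζ h2
    have h4 := hdpos ζ h2
    have h5 : d ζ < c / (|M| + 1) := h1
    rw [lt_div_iff₀ (by positivity)] at h5
    by_contra hlt
    push Not at hlt
    have := le_abs_self M
    nlinarith
  -- Cauchy's estimate on the circle of radius `d / 2`, with the bound `1 / r`, gives `‖F''‖ ≤ 8 /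
  -- (r d ^ 2)`; then `c ≤ ‖F'‖ d`.
  · refine ⟨8 / (r * c ^ 2), by positivity, fun ζ hζ => ?_⟩
    have hζ1 : ‖ζ‖ = 1 := by simpa using hζ.1
    rw [deriv_boundaryExtension hF hζ, iteratedDeriv_boundaryExtension hF hζ]
    have hd0 := hdpos ζ hζ
    have hdisj : ∀ z ∈ Metric.ball ζ (d ζ), z ∉ closure Ω := by
      intro z hz hcl
      have h1 : d ζ ≤ dist ζ z := by
        simp only [hd]
        rw [← Metric.infDist_closure]
        exact Metric.infDist_le_dist_of_mem hcl
      rw [Metric.mem_ball, dist_comm] at hz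
      linarith
    have hball := fun z (hz : z ∈ Metric.ball ζ (d ζ)) => reflectedExtension_on_ball hF hζ1 hr hr1.le
      (fun z hz hS => hdisj z hz (hsing z hS))
      (fun z hz hz1 => hlow z hz1 fun hzΩ => hdisj z hz (subset_closure hzΩ)) hz
    have hcb : Metric.closedBall ζ (d ζ / 2) ⊆ Metric.ball ζ (d ζ) :=
      Metric.closedBall_subset_ball (by linarith)
    have hcauchy := Complex.norm_iteratedDeriv_le_of_forall_mem_sphere_norm_le
      (f := reflectedExtension F) 2 (half_pos hd0) (C := 1 / r)
      (DifferentiableOn.diffContOnCl (by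
        rw [closure_ball _ (by positivity)]
        exact fun z hz => (hball z (hcb hz)).1.differentiableWithinAt))
      (fun z hz => (hball z (hcb (Metric.sphere_subset_closedBall hz))).2)
    have h3 := hcd ζ hζ
    set L := ‖deriv (reflectedExtension F) ζ‖ with hL
    have hL0 : 0 < L := by
      by_contra hneg
      have : L ≤ 0 := not_lt.mp hneg
      nlinarith
    rw [norm_div, norm_pow, ← hL, div_le_div_iff₀ (by positivity) (by positivity)]
    have h4 : ‖iteratedDeriv 2 (reflectedExtension F) ζ‖ * (r * d ζ ^ 2) ≤ 8 := by
      have h5 : ((2 : ℕ).factorial : ℝ) * (1 / r) / (d ζ / 2) ^ 2 = 8 / (r * d ζ ^ 2) := by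
        simp [Nat.factorial]
        field_simp
        norm_num
      rw [h5, le_div_iff₀ (by positivity)] at hcauchy
      exact hcauchy
    have h6 : c ^ 2 ≤ (L * d ζ) ^ 2 := pow_le_pow_left₀ hc.le h3 2
    calc _ ≤ ‖iteratedDeriv 2 (reflectedExtension F) ζ‖ * (r * (L * d ζ) ^ 2) := by gcongr
      _ = ‖iteratedDeriv 2 (reflectedExtension F) ζ‖ * (r * d ζ ^ 2) * L ^ 2 := by ring
      _ ≤ _ := by gcongr

end ConnectedSublevel

end

/-! ### Evenly covered points: sheets and locality. -/

noncomputable section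

section Covering

variable {X Y : Type*} [TopologicalSpace X] [TopologicalSpace Y]

/-- A point of an open set whose preimage is a disjoint union of open sets mapped bijectively by a
local homeomorphism is evenly covered. -/
theorem isEvenlyCovered_of_sheets {f : X → Y} {U : Set Y} (hU : IsOpen U) {I : Type*} {V : I → Set X}
    (hV : ∀ i, IsOpen (V i)) (hcov : ∀ x, f x ∈ U → ∃ i, x ∈ V i)
    (hdisj : ∀ i j x, x ∈ V i → x ∈ V j → i = j) (hbij : ∀ i, BijOn f (V i) U)
    (hf : ∀ x, f x ∈ U → map f (𝓝 x) = 𝓝 (f x)) {y : Y} (hy : y ∈ U) :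
    IsEvenlyCovered f y (f ⁻¹' {y}) := by
  let : TopologicalSpace I := ⊥
  have : DiscreteTopology I := ⟨rfl⟩
  have hfU : IsOpen (f ⁻¹' U) := by
    rw [isOpen_iff_mem_nhds]
    intro x hx
    rw [← mem_map, hf x hx]
    exact hU.mem_nhds hx
  choose idx hidx using fun x : f ⁻¹' U => hcov x x.2
  have hidx' : ∀ (x : f ⁻¹' U) (i : I), (x : X) ∈ V i → idx x = i := fun x i hx =>
    hdisj _ _ x (hidx x) hx
  have hfc : Continuous fun x : f ⁻¹' U => (⟨f x, x.2⟩ : U) := by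
    refine Continuous.subtype_mk (continuous_iff_continuousAt.mpr fun x => ?_) _
    exact ContinuousAt.comp (g := f) (hf x x.2).le continuous_subtype_val.continuousAt
  have hic : Continuous idx := by
    refine continuous_discrete_rng.mpr fun i => ?_
    have : idx ⁻¹' {i} = Subtype.val ⁻¹' V i := by
      ext x
      exact ⟨fun h => by rw [mem_preimage, ← (h : idx x = i)]; exact hidx x, fun h => hidx' x i h⟩
    rw [this]
    exact (hV i).preimage continuous_subtype_val
  have hb : Function.Bijective fun x : f ⁻¹' U => ((⟨f x, x.2⟩ : U), idx x) := by
    constructor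
    · intro x x' h
      simp only [Prod.mk.injEq, Subtype.mk.injEq] at h
      exact Subtype.ext ((hbij (idx x)).injOn (hidx x) (h.2 ▸ hidx x') h.1)
    · rintro ⟨u, i⟩
      obtain ⟨x, hx, hxu⟩ := (hbij i).surjOn u.2
      have hxU : x ∈ f ⁻¹' U := by rw [mem_preimage, hxu]; exact u.2
      exact ⟨⟨x, hxU⟩, Prod.ext (Subtype.ext hxu) (hidx' ⟨x, hxU⟩ i hx)⟩
  have ho : IsOpenMap fun x : f ⁻¹' U => ((⟨f x, x.2⟩ : U), idx x) := by
    intro O hO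
    rw [isOpen_iff_mem_nhds]
    rintro _ ⟨x, hx, rfl⟩
    have h1 : IsOpen ((Subtype.val '' O) ∩ V (idx x)) :=
      (hfU.isOpenMap_subtype_val O hO).inter (hV _)
    have h2 : f '' ((Subtype.val '' O) ∩ V (idx x)) ∈ 𝓝 (f x) := by
      rw [← hf x x.2]
      exact image_mem_map (h1.mem_nhds ⟨⟨x, hx, rfl⟩, hidx x⟩)
    have h3 : (Subtype.val ⁻¹' (f '' ((Subtype.val '' O) ∩ V (idx x))) : Set U) ×ˢ
        ({idx x} : Set I) ∈ 𝓝 ((⟨f x, x.2⟩ : U), idx x) :=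
      prod_mem_nhds (continuous_subtype_val.continuousAt.preimage_mem_nhds h2)
        ((isOpen_discrete _).mem_nhds rfl)
    refine mem_of_superset h3 ?_
    rintro ⟨u, i⟩ ⟨⟨_, ⟨⟨x', hx', rfl⟩, hxV⟩, hxu⟩, hi⟩
    exact ⟨x', hx', Prod.ext (Subtype.ext hxu) ((hidx' x' _ hxV).trans hi.symm)⟩
  have hev : IsEvenlyCovered f y I := ⟨inferInstance, U, hy, hU, hfU,
    (Equiv.ofBijective _ hb).toHomeomorphOfContinuousOpen (hfc.prodMk hic) ho, fun _ => rfl⟩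
  exact hev.to_isEvenlyCovered_preimage

/-- Being evenly covered is local: it can be tested on open subspaces of the source and the target
through which the map factors over a neighbourhood of the point. -/
theorem isEvenlyCovered_iff_of_isOpenEmbedding {X' Y' : Type*} [TopologicalSpace X']
    [TopologicalSpace Y'] {f : X → Y} {f' : X' → Y'} {i : X' → X} {j : Y' → Y}
    (hi : IsOpenEmbedding i) (hj : IsOpenEmbedding j) (hc : ∀ x, f (i x) = j (f' x)) {W : Set Y'}
    (hW : IsOpen W) (hf' : IsOpen (f' ⁻¹' W)) (hrange : f ⁻¹' (j '' W) ⊆ range i) {y : Y'}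
    (hy : y ∈ W) {J : Type*} [TopologicalSpace J] :
    IsEvenlyCovered f (j y) J ↔ IsEvenlyCovered f' y J := by
  have himg : i '' (f' ⁻¹' W) = f ⁻¹' (j '' W) := by
    ext x
    constructor
    · rintro ⟨x', hx', rfl⟩
      exact ⟨f' x', hx', (hc x').symm⟩
    · intro hx
      obtain ⟨x', rfl⟩ := hrange hx
      obtain ⟨w, hw, hwx⟩ := hx
      rw [hc] at hwx
      exact ⟨x', by rw [mem_preimage, ← hj.injective hwx]; exact hw, rfl⟩
  have hfo : IsOpen (f ⁻¹' (j '' W)) := himg ▸ hi.isOpenMap _ hf'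
  let e : f' ⁻¹' W ≃ₜ f ⁻¹' (j '' W) := (hi.isEmbedding.homeomorphImage _).trans (.setCongr himg)
  let e' : W ≃ₜ j '' W := hj.isEmbedding.homeomorphImage W
  have hcomp : (j '' W).restrictPreimage f ∘ e = e' ∘ W.restrictPreimage f' := by
    ext x
    exact hc x
  have h1 : IsEvenlyCovered f (j y) J ↔
      IsEvenlyCovered ((j '' W).restrictPreimage f) ⟨j y, mem_image_of_mem j hy⟩ J :=
    ⟨fun h => h.restrictPreimage _ _, fun h =>
      (h.subtypeVal_comp _ (hj.isOpenMap _ hW)).comp_subtypeVal _ (hj.isOpenMap _ hW) hfo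
        (mem_image_of_mem j hy)⟩
  have h2 : IsEvenlyCovered f' y J ↔ IsEvenlyCovered (W.restrictPreimage f') ⟨y, hy⟩ J :=
    ⟨fun h => h.restrictPreimage _ _, fun h =>
      (h.subtypeVal_comp _ hW).comp_subtypeVal _ hW hf' hy⟩
  rw [h1, h2, ← IsEvenlyCovered.comp_homeomorph_iff e, hcomp,
    ← IsEvenlyCovered.homeomorph_comp_iff e' (f := W.restrictPreimage f')]
  rfl

end Covering

/-! ### Restricting the sphere map to the disk: (c) ⇒ (b). -/

section Restriction

variable {F : ℂ → ℂ}

theorem singularSet_disjoint_ball {z : ℂ} (hz : ‖z‖ < 1) : z ∉ singularSet F := fun h => by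
  have : ‖z‖ = 1 := by simpa using h.1
  linarith

theorem sphereExtension_coe_of_lt {z : ℂ} (hz : ‖z‖ < 1) :
    sphereExtension F (z : OnePoint ℂ) = (F z : OnePoint ℂ) := by
  change (if ‖z‖ < 1 then _ else _) = _
  rw [if_pos hz]

theorem sphereExtension_coe_of_eq {z : ℂ} (hz : ‖z‖ = 1) :
    sphereExtension F (z : OnePoint ℂ) = (boundaryExtension F z z : OnePoint ℂ) := by
  change (if ‖z‖ < 1 then _ else if ‖z‖ = 1 then _ else _) = _
  rw [if_neg (by linarith), if_pos hz]

theorem sphereExtension_coe_of_gt {z : ℂ} (hz : 1 < ‖z‖) :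
    sphereExtension F (z : OnePoint ℂ) = circleReflection (F ((starRingEnd ℂ) z)⁻¹) := by
  change (if ‖z‖ < 1 then _ else if ‖z‖ = 1 then _ else _) = _
  rw [if_neg (by linarith), if_neg (by linarith)]

theorem circleReflection_of_ne {w : ℂ} (hw : w ≠ 0) :
    circleReflection w = (((starRingEnd ℂ) w)⁻¹ : ℂ) := if_neg hw

theorem circleReflection_eq_coe {u w : ℂ} (h : circleReflection w = (u : OnePoint ℂ)) :
    w ≠ 0 ∧ u = ((starRingEnd ℂ) w)⁻¹ := by
  by_cases hw : w = 0
  · rw [hw, circleReflection, if_pos rfl] at h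
    exact absurd h.symm (OnePoint.coe_ne_infty u)
  · rw [circleReflection_of_ne hw] at h
    exact ⟨hw, (OnePoint.coe_injective h).symm⟩

theorem norm_lt_one_of_sphereExtension (hF : IsInnerFunction F) {p : OnePoint ℂ}
    (hp : p ∉ ((↑) : ℂ → OnePoint ℂ) '' singularSet F) {w : ℂ} (hw : ‖w‖ < 1)
    (h : sphereExtension F p = (w : OnePoint ℂ)) : ∃ z : ℂ, ‖z‖ < 1 ∧ (z : OnePoint ℂ) = p := by
  have hrefl : ∀ u : ℂ, ‖u‖ < 1 → circleReflection u ≠ (w : OnePoint ℂ) := by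
    intro u hu hcu
    obtain ⟨hu0, rfl⟩ := circleReflection_eq_coe hcu
    rw [norm_inv_conj] at hw
    have : 1 < ‖u‖⁻¹ := (one_lt_inv₀ (norm_pos_iff.mpr hu0)).mpr hu
    linarith
  induction p using OnePoint.rec with
  | infty => exact absurd h (hrefl _ (norm_lt_one hF (by simp)))
  | coe z =>
    rcases lt_trichotomy ‖z‖ 1 with hlt | heq | hgt
    · exact ⟨z, hlt, rfl⟩
    · rw [sphereExtension_coe_of_eq heq] at h
      have hz : z ∈ Metric.sphere (0 : ℂ) 1 \ singularSet F :=
        ⟨by simpa using heq, fun hS => hp (mem_image_of_mem _ hS)⟩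
      have := (boundaryExtension_spec hz).norm_eq_one hF hz.1
      rw [OnePoint.coe_injective h] at this
      linarith
    · rw [sphereExtension_coe_of_gt hgt] at h
      refine absurd h (hrefl _ (norm_lt_one hF ?_))
      rw [norm_inv_conj]
      exact inv_lt_one_of_one_lt₀ hgt

theorem isOpen_compl_image_singularSet :
    IsOpen {p : OnePoint ℂ | p ∉ ((↑) : ℂ → OnePoint ℂ) '' singularSet F} := by
  have : IsCompact (singularSet F) :=
    (isCompact_sphere (0 : ℂ) 1).of_isClosed_subset (isClosed_singularSet F)
      (singularSet_subset_sphere F)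
  exact (this.image OnePoint.continuous_coe).isClosed.isOpen_compl

/-- Regular circle points go to the circle and exterior points to the exterior or `∞`, so the
preimage of the open disk is the open disk. Even covering, being local on the target, then passes to
the restriction. -/
theorem IsCoveringOverSymmetricAnnulus.isCoveringOverAnnulus (hF : IsInnerFunction F)
    (h : IsCoveringOverSymmetricAnnulus F) : IsCoveringOverAnnulus F := by
  obtain ⟨ρ, hρ, hρ1, hcov⟩ := h
  refine ⟨ρ, hρ, hρ1, fun w hw => ?_⟩
  have hρ' : 1 < 1 / ρ := by rw [lt_div_iff₀ hρ]; linarith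
  have h1 := hcov (w : OnePoint ℂ) ⟨w, ⟨hw.1, hw.2.trans hρ'⟩, rfl⟩
  have hnot : ∀ z : Metric.ball (0 : ℂ) 1,
      ((z : ℂ) : OnePoint ℂ) ∉ ((↑) : ℂ → OnePoint ℂ) '' singularSet F := by
    rintro z ⟨u, hu, huz⟩
    rw [OnePoint.coe_injective huz] at hu
    exact singularSet_disjoint_ball (mem_ball_zero_iff.mp z.2) hu
  have hi : IsOpenEmbedding fun z : Metric.ball (0 : ℂ) 1 =>
      (⟨((z : ℂ) : OnePoint ℂ), hnot z⟩ :
        {p : OnePoint ℂ // p ∉ ((↑) : ℂ → OnePoint ℂ) '' singularSet F}) := by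
    refine IsOpenEmbedding.of_comp _ isOpen_compl_image_singularSet.isOpenEmbedding_subtypeVal ?_
    exact OnePoint.isOpenEmbedding_coe.comp Metric.isOpen_ball.isOpenEmbedding_subtypeVal
  have hpre : (fun z : Metric.ball (0 : ℂ) 1 => F z) ⁻¹' Metric.ball 0 1 = univ :=
    eq_univ_of_forall fun z => hF.mapsTo z.2
  refine IsEvenlyCovered.to_isEvenlyCovered_preimage ((isEvenlyCovered_iff_of_isOpenEmbedding hi
    OnePoint.isOpenEmbedding_coe (fun z => sphereExtension_coe_of_lt (mem_ball_zero_iff.mp z.2))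
    (Metric.isOpen_ball (x := (0 : ℂ)) (ε := 1)) (by rw [hpre]; exact isOpen_univ) ?_
    (by simpa using hw.2)).mp h1)
  rintro ⟨p, hp⟩ ⟨u, hu, hup⟩
  obtain ⟨z, hz, rfl⟩ := norm_lt_one_of_sphereExtension hF hp (by simpa using hu) hup.symm
  exact ⟨⟨z, by simpa using hz⟩, rfl⟩

end Restriction

end

/-! ### The boundary gauge and its Lipschitz bound. -/

noncomputable section

/-- A curve whose speed is at most `C` away from its zeros has norm growing at most at rate `C`. -/
theorem norm_le_add_of_norm_deriv_le_off_zeros {k k' : ℝ → ℂ} (hk : Continuous k) {C : ℝ}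
    (hC : 0 ≤ C) (hd : ∀ x, k x ≠ 0 → HasDerivAt k (k' x) x) (hb : ∀ x, k x ≠ 0 → ‖k' x‖ ≤ C)
    {x y : ℝ} (hxy : x ≤ y) : ‖k y‖ ≤ ‖k x‖ + C * (y - x) := by
  have hseg : ∀ t ≤ y, (∀ s ∈ Icc t y, k s ≠ 0) → ‖k y‖ ≤ ‖k t‖ + C * (y - t) := by
    intro t ht hs
    have := (convex_Icc t y).norm_image_sub_le_of_norm_hasDerivWithin_le (f := k) (f' := k')
      (fun s hs' => (hd s (hs s hs')).hasDerivWithinAt) (fun s hs' => hb s (hs s hs'))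
      (left_mem_Icc.mpr ht) (right_mem_Icc.mpr ht)
    rw [Real.norm_of_nonneg (by linarith)] at this
    have h2 := norm_sub_norm_le (k y) (k t)
    linarith
  by_cases hz : ∀ s ∈ Icc x y, k s ≠ 0
  · exact hseg x hxy hz
  push Not at hz
  -- Only the part of the curve after its last zero in the interval matters, and there the
  -- derivative bound applies.
  set Z : Set ℝ := Icc x y ∩ k ⁻¹' {0} with hZ
  have hZc : IsCompact Z := isCompact_Icc.inter_right (isClosed_singleton.preimage hk)
  have hZn : Z.Nonempty := by
    obtain ⟨s, hs, hs0⟩ := hz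
    exact ⟨s, hs, hs0⟩
  obtain ⟨hm1, hm2⟩ := hZc.sSup_mem hZn
  set m := sSup Z with hm
  have hm0 : k m = 0 := hm2
  have hub : ∀ s ∈ Z, s ≤ m := fun s hs => le_csSup hZc.bddAbove hs
  suffices h : ‖k y‖ ≤ ‖k m‖ + C * (y - m) by
    rw [hm0, norm_zero] at h
    have := norm_nonneg (k x)
    nlinarith [hm1.1]
  rcases hm1.2.eq_or_lt with he | hlt
  · rw [he]; simp
  have hcont : ContinuousWithinAt (fun t => ‖k t‖ + C * (y - t)) (Ioi m) m :=
    (hk.norm.add (by fun_prop)).continuousWithinAt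
  refine ge_of_tendsto hcont ?_
  filter_upwards [Ioo_mem_nhdsGT hlt] with t ht
  refine hseg t ht.2.le fun s hs hs0 => ?_
  have := hub s ⟨⟨by linarith [hm1.1, ht.1, hs.1], hs.2⟩, hs0⟩
  linarith [ht.1, hs.1]

theorem abs_norm_sub_norm_le_off_zeros {k k' : ℝ → ℂ} (hk : Continuous k) {C : ℝ}
    (hC : 0 ≤ C) (hd : ∀ x, k x ≠ 0 → HasDerivAt k (k' x) x) (hb : ∀ x, k x ≠ 0 → ‖k' x‖ ≤ C)
    (x y : ℝ) : |‖k x‖ - ‖k y‖| ≤ C * |x - y| := by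
  have hd2 : ∀ x, k (-x) ≠ 0 → HasDerivAt (fun s => k (-s)) (-k' (-x)) x := fun x hx => by
    have := (hd (-x) hx).scomp x (hasDerivAt_neg x)
    rw [neg_one_smul] at this
    exact this
  have key : ∀ x y : ℝ, x ≤ y → |‖k x‖ - ‖k y‖| ≤ C * |x - y| := by
    intro x y hxy
    have h1 := norm_le_add_of_norm_deriv_le_off_zeros hk hC hd hb hxy
    have h2 := norm_le_add_of_norm_deriv_le_off_zeros (hk.comp continuous_neg) hC hd2
      (fun x hx => by rw [norm_neg]; exact hb (-x) hx) (neg_le_neg hxy)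
    simp only [Function.comp_apply, neg_neg] at h2
    rw [abs_sub_comm x, abs_of_nonneg (by linarith : 0 ≤ y - x), abs_le]
    constructor <;> linarith
  rcases le_total x y with h | h
  · exact key x y h
  · rw [abs_sub_comm, abs_sub_comm x]
    exact key y x h

section Gauge

variable {F : ℂ → ℂ}

/-- The natural length scale of `F` at a point of the circle: `1 / |F' (ζ)|`, and `0` on the
singular set. -/
def boundaryGauge (F : ℂ → ℂ) (ζ : ℂ) : ℝ :=
  open Classical in if ζ ∈ singularSet F then 0 else ‖deriv (reflectedExtension F) ζ‖⁻¹

theorem boundaryGauge_of_mem {ζ : ℂ} (hζ : ζ ∈ singularSet F) : boundaryGauge F ζ = 0 := if_pos hζ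

theorem boundaryGauge_of_notMem {ζ : ℂ} (hζ : ζ ∉ singularSet F) :
    boundaryGauge F ζ = ‖deriv (reflectedExtension F) ζ‖⁻¹ := if_neg hζ

/-- Julia's inequality at the origin. It makes the gauge finite, bounded and positive at regular
points. -/
theorem le_norm_deriv_reflectedExtension (hF : IsInnerFunction F) {ζ : ℂ}
    (hζ : ζ ∈ Metric.sphere (0 : ℂ) 1 \ singularSet F) :
    (1 - ‖F 0‖) / 2 ≤ ‖deriv (reflectedExtension F) ζ‖ := by
  have h := julia hF hζ (a := 0) (by simp)
  have hz : ‖ζ‖ = 1 := by simpa using hζ.1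
  rw [sub_zero, hz, norm_zero] at h
  linarith

theorem norm_deriv_reflectedExtension_pos (hF : IsInnerFunction F) {ζ : ℂ}
    (hζ : ζ ∈ Metric.sphere (0 : ℂ) 1 \ singularSet F) :
    0 < ‖deriv (reflectedExtension F) ζ‖ := by
  have h0 : ‖F 0‖ < 1 := norm_lt_one hF (by simp)
  have := le_norm_deriv_reflectedExtension hF hζ
  linarith

theorem boundaryGauge_nonneg (ζ : ℂ) : 0 ≤ boundaryGauge F ζ := by
  rw [boundaryGauge]
  split_ifs
  · exact le_rfl
  · positivity

theorem boundaryGauge_pos (hF : IsInnerFunction F) {ζ : ℂ}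
    (hζ : ζ ∈ Metric.sphere (0 : ℂ) 1 \ singularSet F) : 0 < boundaryGauge F ζ := by
  rw [boundaryGauge_of_notMem hζ.2]
  exact inv_pos.mpr (norm_deriv_reflectedExtension_pos hF hζ)

theorem mem_of_boundaryGauge_pos {ζ : ℂ} (h1 : ‖ζ‖ = 1) (h : 0 < boundaryGauge F ζ) :
    ζ ∈ Metric.sphere (0 : ℂ) 1 \ singularSet F :=
  ⟨by simpa using h1, fun hS => h.ne' (boundaryGauge_of_mem hS)⟩

theorem boundaryGauge_le (hF : IsInnerFunction F) {ζ : ℂ} (hζ : ‖ζ‖ = 1) :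
    boundaryGauge F ζ ≤ 2 / (1 - ‖F 0‖) := by
  have h0 : ‖F 0‖ < 1 := norm_lt_one hF (by simp)
  by_cases hS : ζ ∈ singularSet F
  · rw [boundaryGauge_of_mem hS]
    exact div_nonneg (by norm_num) (by linarith)
  · rw [boundaryGauge_of_notMem hS, ← inv_div]
    exact inv_anti₀ (by linarith) (le_norm_deriv_reflectedExtension hF ⟨by simpa using hζ, hS⟩)

/-- Under the boundary derivative bounds the length scale is Lipschitz on the circle. -/
theorem HasBoundaryDerivativeBounds.boundaryGauge_lipschitz (hF : IsInnerFunction F)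
    (h : HasBoundaryDerivativeBounds F) :
    ∃ K : ℝ, 0 < K ∧ ∀ ζ ζ' : ℂ, ‖ζ‖ = 1 → ‖ζ'‖ = 1 →
      |boundaryGauge F ζ - boundaryGauge F ζ'| ≤ K * ‖ζ - ζ'‖ := by
  obtain ⟨-, htend, C, hC, hbound⟩ := h
  set E := reflectedExtension F with hE
  classical
  set u : ℝ → ℂ := fun x => Complex.exp (x * Complex.I) with hu
  -- Along the circle `(1 / F')' = -i ζ F'' / F' ^ 2`, which is the bounded quantity. The blow-up of
  -- `F'` at `Σ` gives continuity with value `0` there, and `Σ` is exactly the zero set of `k`.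
  set k : ℝ → ℂ := fun x => if u x ∈ singularSet F then 0 else (deriv E (u x))⁻¹ with hkdef
  have hus : ∀ x, u x ∈ Metric.sphere (0 : ℂ) 1 := exp_mem_sphere
  have huc : Continuous u := by fun_prop
  have hnorm : ∀ x, ‖k x‖ = boundaryGauge F (u x) := by
    intro x
    simp only [hkdef]
    split_ifs with hS
    · rw [boundaryGauge_of_mem hS, norm_zero]
    · rw [boundaryGauge_of_notMem hS, norm_inv]
  set k' : ℝ → ℂ := fun x => -(deriv (deriv E) (u x) * (u x * Complex.I)) / deriv E (u x) ^ 2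
    with hk'
  have hder : ∀ x, u x ∉ singularSet F → HasDerivAt k (k' x) x := by
    intro x hx
    have hmem : u x ∈ Metric.sphere (0 : ℂ) 1 \ singularSet F := ⟨hus x, hx⟩
    have h1 : HasDerivAt u (u x * Complex.I) x := by
      have := ((Complex.ofRealCLM.hasDerivAt (x := x)).mul_const Complex.I).cexp
      simpa [hu] using this
    have h2 : HasDerivAt (deriv E) (deriv (deriv E) (u x)) (u x) :=
      (analyticAt_reflectedExtension hF hmem).deriv.differentiableAt.hasDerivAt
    have h3 := (h2.comp x h1).inv (norm_pos_iff.mp (norm_deriv_reflectedExtension_pos hF hmem))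
    refine h3.congr_of_eventuallyEq ?_
    filter_upwards [huc.continuousAt.eventually
      ((isClosed_singularSet F).isOpen_compl.mem_nhds hx)] with y hy
    exact if_neg hy
  have hk0 : ∀ x, k x ≠ 0 → u x ∉ singularSet F := fun x hx hS => hx (if_pos hS)
  have hb : ∀ x, k x ≠ 0 → ‖k' x‖ ≤ C := by
    intro x hx
    have hmem : u x ∈ Metric.sphere (0 : ℂ) 1 \ singularSet F := ⟨hus x, hk0 x hx⟩
    have h1 := hbound _ hmem
    rw [deriv_boundaryExtension hF hmem, iteratedDeriv_boundaryExtension hF hmem,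
      iteratedDeriv_succ, iteratedDeriv_one, norm_div] at h1
    have h2 : ‖u x‖ = 1 := by simpa using hus x
    simpa [hk', h2] using h1
  have hkc : Continuous k := by
    refine continuous_iff_continuousAt.mpr fun x => ?_
    by_cases hx : u x ∈ singularSet F
    · have hkx : k x = 0 := if_pos hx
      rw [ContinuousAt, hkx, Metric.tendsto_nhds]
      intro ε hε
      have h1 : ∀ᶠ ζ in 𝓝 (u x), ζ ∈ Metric.sphere (0 : ℂ) 1 \ singularSet F →
          ε⁻¹ < ‖deriv (boundaryExtension F ζ) ζ‖ := by
        have := htend.eventually (eventually_gt_atTop ε⁻¹)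
        rw [eventually_inf_principal] at this
        exact this.filter_mono (nhds_le_nhdsSet hx)
      filter_upwards [huc.continuousAt.eventually h1] with y hy
      rw [dist_zero_right]
      by_cases hS : u y ∈ singularSet F
      · rw [show k y = 0 from if_pos hS, norm_zero]
        exact hε
      · have h2 := hy ⟨hus y, hS⟩
        rw [deriv_boundaryExtension hF ⟨hus y, hS⟩] at h2
        rw [show k y = (deriv E (u y))⁻¹ from if_neg hS, norm_inv]
        exact inv_lt_of_inv_lt₀ hε h2
    · exact (hder x hx).continuousAt
  -- The factor `2` bounds `π / 2`, the ratio of arc length to chord.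
  refine ⟨2 * C, by positivity, fun ζ ζ' hζ hζ' => ?_⟩
  have hζ0 : ζ ≠ 0 := by rintro rfl; simp at hζ
  have hζ0' : ζ' ≠ 0 := by rintro rfl; simp at hζ'
  obtain ⟨x, rfl⟩ := exp_surj_sphere hζ
  set φ := Complex.arg (ζ' / Complex.exp (x * Complex.I)) with hφ
  have h1 : u (x + φ) = ζ' := by
    have h2 := Complex.norm_mul_exp_arg_mul_I (ζ' / Complex.exp (x * Complex.I))
    rw [norm_div, hζ, hζ', div_one, Complex.ofReal_one, one_mul, ← hφ, eq_div_iff hζ0] at h2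
    rw [← h2]
    simp only [hu]
    rw [← Complex.exp_add]
    push_cast
    ring_nf
  have h2 := abs_norm_sub_norm_le_off_zeros hkc hC.le (fun y hy => hder y (hk0 y hy)) hb x (x + φ)
  rw [hnorm, hnorm, h1, sub_add_cancel_left, abs_neg] at h2
  have h3 := Complex.angle_le_mul_norm_sub hζ' hζ
  rw [Complex.angle_eq_abs_arg hζ0' hζ0, ← hφ, norm_sub_rev] at h3
  refine h2.trans ?_
  have hpi : Real.pi / 2 ≤ 2 := by linarith [Real.pi_le_four]
  calc C * |φ| ≤ C * (Real.pi / 2 * ‖Complex.exp (x * Complex.I) - ζ'‖) := by gcongr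
    _ ≤ C * (2 * ‖Complex.exp (x * Complex.I) - ζ'‖) := by gcongr
    _ = _ := by ring

end Gauge

end

/-! ### Disks on which the extension is nearly affine. -/

noncomputable section

/-- A bounded holomorphic function has Lipschitz derivative in the concentric half disk. -/
theorem norm_deriv_sub_deriv_le {f : ℂ → ℂ} {c : ℂ} {R M : ℝ} (hR : 0 < R)
    (hd : DifferentiableOn ℂ f (Metric.ball c R)) (hb : ∀ z ∈ Metric.ball c R, ‖f z‖ ≤ M) {z : ℂ}
    (hz : z ∈ Metric.ball c (R / 2)) :
    ‖deriv f z - deriv f c‖ ≤ 8 * M / R ^ 2 * ‖z - c‖ := by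
  have h1 : ∀ w ∈ Metric.ball c (R / 2), ‖deriv f w‖ ≤ M / (R / 2) := by
    intro w hw
    have hsub : Metric.closedBall w (R / 2) ⊆ Metric.ball c R := by
      intro v hv
      rw [Metric.mem_closedBall] at hv
      rw [Metric.mem_ball] at hw ⊢
      linarith [dist_triangle v w c]
    refine Complex.norm_deriv_le_of_forall_mem_sphere_norm_le (by positivity)
      (hd.mono ?_).diffContOnCl fun v hv => hb v (hsub (Metric.sphere_subset_closedBall hv))
    exact Metric.closure_ball_subset_closedBall.trans hsub
  have hc : c ∈ Metric.ball c (R / 2) := Metric.mem_ball_self (by positivity)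
  -- Cauchy's estimate bounds the derivative on the half disk; the Schwarz lemma applied to the
  -- derivative then gives the Lipschitz bound at the centre.
  have hmaps : MapsTo (deriv f) (Metric.ball c (R / 2))
      (Metric.closedBall (deriv f c) (2 * (M / (R / 2)))) := by
    intro w hw
    rw [mem_closedBall_iff_norm]
    linarith [norm_sub_le (deriv f w) (deriv f c), h1 w hw, h1 c hc]
  have hdd : DifferentiableOn ℂ (deriv f) (Metric.ball c (R / 2)) :=
    (hd.deriv Metric.isOpen_ball).mono (Metric.ball_subset_ball (by linarith))
  have := Complex.dist_le_div_mul_dist_of_mapsTo_ball hdd hmaps hz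
  rw [dist_eq_norm, dist_eq_norm] at this
  convert this using 2
  field_simp
  ring

section Local

variable {F : ℂ → ℂ}

theorem norm_div_norm {z : ℂ} (hz : z ≠ 0) : ‖z / ‖z‖‖ = 1 := by
  rw [norm_div, Complex.norm_real, norm_norm, div_self (norm_ne_zero_iff.mpr hz)]

theorem norm_sub_div_norm {z : ℂ} (hz : z ≠ 0) : ‖z - z / ‖z‖‖ = |1 - ‖z‖| := by
  have h0 : (‖z‖ : ℂ) ≠ 0 := by simpa using hz
  have : z - z / ‖z‖ = -((1 - ‖z‖ : ℝ) * (z / ‖z‖)) := by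
    push_cast
    field_simp
    ring
  rw [this, norm_neg, norm_mul, norm_div_norm hz, mul_one, Complex.norm_real, Real.norm_eq_abs]

/-- `κ` is a scale at which the extension of `F` is nearly linear: in every disk around a regular
boundary point `ζ` of radius `κ / |F' (ζ)|` the derivative varies by at most `|F' (ζ)| / 2`. -/
structure IsLinearizationScale (F : ℂ → ℂ) (κ : ℝ) : Prop where
  pos : 0 < κ
  le_half : κ ≤ 1 / 2
  mul_gauge_le : ∀ ζ : ℂ, ‖ζ‖ = 1 → κ * boundaryGauge F ζ ≤ 1 / 2
  lipschitz : ∀ ζ ζ' : ℂ, ‖ζ‖ = 1 → ‖ζ'‖ = 1 →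
    κ * |boundaryGauge F ζ - boundaryGauge F ζ'| ≤ ‖ζ - ζ'‖ / 2
  differentiableAt : ∀ ζ ∈ Metric.sphere (0 : ℂ) 1 \ singularSet F, ∀ z : ℂ,
    ‖z - ζ‖ < κ * boundaryGauge F ζ → DifferentiableAt ℂ (reflectedExtension F) z
  norm_deriv_sub_le : ∀ ζ ∈ Metric.sphere (0 : ℂ) 1 \ singularSet F, ∀ z : ℂ,
    ‖z - ζ‖ < κ * boundaryGauge F ζ →
    ‖deriv (reflectedExtension F) z - deriv (reflectedExtension F) ζ‖ ≤
      ‖deriv (reflectedExtension F) ζ‖ / 2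

/-- On a disk of radius `c * boundaryGauge F ζ` the gauge of nearby circle points stays comparable,
so the disk misses `Σ`, and Julia's inequality gives `‖F‖ ≥ 1 / 2` on its part inside the unit disk.
The extension is then bounded by `2`, and the Cauchy and Schwarz estimates control its derivative on
a smaller disk. -/
theorem HasBoundaryDerivativeBounds.exists_isLinearizationScale (hF : IsInnerFunction F)
    (h : HasBoundaryDerivativeBounds F) : ∃ κ, IsLinearizationScale F κ := by
  obtain ⟨K, hK, hlip⟩ := h.boundaryGauge_lipschitz hF
  have h0 : ‖F 0‖ < 1 := norm_lt_one hF (by simp)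
  set H := 2 / (1 - ‖F 0‖) with hH
  have hHpos : 0 < H := div_pos (by norm_num) (by linarith)
  set c := 1 / (4 * K + 8 + 2 * H) with hc
  have hcpos : 0 < c := by positivity
  have hc1 : c * (4 * K + 8 + 2 * H) = 1 := by rw [hc]; field_simp
  have hcK : 4 * (K * c) ≤ 1 := by nlinarith
  have hc8 : 8 * c ≤ 1 := by nlinarith [mul_pos hcpos hK, mul_pos hcpos hHpos]
  have hcH : 2 * (c * H) ≤ 1 := by nlinarith [mul_pos hcpos hK]
  have hκc : c ^ 2 / 32 ≤ c / 2 := by nlinarith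
  have key : ∀ ζ ∈ Metric.sphere (0 : ℂ) 1 \ singularSet F,
      ∀ z ∈ Metric.ball ζ (c * boundaryGauge F ζ),
        DifferentiableAt ℂ (reflectedExtension F) z ∧ ‖reflectedExtension F z‖ ≤ 1 / (1 / 2) := by
    intro ζ hζ z hz
    have hζ1 : ‖ζ‖ = 1 := by simpa using hζ.1
    have hpos := boundaryGauge_pos hF hζ
    have hle := boundaryGauge_le hF hζ1
    set g := boundaryGauge F ζ with hg
    have hcg : c * g ≤ 1 / 2 := by nlinarith
    refine reflectedExtension_on_ball hF hζ1 (by norm_num) (by norm_num) ?_ ?_ hz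
    · intro w hw hS
      rw [mem_ball_iff_norm] at hw
      have h1 := hlip w ζ (by simpa using hS.1) hζ1
      rw [boundaryGauge_of_mem hS, zero_sub, abs_neg, abs_of_pos hpos] at h1
      nlinarith [mul_pos hcpos hK]
    · intro w hw hw1
      rw [mem_ball_iff_norm] at hw
      have h1 : |‖w‖ - ‖ζ‖| ≤ ‖w - ζ‖ := abs_norm_sub_norm_le w ζ
      rw [hζ1, abs_sub_comm] at h1
      have hw2 : 1 - ‖w‖ ≤ ‖w - ζ‖ := (le_abs_self _).trans h1
      have hw0 : w ≠ 0 := by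
        rintro rfl
        rw [norm_zero] at hw2
        linarith
      have h2 := norm_sub_div_norm hw0
      have h3 : ‖w / ‖w‖ - ζ‖ ≤ 2 * (c * g) := by
        have := norm_sub_le_norm_sub_add_norm_sub (w / ‖w‖) w ζ
        rw [norm_sub_rev _ w, h2] at this
        linarith
      have h4 := hlip (w / ‖w‖) ζ (norm_div_norm hw0) hζ1
      have h5 : g / 2 ≤ boundaryGauge F (w / ‖w‖) := by
        have := (abs_le.mp h4).1
        nlinarith [mul_le_mul_of_nonneg_left h3 hK.le]
      have h6 := mem_of_boundaryGauge_pos (norm_div_norm hw0) ((half_pos hpos).trans_le h5)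
      -- Julia's inequality at the radial projection of `w`, whose gauge is at least `g / 2`, gives
      -- `1 - ‖F w‖ ≤ 2 l c g ≤ 4 c ≤ 1 / 2`.
      have h7 := julia hF h6 hw1
      rw [norm_sub_rev, h2, abs_of_pos (by linarith)] at h7
      rw [boundaryGauge_of_notMem h6.2] at h5
      set l := ‖deriv (reflectedExtension F) (w / ‖w‖)‖ with hl
      have hlpos : 0 < l := norm_deriv_reflectedExtension_pos hF h6
      have h8 : g * l ≤ 2 := by
        have : g ≤ 2 / l := by
          rw [div_eq_mul_inv]; linarith
        rwa [le_div_iff₀ hlpos] at this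
      have h9 : (1 - ‖w‖) * (1 - ‖F w‖) ≤ (1 - ‖w‖) * (2 * l * (1 - ‖w‖)) := by
        have hFw := norm_lt_one hF hw1
        have : 0 ≤ (1 - ‖w‖) * (1 - ‖F w‖) * ‖w‖ :=
          mul_nonneg (mul_nonneg (by linarith) (by linarith)) (norm_nonneg _)
        nlinarith
      have h10 := le_of_mul_le_mul_left h9 (by linarith)
      have h11 : l * (1 - ‖w‖) ≤ l * (c * g) := by gcongr; linarith
      nlinarith
  -- Bound `2` on radius `c g` makes the derivative vary by at most `16 ‖z - ζ‖ / (c g) ^ 2`, which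
  -- is half of `‖F' ζ‖ = 1 / g` at distance `c ^ 2 g / 32`.
  refine ⟨c ^ 2 / 32, by positivity, by nlinarith, ?_, ?_, ?_, ?_⟩
  · intro ζ hζ
    have := boundaryGauge_le hF hζ
    have h1 := boundaryGauge_nonneg (F := F) ζ
    nlinarith [mul_nonneg hcpos.le h1]
  · intro ζ ζ' hζ hζ'
    have h1 := hlip ζ ζ' hζ hζ'
    have h2 := norm_nonneg (ζ - ζ')
    calc c ^ 2 / 32 * |boundaryGauge F ζ - boundaryGauge F ζ'|
        ≤ c / 2 * (K * ‖ζ - ζ'‖) := by gcongr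
      _ = 4 * (K * c) * ‖ζ - ζ'‖ / 8 := by ring
      _ ≤ _ := by nlinarith
  · intro ζ hζ z hz
    refine (key ζ hζ z ?_).1
    rw [mem_ball_iff_norm]
    refine hz.trans_le (mul_le_mul_of_nonneg_right ?_ (boundaryGauge_nonneg _))
    linarith
  · intro ζ hζ z hz
    have hpos := boundaryGauge_pos hF hζ
    have h1 := norm_deriv_sub_deriv_le (mul_pos hcpos hpos)
      (fun w hw => (key ζ hζ w hw).1.differentiableWithinAt) (fun w hw => (key ζ hζ w hw).2)
      (z := z) (by rw [mem_ball_iff_norm]; nlinarith)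
    refine h1.trans ?_
    have h2 : ‖deriv (reflectedExtension F) ζ‖ = (boundaryGauge F ζ)⁻¹ := by
      rw [boundaryGauge_of_notMem hζ.2, inv_inv]
    rw [h2]
    set g := boundaryGauge F ζ with hg
    calc 8 * (1 / (1 / 2)) / (c * g) ^ 2 * ‖z - ζ‖
        ≤ 8 * (1 / (1 / 2)) / (c * g) ^ 2 * (c ^ 2 / 32 * g) := by gcongr
      _ = g⁻¹ / 2 := by field_simp; norm_num

namespace IsLinearizationScale

variable {κ : ℝ} {ζ : ℂ}

theorem gauge_mul_norm_deriv (hF : IsInnerFunction F)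
    (hζ : ζ ∈ Metric.sphere (0 : ℂ) 1 \ singularSet F) :
    boundaryGauge F ζ * ‖deriv (reflectedExtension F) ζ‖ = 1 := by
  rw [boundaryGauge_of_notMem hζ.2]
  exact inv_mul_cancel₀ (norm_deriv_reflectedExtension_pos hF hζ).ne'

theorem deriv_ne_zero (hF : IsInnerFunction F) (h : IsLinearizationScale F κ)
    (hζ : ζ ∈ Metric.sphere (0 : ℂ) 1 \ singularSet F) {z : ℂ}
    (hz : ‖z - ζ‖ < κ * boundaryGauge F ζ) : deriv (reflectedExtension F) z ≠ 0 := by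
  intro h0
  have h1 := h.norm_deriv_sub_le ζ hζ z hz
  have h2 := norm_deriv_reflectedExtension_pos hF hζ
  rw [h0, zero_sub, norm_neg] at h1
  linarith

/-- Mean value inequality for the extension minus its linear part at `ζ`. Multiplying by the gauge
normalizes the derivative to modulus `1`; injectivity and two-sided distortion bounds follow. -/
theorem gauge_mul_norm_sub_sub_le (hF : IsInnerFunction F) (h : IsLinearizationScale F κ)
    (hζ : ζ ∈ Metric.sphere (0 : ℂ) 1 \ singularSet F) {u v : ℂ}
    (hu : ‖u - ζ‖ < κ * boundaryGauge F ζ) (hv : ‖v - ζ‖ < κ * boundaryGauge F ζ) :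
    boundaryGauge F ζ * ‖reflectedExtension F u - reflectedExtension F v -
      deriv (reflectedExtension F) ζ * (u - v)‖ ≤ ‖u - v‖ / 2 := by
  set E := reflectedExtension F with hE
  have h1 := (convex_ball ζ (κ * boundaryGauge F ζ)).norm_image_sub_le_of_norm_hasDerivWithin_le
    (f := fun z => E z - deriv E ζ * z) (f' := fun z => deriv E z - deriv E ζ)
    (C := ‖deriv E ζ‖ / 2) (x := v) (y := u) (fun z hz => by
      rw [mem_ball_iff_norm] at hz
      have h2 := ((h.differentiableAt ζ hζ z hz).hasDerivAt).sub
        ((hasDerivAt_id z).const_mul (deriv E ζ))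
      rw [mul_one] at h2
      exact h2.hasDerivWithinAt)
    (fun z hz => h.norm_deriv_sub_le ζ hζ z (mem_ball_iff_norm.mp hz))
    (mem_ball_iff_norm.mpr hv) (mem_ball_iff_norm.mpr hu)
  have h3 : E u - E v - deriv E ζ * (u - v) = E u - deriv E ζ * u - (E v - deriv E ζ * v) := by ring
  rw [h3]
  have h4 := gauge_mul_norm_deriv hF hζ
  calc _ ≤ boundaryGauge F ζ * (‖deriv E ζ‖ / 2 * ‖u - v‖) :=
        mul_le_mul_of_nonneg_left h1 (boundaryGauge_nonneg _)
    _ = boundaryGauge F ζ * ‖deriv E ζ‖ * ‖u - v‖ / 2 := by ring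
    _ = _ := by rw [h4, one_mul]

theorem norm_sub_le (hF : IsInnerFunction F) (h : IsLinearizationScale F κ)
    (hζ : ζ ∈ Metric.sphere (0 : ℂ) 1 \ singularSet F) {u v : ℂ}
    (hu : ‖u - ζ‖ < κ * boundaryGauge F ζ) (hv : ‖v - ζ‖ < κ * boundaryGauge F ζ) :
    ‖u - v‖ ≤ 2 * (boundaryGauge F ζ * ‖reflectedExtension F u - reflectedExtension F v‖) := by
  have h1 := gauge_mul_norm_sub_sub_le hF h hζ hu hv
  set w := reflectedExtension F u - reflectedExtension F v
  have h2 := norm_sub_norm_le (deriv (reflectedExtension F) ζ * (u - v)) w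
  rw [norm_sub_rev _ w, norm_mul] at h2
  have h3 := mul_le_mul_of_nonneg_left h2 (boundaryGauge_nonneg (F := F) ζ)
  rw [mul_sub, ← mul_assoc, gauge_mul_norm_deriv hF hζ] at h3
  linarith

theorem gauge_mul_norm_sub_le (hF : IsInnerFunction F) (h : IsLinearizationScale F κ)
    (hζ : ζ ∈ Metric.sphere (0 : ℂ) 1 \ singularSet F) {u v : ℂ}
    (hu : ‖u - ζ‖ < κ * boundaryGauge F ζ) (hv : ‖v - ζ‖ < κ * boundaryGauge F ζ) :
    boundaryGauge F ζ * ‖reflectedExtension F u - reflectedExtension F v‖ ≤ 3 / 2 * ‖u - v‖ := by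
  have h1 := gauge_mul_norm_sub_sub_le hF h hζ hu hv
  set w := reflectedExtension F u - reflectedExtension F v
  have h2 := norm_sub_norm_le w (deriv (reflectedExtension F) ζ * (u - v))
  rw [norm_mul] at h2
  have h3 := mul_le_mul_of_nonneg_left h2 (boundaryGauge_nonneg (F := F) ζ)
  rw [mul_sub, ← mul_assoc, gauge_mul_norm_deriv hF hζ] at h3
  linarith

theorem norm_center_sub_lt (hF : IsInnerFunction F) (h : IsLinearizationScale F κ)
    (hζ : ζ ∈ Metric.sphere (0 : ℂ) 1 \ singularSet F) : ‖ζ - ζ‖ < κ * boundaryGauge F ζ := by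
  rw [sub_self, norm_zero]
  exact mul_pos h.pos (boundaryGauge_pos hF hζ)

/-- A quantitative open mapping theorem: on the circle of radius `t * boundaryGauge F ζ` the
extension differs from its central value by at least `t / 2`, so the image contains a disk of half
that radius. It is independent of the gauge. -/
theorem ball_subset_image (hF : IsInnerFunction F) (h : IsLinearizationScale F κ)
    (hζ : ζ ∈ Metric.sphere (0 : ℂ) 1 \ singularSet F) {t : ℝ} (ht : 0 < t) (htκ : t < κ) {w : ℂ}
    (hw : ‖w - reflectedExtension F ζ‖ < t / 4) :
    ∃ z, ‖z - ζ‖ ≤ t * boundaryGauge F ζ ∧ reflectedExtension F z = w := by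
  have hg := boundaryGauge_pos hF hζ
  have hc := norm_center_sub_lt hF h hζ
  have hlt : t * boundaryGauge F ζ < κ * boundaryGauge F ζ := by gcongr
  have hd : DiffContOnCl ℂ (reflectedExtension F) (Metric.ball ζ (t * boundaryGauge F ζ)) := by
    refine DifferentiableOn.diffContOnCl fun z hz => ?_
    have hz1 := Metric.closure_ball_subset_closedBall hz
    rw [mem_closedBall_iff_norm] at hz1
    exact (h.differentiableAt ζ hζ z (hz1.trans_lt hlt)).differentiableWithinAt
  have hsub := hd.ball_subset_image_closedBall (mul_pos ht hg) (ε := t / 2) (fun z hz => by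
      rw [mem_sphere_iff_norm] at hz
      have := norm_sub_le hF h hζ (hz.trans_lt hlt) hc
      rw [hz] at this
      nlinarith) (by
      refine Eventually.frequently (f := 𝓝[≠] ζ) ?_ |>.filter_mono nhdsWithin_le_nhds
      have hn : Metric.ball ζ (κ * boundaryGauge F ζ) ∈ 𝓝 ζ :=
        Metric.ball_mem_nhds _ (mul_pos h.pos hg)
      filter_upwards [nhdsWithin_le_nhds hn, self_mem_nhdsWithin] with z hz hne he
      have := norm_sub_le hF h hζ (mem_ball_iff_norm.mp hz) hc
      rw [he, sub_self, norm_zero, mul_zero, mul_zero] at this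
      exact hne (sub_eq_zero.mp (norm_le_zero_iff.mp this)))
  obtain ⟨z, hz, hzw⟩ := hsub (show w ∈ _ by
    rw [mem_ball_iff_norm]
    linarith)
  exact ⟨z, mem_closedBall_iff_norm.mp hz, hzw⟩

/-- Radially inside a regular boundary point the function moves away from the circle linearly. -/
theorem norm_radial_le (hF : IsInnerFunction F) (h : IsLinearizationScale F κ)
    (hζ : ζ ∈ Metric.sphere (0 : ℂ) 1 \ singularSet F) {t : ℝ} (ht : 0 < t) (htκ : t < κ) {z : ℂ}
    (hz : z = (1 - t * boundaryGauge F ζ : ℝ) * ζ) : ‖F z‖ ≤ 1 - t / 2 := by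
  have hζ1 : ‖ζ‖ = 1 := by simpa using hζ.1
  have hg := boundaryGauge_pos hF hζ
  have hκg := h.mul_gauge_le ζ hζ1
  have hlt : t * boundaryGauge F ζ < κ * boundaryGauge F ζ := by gcongr
  set g := boundaryGauge F ζ with hgdef
  have htg : 0 < t * g := mul_pos ht hg
  have hzn : ‖z‖ < 1 := by
    rw [hz, norm_mul, hζ1, mul_one, Complex.norm_real, Real.norm_of_nonneg (by linarith)]
    linarith
  have hsub : z - ζ = -((t * g : ℝ) * ζ) := by rw [hz]; push_cast; ring
  have hn : ‖z - ζ‖ = t * g := by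
    rw [hsub, norm_neg, norm_mul, hζ1, mul_one, Complex.norm_real, Real.norm_of_nonneg htg.le]
  have h1 := gauge_mul_norm_sub_sub_le hF h hζ (hn.trans_lt hlt) (norm_center_sub_lt hF h hζ)
  set E := reflectedExtension F with hE
  -- The linear part moves the value straight towards the origin by `t`; the nonlinear error is at
  -- most `t / 2`.
  have h2 : deriv E ζ * (z - ζ) = -(t * E ζ) := by
    have h3 := mul_deriv_reflectedExtension hF hζ
    have h4 : (g : ℂ) * (‖deriv E ζ‖ : ℂ) = 1 := by
      exact_mod_cast gauge_mul_norm_deriv hF hζ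
    rw [hsub]
    push_cast
    linear_combination (-(t * g : ℂ)) * h3 - t * E ζ * h4
  rw [h2, hn] at h1
  have h5 : ‖E z - E ζ - -(t * E ζ)‖ ≤ t / 2 := by
    have : g * ‖E z - E ζ - -(t * E ζ)‖ ≤ g * (t / 2) := by linarith
    exact le_of_mul_le_mul_left this hg
  have h6 : E z = (1 - t : ℝ) * E ζ + (E z - E ζ - -(t * E ζ)) := by push_cast; ring
  have h7 : ‖E z‖ ≤ (1 - t) + t / 2 := by
    rw [h6]
    refine (norm_add_le _ _).trans (add_le_add ?_ h5)
    rw [norm_mul, norm_reflectedExtension_eq_one hF hζ, mul_one, Complex.norm_real,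
      Real.norm_of_nonneg (by linarith [h.le_half])]
  rw [hE, reflectedExtension_of_lt hzn] at h7
  linarith

end IsLinearizationScale

end Local

end

/-! ### Points where `F` is near the circle lie in linearization disks. -/

noncomputable section

open scoped ComplexConjugate

section Sheets

variable {F : ℂ → ℂ} {κ : ℝ}

theorem norm_eq_one_of_norm_reflectedExtension (hF : IsInnerFunction F) {z : ℂ}
    (h : ‖reflectedExtension F z‖ = 1) : ‖z‖ = 1 := by
  rcases lt_trichotomy ‖z‖ 1 with hlt | heq | hgt
  · rw [reflectedExtension_of_lt hlt] at h
    exact absurd h (norm_lt_one hF hlt).ne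
  · exact heq
  · rw [reflectedExtension_of_gt hgt, norm_schwarzReflection, inv_eq_one] at h
    refine absurd h (norm_lt_one hF ?_).ne
    rw [norm_inv_conj]
    exact inv_lt_one_of_one_lt₀ hgt

/-- The Lipschitz condition includes singular points, so the gauge of the radial projection is
continuous everywhere except at the origin. The collar `1 - ‖z‖ ≤ t * boundaryGauge F (z / ‖z‖)`
thus has a continuous profile. -/
theorem IsLinearizationScale.continuousAt_gauge (h : IsLinearizationScale F κ) {ξ : ℂ}
    (hξ : ξ ≠ 0) : ContinuousAt (fun z : ℂ => boundaryGauge F (z / ‖z‖)) ξ := by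
  have h1 : ContinuousAt (fun z : ℂ => z / (‖z‖ : ℂ)) ξ :=
    continuousAt_id.div (Complex.continuous_ofReal.continuousAt.comp continuous_norm.continuousAt)
      (by simpa using hξ)
  have h2 : Tendsto (fun z : ℂ => ‖z / ‖z‖ - ξ / ‖ξ‖‖ / 2 / κ) (𝓝 ξ) (𝓝 0) := by
    have := (((h1.sub (continuousAt_const (y := ξ / ‖ξ‖))).norm.div_const 2).div_const κ).tendsto
    simpa using this
  rw [ContinuousAt, tendsto_iff_norm_sub_tendsto_zero]
  refine squeeze_zero' (Eventually.of_forall fun z => norm_nonneg _) ?_ h2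
  filter_upwards [eventually_ne_nhds hξ] with z hz
  rw [le_div_iff₀ h.pos, Real.norm_eq_abs, mul_comm]
  exact h.lipschitz _ _ (norm_div_norm hz) (norm_div_norm hξ)

/-- If the singular set is null, points where `F` is close to the circle are close to the circle on
the natural scale. -/
theorem IsLinearizationScale.one_sub_norm_le (hF : IsInnerFunction F)
    (h : IsLinearizationScale F κ)
    (hnull : volume {θ : ℝ | θ ∈ Ico 0 (2 * Real.pi) ∧
      Complex.exp (θ * Complex.I) ∈ singularSet F} = 0)
    {t : ℝ} (ht : 0 < t) (htκ : t < κ) (h0 : ‖F 0‖ ≤ 1 - t / 2) {p : ℂ} (hp : ‖p‖ < 1)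
    (hFp : 1 - t / 2 < ‖F p‖) : 1 - ‖p‖ ≤ t * boundaryGauge F (p / ‖p‖) := by
  by_contra! hlt
  -- The hypothetical bad set, below the collar with `‖F‖ > 1 - t / 2`. Its frontier avoids regular
  -- circle points, and `‖F‖ ≤ 1 - t / 2` at its frontier points in the disk: by `norm_radial_le` on
  -- the collar boundary, by `h0` at the origin. Only the null set `Σ` is left over, and the maximum
  -- principle makes `V` empty.
  set V : Set ℂ := {z | ‖z‖ < 1 ∧ z ≠ 0 ∧ t * boundaryGauge F (z / ‖z‖) < 1 - ‖z‖ ∧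
    1 - t / 2 < ‖F z‖} with hV
  have hp0 : p ≠ 0 := by rintro rfl; linarith
  have hFc : ∀ z : ℂ, ‖z‖ < 1 → ContinuousAt F z := fun z hz =>
    (hF.holomorphic.differentiableAt (Metric.isOpen_ball.mem_nhds (by simpa using hz))).continuousAt
  have hVo : IsOpen V := by
    rw [isOpen_iff_mem_nhds]
    rintro z ⟨h1, h2, h3, h4⟩
    have e1 := continuous_norm.continuousAt.eventually (eventually_lt_nhds h1)
    have e3 : ∀ᶠ w : ℂ in 𝓝 z, t * boundaryGauge F (w / ‖w‖) < 1 - ‖w‖ :=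
      ((h.continuousAt_gauge h2).const_mul t).eventually_lt
        (continuousAt_const.sub continuous_norm.continuousAt) h3
    have e4 := (hFc z h1).norm.eventually (eventually_gt_nhds h4)
    filter_upwards [e1, eventually_ne_nhds h2, e3, e4] with w w1 w2 w3 w4
    exact ⟨w1, w2, w3, w4⟩
  have hVb : V ⊆ Metric.ball 0 1 := fun z hz => by simpa using hz.1
  have hkey := norm_le_of_eventually_frontier_off_null (isClosed_singularSet F)
    (singularSet_subset_sphere F) hnull hVo hVb (hF.holomorphic.mono hVb)
    (M := 1 - t / 2) (by linarith [h.le_half]) (fun z hz => (norm_lt_one hF hz.1).le) ?_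
    (z := p) ⟨hp, hp0, hlt, hFp⟩
  · linarith
  intro ξ hξ hξS M' hM'
  have hξ1 : ‖ξ‖ ≤ 1 := by
    have := closure_mono hVb (frontier_subset_closure hξ)
    simpa using Metric.closure_ball_subset_closedBall this
  have hξV : ξ ∉ V := by
    rw [hVo.frontier_eq] at hξ
    exact hξ.2
  have hgood : ‖ξ‖ < 1 → ‖F ξ‖ ≤ 1 - t / 2 → ∀ᶠ z in 𝓝[V] ξ, ‖F z‖ ≤ M' := fun h1 h2 =>
    ((hFc ξ h1).norm.eventually (eventually_le_nhds (h2.trans_lt hM'))).filter_mono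
      nhdsWithin_le_nhds
  by_cases hξ0 : ξ = 0
  · subst hξ0
    exact hgood (by simp) h0
  rcases lt_trichotomy (1 - ‖ξ‖) (t * boundaryGauge F (ξ / ‖ξ‖)) with hl | he | hg
  · have e1 : ∀ᶠ w : ℂ in 𝓝 ξ, 1 - ‖w‖ < t * boundaryGauge F (w / ‖w‖) :=
      (continuousAt_const.sub continuous_norm.continuousAt).eventually_lt
        ((h.continuousAt_gauge hξ0).const_mul t) hl
    filter_upwards [nhdsWithin_le_nhds e1, self_mem_nhdsWithin] with w hw hwV
    exact absurd hw hwV.2.2.1.not_gt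
  · rcases hξ1.eq_or_lt with h1 | h1
    · have hmem : ξ ∈ Metric.sphere (0 : ℂ) 1 \ singularSet F := ⟨by simpa using h1, hξS⟩
      rw [h1, sub_self, Complex.ofReal_one, div_one] at he
      exact absurd he (mul_pos ht (boundaryGauge_pos hF hmem)).ne
    · have hpos : 0 < boundaryGauge F (ξ / ‖ξ‖) := by
        have : 0 < t * boundaryGauge F (ξ / ‖ξ‖) := by linarith
        exact pos_of_mul_pos_right this ht.le
      refine hgood h1 (h.norm_radial_le hF
        (mem_of_boundaryGauge_pos (norm_div_norm hξ0) hpos) ht htκ ?_)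
      rw [← he, sub_sub_cancel, mul_div_cancel₀]
      simpa using hξ0
  · rcases hξ1.eq_or_lt with h1 | h1
    · rw [h1, sub_self] at hg
      exact absurd hg (mul_nonneg ht.le (boundaryGauge_nonneg _)).not_gt
    · refine hgood h1 (not_lt.mp fun h2 => hξV ⟨h1, hξ0, hg, h2⟩)

/-- Points of the plane where the extension of `F` is close to the circle are close to the circle
on the natural scale. -/
theorem IsLinearizationScale.exists_norm_sub_le (hF : IsInnerFunction F)
    (h : IsLinearizationScale F κ)
    (hnull : volume {θ : ℝ | θ ∈ Ico 0 (2 * Real.pi) ∧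
      Complex.exp (θ * Complex.I) ∈ singularSet F} = 0)
    {t : ℝ} (ht : 0 < t) (htκ : t < κ) (h0 : ‖F 0‖ ≤ 1 - t / 2) {p w : ℂ} (hp : p ∉ singularSet F)
    (hw : ‖w‖ = 1) (hpw : ‖reflectedExtension F p - w‖ < t / 2) :
    ∃ ζ ∈ Metric.sphere (0 : ℂ) 1 \ singularSet F, ‖p - ζ‖ ≤ 2 * t * boundaryGauge F ζ := by
  have ht2 : t < 1 / 2 := htκ.trans_le h.le_half
  have hin : ∀ q : ℂ, ‖q‖ < 1 → 1 - t / 2 < ‖F q‖ →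
      ∃ ζ ∈ Metric.sphere (0 : ℂ) 1 \ singularSet F, ‖q - ζ‖ ≤ t * boundaryGauge F ζ ∧
        1 / 2 ≤ ‖q‖ := by
    intro q hq hFq
    have h1 := h.one_sub_norm_le hF hnull ht htκ h0 hq hFq
    have hq0 : q ≠ 0 := by rintro rfl; linarith
    have hpos : 0 < boundaryGauge F (q / ‖q‖) :=
      pos_of_mul_pos_right (by linarith : 0 < t * boundaryGauge F (q / ‖q‖)) ht.le
    have h2 := h.mul_gauge_le _ (norm_div_norm hq0)
    refine ⟨q / ‖q‖, mem_of_boundaryGauge_pos (norm_div_norm hq0) hpos, ?_, ?_⟩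
    · rw [norm_sub_div_norm hq0, abs_of_pos (by linarith)]
      exact h1
    · nlinarith
  rcases lt_trichotomy ‖p‖ 1 with hlt | heq | hgt
  · rw [reflectedExtension_of_lt hlt] at hpw
    have h1 := norm_sub_norm_le w (F p)
    rw [norm_sub_rev, hw] at h1
    obtain ⟨ζ, hζ, hζ1, -⟩ := hin p hlt (by linarith)
    have := mul_nonneg ht.le (boundaryGauge_nonneg (F := F) ζ)
    exact ⟨ζ, hζ, by linarith⟩
  · refine ⟨p, ⟨by simpa using heq, hp⟩, ?_⟩
    rw [sub_self, norm_zero]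
    have := mul_nonneg ht.le (boundaryGauge_nonneg (F := F) p)
    linarith
  · have hp0 : p ≠ 0 := by rintro rfl; norm_num at hgt
    have hq1 : ‖(conj p)⁻¹‖ < 1 := by
      rw [norm_inv_conj]
      exact inv_lt_one_of_one_lt₀ hgt
    have hub := norm_sub_norm_le (reflectedExtension F p) w
    have hlb := norm_sub_norm_le w (reflectedExtension F p)
    rw [norm_sub_rev] at hlb
    rw [hw, reflectedExtension_of_gt hgt, norm_schwarzReflection] at hub hlb
    rw [reflectedExtension_of_gt hgt] at hpw
    set a := ‖F (conj p)⁻¹‖ with ha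
    have hapos : 0 < a := by
      refine (norm_nonneg _).lt_of_ne fun h3 => ?_
      rw [ha.trans h3.symm, inv_zero] at hlb
      linarith
    have h3 : a⁻¹ < 1 + t / 2 := by linarith
    have h4 : 1 < (1 + t / 2) * a := by
      rw [inv_lt_iff_one_lt_mul₀ hapos] at h3
      linarith
    obtain ⟨ζ, hζ, hζ1, hζ2⟩ := hin _ hq1 (by
      have := norm_lt_one hF hq1
      nlinarith)
    refine ⟨ζ, hζ, ?_⟩
    have h5 := dist_inv_conj (by simpa using hζ.1) hp0 (ζ := ζ)
    rw [dist_eq_norm, dist_eq_norm] at h5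
    rw [h5, div_le_iff₀ (by linarith)] at hζ1
    rw [norm_inv_conj] at hζ2
    -- Reflection back to the exterior multiplies the distance to `ζ` by `‖p‖`; hence the factor `2`
    -- in the conclusion.
    have h6 : ‖p‖ ≤ 2 := by
      have := inv_anti₀ (by norm_num) hζ2
      rw [inv_inv] at this
      linarith
    have := mul_nonneg ht.le (boundaryGauge_nonneg (F := F) ζ)
    nlinarith

/-- The disks of the natural scale around the preimages of `w` cover the preimage of a neighbourhood
of `w`. -/
theorem IsLinearizationScale.exists_preimage_near (hF : IsInnerFunction F)
    (h : IsLinearizationScale F κ)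
    (hnull : volume {θ : ℝ | θ ∈ Ico 0 (2 * Real.pi) ∧
      Complex.exp (θ * Complex.I) ∈ singularSet F} = 0)
    {t : ℝ} (ht : 0 < t) (htκ : t ≤ κ / 1024) (h0 : ‖F 0‖ ≤ 1 - t / 2) {p w : ℂ}
    (hp : p ∉ singularSet F) (hw : ‖w‖ = 1) (hpw : ‖reflectedExtension F p - w‖ < t / 2) :
    ∃ ζ ∈ Metric.sphere (0 : ℂ) 1 \ singularSet F, reflectedExtension F ζ = w ∧
      ‖p - ζ‖ < κ / 4 * boundaryGauge F ζ := by
  have hκ := h.pos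
  obtain ⟨ζ', hζ', hd⟩ := h.exists_norm_sub_le hF hnull ht (by linarith) h0 hp hw hpw
  have hζ1' : ‖ζ'‖ = 1 := by simpa using hζ'.1
  have hg' := boundaryGauge_pos hF hζ'
  set g' := boundaryGauge F ζ' with hg'def
  have h1 := h.gauge_mul_norm_sub_le hF hζ' (u := p) (hd.trans_lt (by gcongr; linarith))
    (h.norm_center_sub_lt hF hζ')
  have h2 : ‖reflectedExtension F p - reflectedExtension F ζ'‖ ≤ 3 * t := by
    have : g' * ‖reflectedExtension F p - reflectedExtension F ζ'‖ ≤ g' * (3 * t) := by linarith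
    exact le_of_mul_le_mul_left this hg'
  -- The error is below `t / 2 + 3 t`, and `t ≤ κ / 1024` leaves room. `ball_subset_image` then
  -- moves `ζ'` to an exact preimage of `w`, which lies on the circle because `‖w‖ = 1`.
  have h3 : ‖w - reflectedExtension F ζ'‖ < κ / 32 / 4 := by
    have := norm_sub_le_norm_sub_add_norm_sub w (reflectedExtension F p) (reflectedExtension F ζ')
    rw [norm_sub_rev w (reflectedExtension F p)] at this
    linarith
  obtain ⟨ζ, hζd, hζw⟩ := h.ball_subset_image hF hζ' (t := κ / 32) (by linarith) (by linarith) h3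
  have hζ1 : ‖ζ‖ = 1 := norm_eq_one_of_norm_reflectedExtension hF (by rw [hζw, hw])
  have h4 := h.lipschitz ζ ζ' hζ1 hζ1'
  have h5 : g' / 2 ≤ boundaryGauge F ζ := by
    have h6 : κ * |boundaryGauge F ζ - g'| ≤ κ * (g' / 2) := by nlinarith [mul_pos hκ hg']
    have h7 := le_of_mul_le_mul_left h6 hκ
    linarith [(abs_le.mp h7).1]
  refine ⟨ζ, mem_of_boundaryGauge_pos hζ1 (by linarith), hζw, ?_⟩
  have h8 := norm_sub_le_norm_sub_add_norm_sub p ζ' ζ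
  rw [norm_sub_rev ζ' ζ] at h8
  nlinarith [mul_le_mul_of_nonneg_left h5 hκ.le, mul_pos hκ hg']

end Sheets

end

/-! ### From the derivative bounds to the covering of the symmetric annulus: (d) ⇒ (c). -/

noncomputable section

open scoped ComplexConjugate

section SymmetricCovering

variable {F : ℂ → ℂ}

/-- The hypothesis excludes poles, where the planar function has the default value `0` of the
inverse instead of `∞`. -/
theorem sphereExtension_coe {z : ℂ} (hz : 1 < ‖z‖ → F (conj z)⁻¹ ≠ 0) :
    sphereExtension F (z : OnePoint ℂ) = (reflectedExtension F z : OnePoint ℂ) := by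
  rcases lt_trichotomy ‖z‖ 1 with hlt | heq | hgt
  · rw [sphereExtension_coe_of_lt hlt, reflectedExtension_of_lt hlt]
  · rw [sphereExtension_coe_of_eq heq, reflectedExtension_of_eq heq]
  · rw [sphereExtension_coe_of_gt hgt, reflectedExtension_of_gt hgt, circleReflection_of_ne (hz hgt)]
    rfl

/-- Over a disk around `w₀` on the circle, the sheets are indexed by the regular preimages `ζ` of
`w₀`: each is the part of the disk of radius `κ / 4` times the gauge at `ζ` lying over the target
disk. Its radius `t / 2` is the same for all `w₀`, so these disks fill an annulus. -/
theorem HasBoundaryDerivativeBounds.isCoveringOverSymmetricAnnulus (hF : IsInnerFunction F)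
    (h : HasBoundaryDerivativeBounds F) : IsCoveringOverSymmetricAnnulus F := by
  obtain ⟨κ, hs⟩ := h.exists_isLinearizationScale hF
  have hnull := h.1
  have hF0 : ‖F 0‖ < 1 := norm_lt_one hF (by simp)
  have hκ := hs.pos
  have hκ2 := hs.le_half
  obtain ⟨t, ht, htκ, ht0⟩ : ∃ t : ℝ, 0 < t ∧ t ≤ κ / 1024 ∧ ‖F 0‖ ≤ 1 - t / 2 := by
    refine ⟨min (κ / 1024) (1 - ‖F 0‖), lt_min (by positivity) (by linarith), min_le_left _ _, ?_⟩
    have := min_le_right (κ / 1024) (1 - ‖F 0‖)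
    linarith
  set E := reflectedExtension F with hE
  set N : Set ℂ := {z | ∃ ζ ∈ Metric.sphere (0 : ℂ) 1 \ singularSet F,
    ‖z - ζ‖ < κ * boundaryGauge F ζ} with hN
  have hball : ∀ (ζ : ℂ) (r : ℝ), IsOpen {z : ℂ | ‖z - ζ‖ < r} := fun ζ r =>
    isOpen_lt (by fun_prop) continuous_const
  have hNo : IsOpen N := by
    rw [isOpen_iff_mem_nhds]
    rintro z ⟨ζ, hζ, hz⟩
    filter_upwards [(hball _ _).mem_nhds hz] with w hw
    exact ⟨ζ, hζ, hw⟩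
  have hNd : DifferentiableOn ℂ E N := by
    rintro z ⟨ζ, hζ, hz⟩
    exact (hs.differentiableAt ζ hζ z hz).differentiableWithinAt
  have hNstrict : ∀ z ∈ N, map E (𝓝 z) = 𝓝 (E z) := by
    intro z hz
    have h1 : HasStrictDerivAt E (deriv E z) z :=
      (hNd.analyticAt (hNo.mem_nhds hz)).hasStrictDerivAt
    obtain ⟨ζ, hζ, hz⟩ := hz
    exact h1.map_nhds_eq (hs.deriv_ne_zero hF hζ hz)
  have hNS : ∀ z ∈ N, z ∉ singularSet F := by
    rintro z ⟨ζ, hζ, hz⟩ hS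
    have h1 := hs.lipschitz z ζ (by simpa using hS.1) (by simpa using hζ.1)
    have hpos := boundaryGauge_pos hF hζ
    rw [boundaryGauge_of_mem hS, zero_sub, abs_neg, abs_of_pos hpos] at h1
    linarith [norm_nonneg (z - ζ)]
  have hN0 : ∀ z ∈ N, E z ≠ 0 := by
    rintro z ⟨ζ, hζ, hz⟩ h0
    have h1 := hs.gauge_mul_norm_sub_le hF hζ hz (hs.norm_center_sub_lt hF hζ)
    have hpos := boundaryGauge_pos hF hζ
    rw [← hE, h0, zero_sub, norm_neg, norm_reflectedExtension_eq_one hF hζ] at h1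
    nlinarith
  -- every point of the unit circle has a neighbourhood which is evenly covered
  have hsheet : ∀ w₀ : ℂ, ‖w₀‖ = 1 → ∀ w ∈ Metric.ball w₀ (t / 2),
      IsEvenlyCovered (fun z : N => E z) w ((fun z : N => E z) ⁻¹' {w}) := by
    intro w₀ hw₀ w hw
    refine isEvenlyCovered_of_sheets (U := Metric.ball w₀ (t / 2)) Metric.isOpen_ball
      (I := {ζ : ℂ // ζ ∈ Metric.sphere (0 : ℂ) 1 \ singularSet F ∧ E ζ = w₀})
      (V := fun ζ => {z : N | ‖(z : ℂ) - ζ‖ < κ / 4 * boundaryGauge F ζ ∧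
        E z ∈ Metric.ball w₀ (t / 2)}) ?_ ?_ ?_ ?_ ?_ hw
    · intro ζ
      have h1 : IsOpen (N ∩ E ⁻¹' Metric.ball w₀ (t / 2)) :=
        hNd.continuousOn.isOpen_inter_preimage hNo Metric.isOpen_ball
      have h2 := ((hball ζ (κ / 4 * boundaryGauge F ζ)).inter h1).preimage
        (continuous_subtype_val (p := (· ∈ N)))
      convert h2 using 1
      ext z
      exact ⟨fun hz => ⟨hz.1, z.2, hz.2⟩, fun hz => ⟨hz.1, hz.2.2⟩⟩
    · intro z hz
      obtain ⟨ζ, hζ, hζw, hd⟩ := hs.exists_preimage_near hF hnull ht htκ ht0 (hNS z z.2) hw₀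
        (mem_ball_iff_norm.mp hz)
      exact ⟨⟨ζ, hζ, hζw⟩, hd, hz⟩
    -- If two sheets meet, the centre with smaller gauge lies in the linearization disk of the
    -- other, on which `E` is injective.
    · have key : ∀ ζ₁ ∈ Metric.sphere (0 : ℂ) 1 \ singularSet F, ∀ ζ₂ z : ℂ, E ζ₁ = w₀ → E ζ₂ = w₀ →
          ‖z - ζ₁‖ < κ / 4 * boundaryGauge F ζ₁ → ‖z - ζ₂‖ < κ / 4 * boundaryGauge F ζ₂ →
          boundaryGauge F ζ₂ ≤ boundaryGauge F ζ₁ → ζ₂ = ζ₁ := by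
        intro ζ₁ hζ₁ ζ₂ z h1 h2 h3 h4 h5
        have h6 := norm_sub_le_norm_sub_add_norm_sub ζ₂ z ζ₁
        rw [norm_sub_rev ζ₂ z] at h6
        have h7 := hs.norm_sub_le hF hζ₁ (u := ζ₂)
          (by nlinarith [mul_pos hκ (boundaryGauge_pos hF hζ₁)]) (hs.norm_center_sub_lt hF hζ₁)
        rw [← hE, h1, h2, sub_self, norm_zero, mul_zero, mul_zero] at h7
        exact sub_eq_zero.mp (norm_le_zero_iff.mp h7)
      rintro ⟨ζ₁, hζ₁, h1⟩ ⟨ζ₂, hζ₂, h2⟩ z ⟨h3, -⟩ ⟨h4, -⟩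
      rcases le_total (boundaryGauge F ζ₂) (boundaryGauge F ζ₁) with hle | hle
      · exact Subtype.ext (key ζ₁ hζ₁ ζ₂ z h1 h2 h3 h4 hle).symm
      · exact Subtype.ext (key ζ₂ hζ₂ ζ₁ z h2 h1 h4 h3 hle)
    · rintro ⟨ζ, hζ, hζw⟩
      have hpos := boundaryGauge_pos hF hζ
      refine ⟨fun z hz => hz.2, ?_, ?_⟩
      · rintro z ⟨hz, -⟩ z' ⟨hz', -⟩ he
        have h7 := hs.norm_sub_le hF hζ (u := z) (v := z') (hz.trans (by gcongr; linarith))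
          (hz'.trans (by gcongr; linarith))
        rw [← hE, show E z = E z' from he, sub_self, norm_zero, mul_zero, mul_zero] at h7
        exact Subtype.ext (sub_eq_zero.mp (norm_le_zero_iff.mp h7))
      · intro v hv
        obtain ⟨z, hz, hzv⟩ := hs.ball_subset_image hF hζ (t := κ / 8) (by linarith) (by linarith)
          (w := v) (by
            rw [← hE, hζw]
            rw [mem_ball_iff_norm] at hv
            linarith)
        refine ⟨⟨z, ζ, hζ, hz.trans_lt (by gcongr; linarith)⟩, ⟨hz.trans_lt ?_, ?_⟩, hzv⟩
        · change κ / 8 * boundaryGauge F ζ < κ / 4 * boundaryGauge F ζ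
          gcongr
          norm_num
        · change E z ∈ _
          rwa [hE, hzv]
    · intro z _
      have h1 : (fun z : N => E z) = E ∘ Subtype.val := rfl
      rw [h1, ← Filter.map_map, hNo.isOpenEmbedding_subtypeVal.map_nhds_eq]
      exact hNstrict z z.2
  have hmemN : ∀ (w₀ z : ℂ), ‖w₀‖ = 1 → z ∉ singularSet F → E z ∈ Metric.ball w₀ (t / 2) →
      z ∈ N := by
    intro w₀ z hw₀ hz hEz
    obtain ⟨ζ, hζ, -, hd⟩ := hs.exists_preimage_near hF hnull ht htκ ht0 hz hw₀
      (mem_ball_iff_norm.mp hEz)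
    have := boundaryGauge_pos hF hζ
    exact ⟨ζ, hζ, hd.trans (by gcongr; linarith)⟩
  have hnot : ∀ z : N, ((z : ℂ) : OnePoint ℂ) ∉ ((↑) : ℂ → OnePoint ℂ) '' singularSet F := by
    rintro z ⟨u, hu, huz⟩
    rw [OnePoint.coe_injective huz] at hu
    exact hNS z z.2 hu
  have hi : IsOpenEmbedding fun z : N => (⟨((z : ℂ) : OnePoint ℂ), hnot z⟩ :
      {p : OnePoint ℂ // p ∉ ((↑) : ℂ → OnePoint ℂ) '' singularSet F}) := by
    refine IsOpenEmbedding.of_comp _ isOpen_compl_image_singularSet.isOpenEmbedding_subtypeVal ?_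
    exact OnePoint.isOpenEmbedding_coe.comp hNo.isOpenEmbedding_subtypeVal
  have hcomm : ∀ z : N, sphereExtension F ((z : ℂ) : OnePoint ℂ) = (E z : OnePoint ℂ) := by
    refine fun z => sphereExtension_coe fun hz h0 => hN0 z z.2 ?_
    rw [hE, reflectedExtension_of_gt hz, schwarzReflection, h0, map_zero, inv_zero]
  -- For `w` in this annulus, `w / ‖w‖` is at distance `|1 - ‖w‖| < t / 2`.
  refine ⟨1 / (1 + t / 2), by positivity, by rw [div_lt_one] <;> linarith, ?_⟩
  rintro _ ⟨w, ⟨hw1, hw2⟩, rfl⟩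
  rw [one_div_one_div] at hw2
  rw [div_lt_iff₀ (by linarith)] at hw1
  have hw0 : w ≠ 0 := by
    rintro rfl
    rw [norm_zero] at hw1
    linarith
  have hw3 : w ∈ Metric.ball (w / ‖w‖) (t / 2) := by
    rw [mem_ball_iff_norm, norm_sub_div_norm hw0, abs_lt]
    constructor <;> nlinarith
  have hW := norm_div_norm hw0
  set w₀ : ℂ := w / ‖w‖ with hw₀
  refine IsEvenlyCovered.to_isEvenlyCovered_preimage ((isEvenlyCovered_iff_of_isOpenEmbedding hi
    OnePoint.isOpenEmbedding_coe hcomm (W := Metric.ball w₀ (t / 2)) Metric.isOpen_ball ?_ ?_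
    hw3).mpr (hsheet w₀ hW w hw3))
  · exact Metric.isOpen_ball.preimage (continuousOn_iff_continuous_domRestrict.mp hNd.continuousOn)
  rintro ⟨p, hp⟩ ⟨u, hu, hup⟩
  have hu1 : ‖u‖ < 1 + t / 2 := by
    have := norm_sub_norm_le u w₀
    rw [mem_ball_iff_norm] at hu
    linarith
  suffices hsuff : ∃ z ∈ N, (z : OnePoint ℂ) = p by
    obtain ⟨z, hz, rfl⟩ := hsuff
    exact ⟨⟨z, hz⟩, rfl⟩
  induction p using OnePoint.rec with
  | infty =>
    -- The value at `∞` is the reflection of `F 0`; since `‖F 0‖ ≤ 1 - t / 2`, it is too large to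
    -- lie in the target disk.
    obtain ⟨h1, h2⟩ := circleReflection_eq_coe hup.symm
    rw [h2, norm_inv_conj, inv_lt_iff_one_lt_mul₀ (norm_pos_iff.mpr h1)] at hu1
    nlinarith
  | coe z =>
    have hzS : z ∉ singularSet F := fun hS => hp (mem_image_of_mem _ hS)
    refine ⟨z, hmemN w₀ z hW hzS ?_, rfl⟩
    have h1 : sphereExtension F (z : OnePoint ℂ) = (E z : OnePoint ℂ) := by
      refine sphereExtension_coe fun hz h0 => ?_
      have h2 : sphereExtension F (z : OnePoint ℂ) = (u : OnePoint ℂ) := hup.symm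
      rw [sphereExtension_coe_of_gt hz] at h2
      exact (circleReflection_eq_coe h2).1 h0
    rw [← OnePoint.coe_injective (hup.trans h1)]
    exact hu

end SymmetricCovering

end

/-! ### The cycle of implications. -/

theorem mainTheorem9 (F : ℂ → ℂ) (hF : IsInnerFunction F) :
    [HasConnectedSublevel F, IsCoveringOverAnnulus F, IsCoveringOverSymmetricAnnulus F,
      HasBoundaryDerivativeBounds F].TFAE ∧
    ((HasConnectedSublevel F ∨ IsCoveringOverAnnulus F ∨ IsCoveringOverSymmetricAnnulus F ∨
        HasBoundaryDerivativeBounds F) →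
      singularSet F =
        {ζ : ℂ | ζ ∈ Metric.sphere (0 : ℂ) 1 ∧ ¬ HasUnimodularRadialLimit F ζ}) := by
  have had : HasConnectedSublevel F → HasBoundaryDerivativeBounds F := fun h =>
    (HasConnectedSublevel.boundary_properties hF h).1
  have hdc : HasBoundaryDerivativeBounds F → IsCoveringOverSymmetricAnnulus F := fun h =>
    h.isCoveringOverSymmetricAnnulus hF
  have hcb : IsCoveringOverSymmetricAnnulus F → IsCoveringOverAnnulus F := fun h =>
    h.isCoveringOverAnnulus hF
  have hba : IsCoveringOverAnnulus F → HasConnectedSublevel F := fun h =>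
    IsCoveringOverAnnulus.hasConnectedSublevel hF h
  constructor
  · tfae_have 1 → 4 := had
    tfae_have 4 → 3 := hdc
    tfae_have 3 → 2 := hcb
    tfae_have 2 → 1 := hba
    tfae_finish
  · intro h
    have ha : HasConnectedSublevel F := by
      rcases h with h | h | h | h
      exacts [h, hba h, hba (hcb h), hba (hcb (hdc h))]
    exact (HasConnectedSublevel.boundary_properties hF ha).2
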